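/- Let $G=(V,E)$ be a finite, weakly connected directed graph without self-loops and parallel edges that is Eulerian, i.e. has an Eulerian circuit (a closed walk passing through every edge exactly once). A walk $(u_0,\dots,u_\ell)$ \emph{appears} in a circuit $(v_0,\dots,v_k)$, $v_0=v_k$, if $\ell\le k-1$ and for some $i\in\{0,\dots,k-1\}$ we have $u_j=v_{(i+j)\bmod k}$ for all $0\le j\le \ell$. A walk of $G$ is \emph{safe} if it appears in all Eulerian circuits of $G$, and a \emph{maximal safe walk} is a safe walk that is not a subwalk of another safe walk. Let $d(v)$ be the out-degree of $v$, let $U(G)$ be the underlying undirected graph, and let \[A(G)=\{v\in V \mid d(v)=1,\ \text{or}\ d(v)=2\ \text{and}\ U(G)\setminus v\ \text{is not connected}\}.\] There is an algorithm (a single program of a unit-cost random access machine, with successor and predecessor as its only arithmetic operations) which, given the number of nodes and the list of the edges of any such $G$ in any order, halts after $O(|E|)$ steps (at most $c\,(|E|+1)$ steps, with an absolute constant $c$) and outputs a list $L$ of walks of $G$ such that: (1) If $A(G)\neq V$, then $L$ contains every maximal safe walk of $G$ exactly once and nothing else. Moreover, for every Eulerian circuit $C$ of $G$, the maximal safe walks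 are exactly the segments obtained by cutting $C$ at every node not in $A(G)$, i.e. the non-empty walks that appear in $C$, whose two end nodes are not in $A(G)$ and whose internal nodes are all in $A(G)$. (2) If $A(G)=V$ (so that there is no node to cut at), then $L$ consists of one Eulerian circuit $C$; every Eulerian circuit of $G$ is a rotation of $C$, and the maximal safe walks are exactly the walks of length $|E|-1$ that appear in $C$. (3) The walks in $L$ are pairwise edge-disjoint and have total length $|E|$. In particular, if $A(G)\ne V$, the maximal safe walks are pairwise edge-disjoint and have total length exactly $|E|$. -/

import Mathlib

/-! ### Walks, Eulerian circuits and safe walks in digraphs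

A walk `(v₀, …, v_k)` is the list of its nodes.  A `Digraph` has no parallel edges, so a walk is
determined by its nodes. -/

namespace EulerSafe

variable {V : Type*}

/-- `W = (v₀, …, v_k)` is a walk of `G`. -/
def IsWalk (G : Digraph V) (W : List V) : Prop :=
  W ≠ [] ∧ W.IsChain G.Adj

/-- The string of edges `(v₀,v₁), (v₁,v₂), …` of a walk. -/
def walkEdges (W : List V) : List (V × V) :=
  W.zip W.tail

/-- The length `k` of a walk `(v₀, …, v_k)`, i.e. its number of edges. -/
def walkLength (W : List V) : ℕ :=
  W.length - 1

/-- An Eulerian circuit: a closed walk passing through every edge exactly once. -/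
def IsEulerianCircuit (G : Digraph V) (C : List V) : Prop :=
  IsWalk G C ∧ C.head? = C.getLast? ∧ (walkEdges C).Nodup ∧
    ∀ u v, G.Adj u v → (u, v) ∈ walkEdges C

/-- `Q = (u₀, …, u_ℓ)` appears in the circuit `C = (v₀, …, v_k)`: `ℓ ≤ k - 1`, and for some
`i ∈ {0, …, k-1}` one has `u_j = v_{(i+j) mod k}` for all `j ∈ {0, …, ℓ}`. -/
def AppearsInCircuit (Q C : List V) : Prop :=
  walkLength Q + 1 ≤ walkLength C ∧
    ∃ i < walkLength C, ∀ j < Q.length, Q[j]? = C[(i + j) % walkLength C]?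

/-- A safe walk: it appears in all Eulerian circuits of `G`. -/
def IsSafe (G : Digraph V) (Q : List V) : Prop :=
  IsWalk G Q ∧ ∀ C, IsEulerianCircuit G C → AppearsInCircuit Q C

/-- A maximal safe walk: a safe walk that is not a subwalk of another safe walk. -/
def IsMaximalSafe (G : Digraph V) (Q : List V) : Prop :=
  IsSafe G Q ∧ ∀ Q', IsSafe G Q' → Q <:+: Q' → Q' = Q

/-- The number `d(v)` of out-neighbors of `v`. -/
noncomputable def outDegree (G : Digraph V) (v : V) : ℕ :=
  {w | G.Adj v w}.ncard

/-- `v` is a cut node of the undirected graph `H`: deleting `v` leaves a disconnected graph. -/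
def IsCutNode (H : SimpleGraph V) (v : V) : Prop :=
  ¬ (H.induce {v}ᶜ).Connected

/-- The set `A(G)`: the nodes of degree `1`, and the nodes of degree `2` that are cut nodes of the
underlying undirected graph. -/
def forcedNodes (G : Digraph V) : Set V :=
  {v | outDegree G v = 1 ∨ (outDegree G v = 2 ∧ IsCutNode G.toSimpleGraphInclusive v)}

/-- `Q` is one of the segments obtained by cutting the circuit `C` at every node not in `A(G)`:
a non-empty stretch of `C` whose two end nodes are not in `A(G)` and all of whose internal nodes
are in `A(G)`. -/
def IsCutSegment (G : Digraph V) (C Q : List V) : Prop :=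
  AppearsInCircuit Q C ∧ 1 ≤ walkLength Q ∧
    (∀ v ∈ Q.head?, v ∉ forcedNodes G) ∧ (∀ v ∈ Q.getLast?, v ∉ forcedNodes G) ∧
    ∀ v ∈ Q.tail.dropLast, v ∈ forcedNodes G

end EulerSafe

/-! ### A unit-cost random access machine

The machine has registers and (infinite) arrays of natural numbers and a write-only output tape.
A program is a finite text and so names finitely many registers and arrays.  Arithmetic is
restricted to successor and predecessor; hence in `t` steps numbers grow by at most `t` beyond the input and
the constants of the program, and unit
cost hides no long-number arithmetic. -/

namespace RAM

/-- A configuration of the memory and of the output tape. -/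
structure State where
  /-- contents of the registers -/
  reg : ℕ → ℕ
  /-- `arr a i` is the cell `i` of the array `a` -/
  arr : ℕ → ℕ → ℕ
  /-- the numbers written so far -/
  out : List ℕ

/-- Expressions: constants, registers, successor, predecessor, array access. -/
inductive Expr
  | lit (c : ℕ)
  | reg (r : ℕ)
  | succ (e : Expr)
  | pred (e : Expr)
  | get (a : ℕ) (e : Expr)

/-- The value of an expression. -/
def Expr.eval (s : State) : Expr → ℕ
  | .lit c => c
  | .reg r => s.reg r
  | .succ e => e.eval s + 1
  | .pred e => e.eval s - 1
  | .get a e => s.arr a (e.eval s)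

/-- The number of steps to evaluate an expression: one for every operation. -/
def Expr.cost : Expr → ℕ
  | .lit _ => 1
  | .reg _ => 1
  | .succ e => e.cost + 1
  | .pred e => e.cost + 1
  | .get _ e => e.cost + 1

/-- Tests: comparisons of two expressions and their Boolean combinations. -/
inductive Test
  | eq (e f : Expr)
  | lt (e f : Expr)
  | not (b : Test)
  | and (b c : Test)

/-- The outcome of a test. -/
def Test.holds (s : State) : Test → Prop
  | .eq e f => e.eval s = f.eval s
  | .lt e f => e.eval s < f.eval s
  | .not b => ¬ b.holds s
  | .and b c => b.holds s ∧ c.holds s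

/-- The number of steps to evaluate a test. -/
def Test.cost : Test → ℕ
  | .eq e f => e.cost + f.cost + 1
  | .lt e f => e.cost + f.cost + 1
  | .not b => b.cost + 1
  | .and b c => b.cost + c.cost + 1

/-- Programs. -/
inductive Prog
  | skip
  | assign (r : ℕ) (e : Expr)
  | store (a : ℕ) (i e : Expr)
  | write (e : Expr)
  | seq (p q : Prog)
  | ite (b : Test) (p q : Prog)
  | while (b : Test) (p : Prog)

/-- `Exec p s s' t`: started in `s`, the program `p` halts in `s'` after exactly `t` steps. -/
inductive Exec : Prog → State → State → ℕ → Prop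
  | skip (s : State) : Exec .skip s s 1
  | assign (r : ℕ) (e : Expr) (s : State) :
      Exec (.assign r e) s { s with reg := Function.update s.reg r (e.eval s) } (e.cost + 1)
  | store (a : ℕ) (i e : Expr) (s : State) :
      Exec (.store a i e) s
        { s with arr := Function.update s.arr a
                          (Function.update (s.arr a) (i.eval s) (e.eval s)) }
        (i.cost + e.cost + 1)
  | write (e : Expr) (s : State) :
      Exec (.write e) s { s with out := s.out ++ [e.eval s] } (e.cost + 1)
  | seq (p q : Prog) (s₁ s₂ s₃ : State) (t u : ℕ) :
      Exec p s₁ s₂ t → Exec q s₂ s₃ u → Exec (.seq p q) s₁ s₃ (t + u)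
  | ite_true (b : Test) (p q : Prog) (s s' : State) (t : ℕ) :
      b.holds s → Exec p s s' t → Exec (.ite b p q) s s' (b.cost + t)
  | ite_false (b : Test) (p q : Prog) (s s' : State) (t : ℕ) :
      ¬ b.holds s → Exec q s s' t → Exec (.ite b p q) s s' (b.cost + t)
  | while_true (b : Test) (p : Prog) (s₁ s₂ s₃ : State) (t u : ℕ) :
      b.holds s₁ → Exec p s₁ s₂ t → Exec (.while b p) s₂ s₃ u →
        Exec (.while b p) s₁ s₃ (b.cost + t + u)
  | while_false (b : Test) (p : Prog) (s : State) :
      ¬ b.holds s → Exec (.while b p) s s b.cost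

/-- The initial state for a digraph on the nodes `0, …, n-1` given by the list `E` of its edges in
any order: register `0` holds `n`, register `1` holds `|E|`, and the cells number `i` of the arrays
`0` and `1` hold the tail and the head of the `i`-th edge; everything else is `0`. -/
def edgeListInput {n : ℕ} (E : List (Fin n × Fin n)) : State where
  reg r := if r = 0 then n else if r = 1 then E.length else 0
  arr a i :=
    if a = 0 then (E.map fun e => (e.1 : ℕ)).getD i 0
    else if a = 1 then (E.map fun e => (e.2 : ℕ)).getD i 0
    else 0
  out := []

/-- A list of walks on the output tape: the walks one after the other, node `v` written as the
number `v + 1`, and every walk ended by a `0`. -/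
def encodeWalks {n : ℕ} (L : List (List (Fin n))) : List ℕ :=
  L.flatMap fun W => (W.map fun v => (v : ℕ) + 1) ++ [0]

end RAM

namespace EulerSafe

variable {V : Type*}

/-! ### Edges of walks -/

/-! Everything reduces to one local question: when an Eulerian circuit enters a node `v` by a given
edge, is the edge by which it leaves the same in all Eulerian circuits? The answer is yes exactly
for `v` in `A(G)`.

If `d(v) = 1`, there is no choice. If `d(v) = 2`, the two visits to `v` split the circuit into two
stretches. When some other node lies on both stretches (the visits are `Interlaced` with two visits
to that node), `v` is not a cut node, and rearranging the four pieces between these visits changes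
the continuation at `v`. When no node is shared, `v` is a cut node; any circuit that leaves `v` into
a stretch can return to `v` only by the edge that ends that stretch, so the continuation is forced.
If `d(v) ≥ 3`, three closed pieces at `v` can be reordered. These facts are `forced_transition_zero`
and `unforced_transition_zero`.

Since an edge occurs once in a circuit, a stretch with forced internal nodes is determined by its
first edge. Hence (`isSafe_iff`) the safe walks are the stretches of fewer than `|E|` edges of any
one Eulerian circuit whose internal nodes all lie in `A(G)`. The maximal ones are cut off by
unforced nodes; the length bound does not interfere, because an unforced node occurs at least twice
per period. If every node is forced, only the length bound matters, and the circuit is unique up to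
rotation. Cutting a circuit keeps each edge once, which gives disjointness and total length
(`cutAt_spec`).

The algorithm finds a circuit by Hierholzer's method, tallies the visits to each node, and
recognizes the cut nodes of degree two by a parenthesis matching: `v` with visits `p < q` is a cut
node iff no node is visited both strictly between them and outside (`isCutNode_iff`). Nested
candidates are kept on a stack and dropped when crossed. Potentials of the form "twice the remaining
input plus the stack height" make the search and the scan linear. -/

theorem walkEdges_singleton (a : V) : walkEdges [a] = [] := rfl

theorem walkEdges_cons_cons (a b : V) (l : List V) :
    walkEdges (a :: b :: l) = (a, b) :: walkEdges (b :: l) := rfl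

theorem walkEdges_append_cons (l : List V) (x : V) (l' : List V) :
    walkEdges (l ++ x :: l') = walkEdges (l ++ [x]) ++ walkEdges (x :: l') := by
  induction l with
  | nil => rfl
  | cons a l ih =>
    cases l with
    | nil => rfl
    | cons b l => simpa [walkEdges_cons_cons] using ih

theorem length_walkEdges (W : List V) : (walkEdges W).length = walkLength W := by
  simp [walkEdges, walkLength]

theorem isChain_iff_walkEdges {R : V → V → Prop} (W : List V) :
    W.IsChain R ↔ ∀ e ∈ walkEdges W, R e.1 e.2 := by
  induction W with
  | nil => simp [walkEdges]
  | cons a l ih =>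
    cases l with
    | nil => simp [walkEdges_singleton]
    | cons b l => rw [List.isChain_cons_cons, walkEdges_cons_cons, List.forall_mem_cons, ih]

theorem walkEdges_map {β : Type*} (f : V → β) (W : List V) :
    walkEdges (W.map f) = (walkEdges W).map (Prod.map f f) := by
  simp [walkEdges, ← List.map_tail, List.zip_map]

/-- An Eulerian circuit is a closed node list whose edges are the edges of `G`, each once. -/
theorem isEulerianCircuit_iff (G : Digraph V) (C : List V) :
    IsEulerianCircuit G C ↔ C ≠ [] ∧ C.head? = C.getLast? ∧ (walkEdges C).Nodup ∧
      ∀ u v, G.Adj u v ↔ (u, v) ∈ walkEdges C := by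
  unfold IsEulerianCircuit IsWalk
  rw [isChain_iff_walkEdges]
  constructor
  · rintro ⟨⟨h1, h2⟩, h3, h4, h5⟩
    exact ⟨h1, h3, h4, fun u v => ⟨h5 u v, fun h => h2 _ h⟩⟩
  · rintro ⟨h1, h3, h4, h5⟩
    exact ⟨⟨h1, fun e he => (h5 _ _).2 he⟩, h3, h4, fun u v => (h5 u v).1⟩

/-- Being Eulerian depends only on closedness and on the edges up to order. This is how rerouted
circuits are recognized. -/
theorem IsEulerianCircuit.of_perm {G : Digraph V} {C C' : List V} (h : IsEulerianCircuit G C)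
    (hne : C' ≠ []) (hcl : C'.head? = C'.getLast?) (hp : (walkEdges C').Perm (walkEdges C)) :
    IsEulerianCircuit G C' := by
  rw [isEulerianCircuit_iff] at h ⊢
  exact ⟨hne, hcl, hp.nodup_iff.2 h.2.2.1, fun u v => by rw [hp.mem_iff]; exact h.2.2.2 u v⟩

theorem IsEulerianCircuit.perm {G : Digraph V} {C C' : List V} (h : IsEulerianCircuit G C)
    (h' : IsEulerianCircuit G C') : (walkEdges C).Perm (walkEdges C') := by
  rw [isEulerianCircuit_iff] at h h'
  rw [List.perm_ext_iff_of_nodup h.2.2.1 h'.2.2.1]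
  rintro ⟨u, v⟩
  rw [← h.2.2.2, ← h'.2.2.2]

/-! ### Windows of sequences -/

/-- The `n` consecutive terms of the sequence `c` that start at the index `s`. -/
def window (c : ℕ → V) (s n : ℕ) : List V :=
  (List.range n).map fun j => c (s + j)

@[simp] theorem length_window (c : ℕ → V) (s n : ℕ) : (window c s n).length = n := by
  simp [window]

@[simp] theorem window_zero (c : ℕ → V) (s : ℕ) : window c s 0 = [] := rfl

theorem window_add (c : ℕ → V) (s m n : ℕ) :
    window c s (m + n) = window c s m ++ window c (s + m) n := by
  simp [window, List.range_add, Nat.add_assoc, Function.comp_def]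

theorem window_succ (c : ℕ → V) (s n : ℕ) : window c s (n + 1) = c s :: window c (s + 1) n := by
  rw [Nat.add_comm n 1, window_add]; rfl

theorem window_succ_last (c : ℕ → V) (s n : ℕ) :
    window c s (n + 1) = window c s n ++ [c (s + n)] := window_add c s n 1

theorem getElem?_window (c : ℕ → V) (s n j : ℕ) (h : j < n) :
    (window c s n)[j]? = some (c (s + j)) := by
  simp [window, h]

theorem mem_window {c : ℕ → V} {s n : ℕ} {v : V} :
    v ∈ window c s n ↔ ∃ j < n, c (s + j) = v := by
  simp [window]

theorem window_congr {c c' : ℕ → V} {s s' n : ℕ} (h : ∀ j < n, c (s + j) = c' (s' + j)) :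
    window c s n = window c' s' n := by
  apply List.map_congr_left
  intro j hj
  exact h j (List.mem_range.1 hj)

theorem eq_of_window_eq {c c' : ℕ → V} {s s' n : ℕ} (h : window c s n = window c' s' n) (j : ℕ)
    (hj : j < n) : c (s + j) = c' (s' + j) := by
  have := getElem?_window c s n j hj
  rw [h, getElem?_window c' s' n j hj] at this
  exact (Option.some.inj this).symm

theorem window_tail_dropLast (c : ℕ → V) (s n : ℕ) :
    (window c s n).tail.dropLast = window c (s + 1) (n - 2) := by
  rcases n with _ | _ | n
  · rfl
  · rfl
  · rw [window_succ, List.tail_cons, window_succ_last, List.dropLast_concat]; rfl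

theorem window_head? (c : ℕ → V) (s n : ℕ) : (window c s (n + 1)).head? = some (c s) := by
  rw [window_succ]; rfl

theorem window_getLast? (c : ℕ → V) (s n : ℕ) :
    (window c s (n + 1)).getLast? = some (c (s + n)) := by
  rw [window_succ_last]; simp

theorem walkEdges_window (c : ℕ → V) (s n : ℕ) :
    walkEdges (window c s (n + 1)) = window (fun i => (c i, c (i + 1))) s n := by
  induction n generalizing s with
  | zero => rfl
  | succ n ih =>
    rw [window_succ, window_succ, walkEdges_cons_cons, ← window_succ, ih,
      window_succ (fun i => (c i, c (i + 1)))]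

theorem subwalk_window {c : ℕ → V} {s n : ℕ} {Q : List V} (h : Q <:+: window c s n) :
    ∃ a, a + Q.length ≤ n ∧ Q = window c (s + a) Q.length := by
  obtain ⟨A, B, h⟩ := h
  have hn : A.length + Q.length + B.length = n := by
    have := congrArg List.length h
    simpa [Nat.add_assoc] using this
  refine ⟨A.length, by omega, ?_⟩
  rw [← hn, window_add, window_add] at h
  have h1 := List.append_inj h (by simp)
  have h2 := List.append_inj h1.1 (by simp)
  exact h2.2

theorem window_subwalk (c : ℕ → V) (s n a m : ℕ) (h : a + m ≤ n) :
    window c (s + a) m <:+: window c s n := by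
  obtain ⟨b, rfl⟩ := Nat.exists_eq_add_of_le h
  exact ⟨window c s a, window c (s + (a + m)) b, by rw [window_add, window_add]⟩

/-! ### Eulerian circuits as periodic sequences -/

/-- The periodic sequence of nodes read off an Eulerian circuit with `k ≥ 1` edges. -/
structure IsEulerSeq (G : Digraph V) (k : ℕ) (c : ℕ → V) : Prop where
  pos : 0 < k
  periodic : ∀ i, c (i + k) = c i
  adj : ∀ i, G.Adj (c i) (c (i + 1))
  inj : ∀ i j, c i = c j → c (i + 1) = c (j + 1) → i ≡ j [MOD k]
  surj : ∀ u v, G.Adj u v → ∃ i < k, c i = u ∧ c (i + 1) = v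

theorem periodic_mod {c : ℕ → V} {k : ℕ} (h : ∀ i, c (i + k) = c i) (i : ℕ) : c (i % k) = c i :=
  Function.Periodic.map_mod_nat h i

namespace IsEulerSeq

variable {G : Digraph V} {k : ℕ} {c c' : ℕ → V}

theorem congr (h : IsEulerSeq G k c) {i j : ℕ} (hij : i ≡ j [MOD k]) : c i = c j := by
  rw [← periodic_mod h.periodic i, ← periodic_mod h.periodic j, hij]

theorem shift (h : IsEulerSeq G k c) (s : ℕ) : IsEulerSeq G k (fun i => c (s + i)) where
  pos := h.pos
  periodic i := by rw [← Nat.add_assoc]; exact h.periodic _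
  adj i := h.adj _
  inj i j h1 h2 := Nat.ModEq.add_left_cancel' s (h.inj _ _ h1 h2)
  surj u v huv := by
    obtain ⟨i, -, h1, h2⟩ := h.surj u v huv
    have hk := h.pos
    -- `(k - 1) * s` plays the role of `-s` modulo `k` without leaving the natural numbers.
    have key : s + (i + (k - 1) * s) % k ≡ i [MOD k] := by
      have : s + (i + (k - 1) * s) = i + k * s := by
        obtain ⟨k, rfl⟩ := Nat.exists_eq_succ_of_ne_zero hk.ne'
        simp; ring
      calc s + (i + (k - 1) * s) % k ≡ s + (i + (k - 1) * s) [MOD k] :=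
            Nat.ModEq.add_left _ (Nat.mod_modEq _ _)
        _ = i + k * s := this
        _ ≡ i [MOD k] := by simp [Nat.ModEq]
    refine ⟨(i + (k - 1) * s) % k, Nat.mod_lt _ hk, ?_, ?_⟩
    · rw [← h1]; exact h.congr key
    · rw [← h2]; exact h.congr (key.add_right 1)

theorem isEulerianCircuit (h : IsEulerSeq G k c) (s : ℕ) :
    IsEulerianCircuit G (window c s (k + 1)) := by
  rw [isEulerianCircuit_iff, walkEdges_window]
  refine ⟨by rw [window_succ]; simp, ?_, ?_, ?_⟩
  · rw [window_head?, window_getLast?, h.periodic]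
  · refine (List.nodup_map_iff_inj_on List.nodup_range).2 ?_
    intro i hi j hj hij
    have h2 := Nat.ModEq.add_left_cancel' s
      (h.inj _ _ (congrArg Prod.fst hij) (congrArg Prod.snd hij))
    exact Nat.ModEq.eq_of_lt_of_lt h2 (List.mem_range.1 hi) (List.mem_range.1 hj)
  · intro u v
    rw [mem_window]
    constructor
    · intro huv
      obtain ⟨i, hi, h1, h2⟩ := (h.shift s).surj u v huv
      exact ⟨i, hi, by rw [← h1, ← h2]; rfl⟩
    · rintro ⟨j, -, hj⟩
      have := h.adj (s + j)
      rw [Prod.mk.injEq] at hj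
      rwa [hj.1, hj.2] at this

theorem eq_of_lt (h : IsEulerSeq G k c) {i j : ℕ} (hi : i < k) (hj : j < k) (h1 : c i = c j)
    (h2 : c (i + 1) = c (j + 1)) : i = j :=
  Nat.ModEq.eq_of_lt_of_lt (h.inj _ _ h1 h2) hi hj

end IsEulerSeq

/-- Reading the list modulo its length in edges ignores the repeated last node. Closedness is what
makes the last entry agree with the entry at index `0`. -/
theorem IsEulerianCircuit.exists_seq {G : Digraph V} {C : List V} (h : IsEulerianCircuit G C)
    (hk : 0 < walkLength C) :
    ∃ c, IsEulerSeq G (walkLength C) c ∧ C = window c 0 (walkLength C + 1) := by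
  obtain ⟨hne, hcl, hnd, hadj⟩ := (isEulerianCircuit_iff G C).1 h
  set k := walkLength C with hkdef
  have hlen : C.length = k + 1 := by
    have := List.length_pos_of_ne_nil hne
    simp only [hkdef, walkLength]; omega
  let c : ℕ → V := fun i => C[i % k]'(by have := Nat.mod_lt i hk; omega)
  have hper : ∀ i, c (i + k) = c i := by intro i; simp [c]
  have hlast : C[k]'(by omega) = C[0]'(by omega) := by
    rw [List.head?_eq_getElem?, List.getLast?_eq_getElem?, hlen,
      List.getElem?_eq_getElem (by omega), List.getElem?_eq_getElem (by omega)] at hcl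
    exact (Option.some.inj hcl).symm
  have hC : C = window c 0 (k + 1) := by
    apply List.ext_getElem (by simp [hlen])
    intro i h1 h2
    have hi : i ≤ k := by omega
    simp only [window, List.getElem_map, List.getElem_range, Nat.zero_add, c]
    rcases hi.lt_or_eq with hi | rfl
    · simp [Nat.mod_eq_of_lt hi]
    · simp [hlast]
  refine ⟨c, ?_, hC⟩
  rw [hC, walkEdges_window] at hnd hadj
  have hinj : ∀ i j, i < k → j < k → c i = c j → c (i + 1) = c (j + 1) → i = j := by
    intro i j hi hj h1 h2
    refine (List.nodup_map_iff_inj_on List.nodup_range).1 hnd i (List.mem_range.2 hi) j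
      (List.mem_range.2 hj) ?_
    simp [h1, h2]
  have hsucc : ∀ i, c (i % k + 1) = c (i + 1) := by
    intro i
    rw [← periodic_mod hper (i % k + 1), ← periodic_mod hper (i + 1)]
    simp
  refine ⟨hk, hper, ?_, ?_, ?_⟩
  · intro i
    rw [hadj, mem_window]
    exact ⟨i % k, Nat.mod_lt _ hk, by simp [hsucc, periodic_mod hper]⟩
  · intro i j h1 h2
    refine hinj _ _ (Nat.mod_lt _ hk) (Nat.mod_lt _ hk) ?_ ?_
    · rw [periodic_mod hper, periodic_mod hper, h1]
    · rw [hsucc, hsucc, h2]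
  · intro u v huv
    obtain ⟨i, hi, hh⟩ := mem_window.1 ((hadj u v).1 huv)
    simp only [Nat.zero_add, Prod.mk.injEq] at hh
    exact ⟨i, hi, hh⟩

/-- Along a periodic sequence the modular indices disappear, and so does the starting point `s` of
the circuit; only the length bound survives. -/
theorem appearsInCircuit_window {c : ℕ → V} {k : ℕ} (hk : 0 < k) (hper : ∀ i, c (i + k) = c i)
    (s : ℕ) (Q : List V) :
    AppearsInCircuit Q (window c s (k + 1)) ↔
      walkLength Q + 1 ≤ k ∧ ∃ i, Q = window c i Q.length := by
  have hwl : walkLength (window c s (k + 1)) = k := by simp [walkLength]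
  unfold AppearsInCircuit
  rw [hwl]
  refine and_congr_right fun _ => ⟨?_, ?_⟩
  · rintro ⟨i, -, h⟩
    refine ⟨s + i, ?_⟩
    apply List.ext_getElem?
    intro j
    by_cases hj : j < Q.length
    · have hlt := Nat.mod_lt (i + j) hk
      rw [h j hj, getElem?_window _ _ _ _ (by omega), getElem?_window _ _ _ _ hj,
        ← periodic_mod hper (s + i + j), ← periodic_mod hper (s + (i + j) % k)]
      simp [Nat.add_assoc]
    · rw [List.getElem?_eq_none (by omega), List.getElem?_eq_none (by simp; omega)]
  · rintro ⟨i, hi⟩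
    refine ⟨(i + (k - 1) * s) % k, Nat.mod_lt _ hk, fun j hj => ?_⟩
    have hlt := Nat.mod_lt ((i + (k - 1) * s) % k + j) hk
    rw [hi, getElem?_window _ _ _ _ hj, getElem?_window _ _ _ _ (by omega)]
    congr 1
    rw [← periodic_mod hper, ← periodic_mod hper (s + _)]
    congr 1
    have : s + (i + (k - 1) * s + j) = i + j + k * s := by
      obtain ⟨k, rfl⟩ := Nat.exists_eq_succ_of_ne_zero hk.ne'
      simp; ring
    simp [this]

theorem AppearsInCircuit.of_subwalk {c : ℕ → V} {k : ℕ} (hk : 0 < k) (hper : ∀ i, c (i + k) = c i)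
    {s : ℕ} {Q Q' : List V} (h : AppearsInCircuit Q' (window c s (k + 1))) (hi : Q <:+: Q') :
    AppearsInCircuit Q (window c s (k + 1)) := by
  rw [appearsInCircuit_window hk hper] at h ⊢
  obtain ⟨h1, i, h2⟩ := h
  have hl := hi.length_le
  rw [h2] at hi
  obtain ⟨a, -, ha⟩ := subwalk_window hi
  refine ⟨?_, _, ha⟩
  unfold walkLength at h1 ⊢
  omega

variable {G : Digraph V} {k : ℕ} {c c' : ℕ → V}

/-! ### Degrees and cut nodes along an Eulerian circuit -/

theorem inclusive_adj {u v : V} :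
    G.toSimpleGraphInclusive.Adj u v ↔ u ≠ v ∧ (G.Adj u v ∨ G.Adj v u) :=
  SimpleGraph.fromRel_adj _ _ _

-- Each edge is traversed once per period, so the visits to `v` in one period are in bijection with
-- the edges leaving `v`.
open Classical in
theorem IsEulerSeq.outDegree_eq (h : IsEulerSeq G k c) (v : V) :
    outDegree G v = ((Finset.range k).filter fun i => c i = v).card := by
  have hset : {w | G.Adj v w} =
      (((Finset.range k).filter fun i => c i = v).image fun i => c (i + 1) : Finset V) := by
    ext w
    simp only [Set.mem_ofPred_eq, Finset.coe_image, Finset.coe_filter, Finset.mem_range,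
      Set.mem_image]
    constructor
    · intro hw
      obtain ⟨i, hi, h1, h2⟩ := h.surj v w hw
      exact ⟨i, ⟨hi, h1⟩, h2⟩
    · rintro ⟨i, ⟨-, rfl⟩, rfl⟩
      exact h.adj i
  rw [outDegree, hset, Set.ncard_coe_finset, Finset.card_image_of_injOn]
  intro i hi j hj hij
  simp only [Finset.coe_filter, Finset.mem_range, Set.mem_ofPred_eq] at hi hj
  exact h.eq_of_lt hi.1 hj.1 (hi.2.trans hj.2.symm) hij

/-- Without loops an edge has two different ends, so connectedness leaves no node isolated; and
every edge is on the circuit. -/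
theorem IsEulerSeq.exists_index (h : IsEulerSeq G k c) (hloop : ∀ v, ¬ G.Adj v v)
    (hconn : G.toSimpleGraphInclusive.Connected) (v : V) : ∃ i < k, c i = v := by
  have hne : c 0 ≠ c 1 := fun h0 => hloop (c 1) (by have := h.adj 0; rwa [h0] at this)
  have : Nontrivial V := ⟨_, _, hne⟩
  obtain ⟨w, hw⟩ := hconn.preconnected.exists_adj_of_nontrivial v
  rcases (inclusive_adj.1 hw).2 with hw | hw
  · obtain ⟨i, hi, h1, -⟩ := h.surj _ _ hw
    exact ⟨i, hi, h1⟩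
  · obtain ⟨i, hi, -, h1⟩ := h.surj _ _ hw
    exact ⟨(i + 1) % k, Nat.mod_lt _ h.pos, by rw [periodic_mod h.periodic, h1]⟩

theorem IsEulerSeq.outDegree_pos (h : IsEulerSeq G k c) (hloop : ∀ v, ¬ G.Adj v v)
    (hconn : G.toSimpleGraphInclusive.Connected) (v : V) : 0 < outDegree G v := by
  classical
  obtain ⟨i, hi, hv⟩ := h.exists_index hloop hconn v
  rw [h.outDegree_eq]
  exact Finset.card_pos.2 ⟨i, by simp [hi, hv]⟩

/-- A node of degree one occurs once. -/
theorem IsEulerSeq.eq_of_outDegree_eq_one (h : IsEulerSeq G k c) {v : V}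
    (hd : outDegree G v = 1) {i j : ℕ} (hi : c i = v) (hj : c j = v) : i ≡ j [MOD k] := by
  classical
  rw [h.outDegree_eq, Finset.card_eq_one] at hd
  obtain ⟨a, ha⟩ := hd
  have key : ∀ i, c i = v → i % k = a := by
    intro i hi
    have : i % k ∈ (Finset.range k).filter fun i => c i = v := by
      simp [Nat.mod_lt _ h.pos, periodic_mod h.periodic, hi]
    rw [ha] at this
    simpa using this
  exact (key i hi).trans (key j hj).symm

/-- A node of degree two occurs twice. -/
theorem IsEulerSeq.exists_of_outDegree_eq_two (h : IsEulerSeq G k c)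
    (hd : outDegree G (c 0) = 2) :
    ∃ q, 0 < q ∧ q < k ∧ c q = c 0 ∧ ∀ i < k, c i = c 0 → i = 0 ∨ i = q := by
  classical
  rw [h.outDegree_eq, Finset.card_eq_two] at hd
  obtain ⟨a, b, hab, hs⟩ := hd
  have hmem : ∀ i, i < k ∧ c i = c 0 ↔ i = a ∨ i = b := by
    intro i
    have := congrArg (i ∈ ·) hs
    simpa using this
  rcases (hmem 0).1 ⟨h.pos, rfl⟩ with h0 | h0
  · subst h0
    exact ⟨b, by omega, ((hmem b).2 (Or.inr rfl)).1, ((hmem b).2 (Or.inr rfl)).2,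
      fun i hi h' => (hmem i).1 ⟨hi, h'⟩⟩
  · subst h0
    exact ⟨a, by omega, ((hmem a).2 (Or.inl rfl)).1, ((hmem a).2 (Or.inl rfl)).2,
      fun i hi h' => ((hmem i).1 ⟨hi, h'⟩).symm⟩

/-- A node of degree at least three occurs three times. -/
theorem IsEulerSeq.exists_of_three_le_outDegree (h : IsEulerSeq G k c)
    (hd : 3 ≤ outDegree G (c 0)) :
    ∃ q r, 0 < q ∧ q < r ∧ r < k ∧ c q = c 0 ∧ c r = c 0 := by
  classical
  rw [h.outDegree_eq] at hd
  have h0 : 0 ∈ (Finset.range k).filter fun i => c i = c 0 := by simp [h.pos]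
  have h2 : 1 < (((Finset.range k).filter fun i => c i = c 0).erase 0).card := by
    rw [Finset.card_erase_of_mem h0]; omega
  obtain ⟨a, ha, b, hb, hab⟩ := Finset.one_lt_card.1 h2
  simp only [Finset.mem_erase, Finset.mem_filter, Finset.mem_range] at ha hb
  rcases lt_or_gt_of_ne hab with hlt | hlt
  · exact ⟨a, b, by omega, hlt, by omega, ha.2.2, hb.2.2⟩
  · exact ⟨b, a, by omega, hlt, by omega, hb.2.2, ha.2.2⟩

/-- The two occurrences of the node `c 0`, at `0` and `q`, are interlaced with two occurrences
of another node. -/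
def Interlaced (c : ℕ → V) (k q : ℕ) : Prop :=
  ∃ a b, 0 < a ∧ a < q ∧ q < b ∧ b < k ∧ c a = c b

section TwoOccurrences

variable {q : ℕ}

/-- An edge that avoids the node `c 0` lies in one of the two stretches of the circuit between
the occurrences of `c 0`. -/
theorem IsEulerSeq.index_of_adj_ne (h : IsEulerSeq G k c) (hq : c q = c 0)
    {u v : V} (huv : G.Adj u v) (hu : u ≠ c 0) (hv : v ≠ c 0) :
    ∃ i, c i = u ∧ c (i + 1) = v ∧ ((0 < i ∧ i + 1 < q) ∨ (q < i ∧ i + 1 < k)) := by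
  obtain ⟨i, hi, rfl, rfl⟩ := h.surj u v huv
  refine ⟨i, rfl, rfl, ?_⟩
  have h0 : i ≠ 0 := by rintro rfl; exact hu rfl
  have h1 : i ≠ q := by rintro rfl; exact hu hq
  have h2 : i + 1 ≠ q := fun h => hv (h ▸ hq)
  have h3 : i + 1 ≠ k := fun h' => hv (by rw [h', ← Nat.zero_add k]; exact h.periodic 0)
  omega

theorem IsEulerSeq.reachable_stretch (h : IsEulerSeq G k c) (hloop : ∀ v, ¬ G.Adj v v)
    {a n : ℕ} (hne : ∀ j ≤ n, c (a + j) ∈ ({c 0}ᶜ : Set V)) :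
    (G.toSimpleGraphInclusive.induce {c 0}ᶜ).Reachable ⟨c a, hne 0 (Nat.zero_le n)⟩
      ⟨c (a + n), hne n le_rfl⟩ := by
  induction n with
  | zero => exact SimpleGraph.Reachable.refl _
  | succ n ih =>
    refine (ih fun j hj => hne j (by omega)).trans (SimpleGraph.Adj.reachable ?_)
    rw [SimpleGraph.comap_adj]
    refine inclusive_adj.2 ⟨?_, Or.inl (h.adj (a + n))⟩
    intro heq
    have := h.adj (a + n)
    exact hloop (c (a + n)) (by
      have h2 : c (a + n) = c (a + n + 1) := heq
      rwa [← h2] at this)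

/-- Deleting `c 0` leaves two stretches of the circuit that together contain all other nodes. Each
is connected in itself, and the interlacing node lies on both. -/
theorem IsEulerSeq.not_isCutNode_of_interlaced (h : IsEulerSeq G k c)
    (hloop : ∀ v, ¬ G.Adj v v) (hconn : G.toSimpleGraphInclusive.Connected)
    (hq : c q = c 0) (hocc : ∀ i < k, c i = c 0 → i = 0 ∨ i = q) (hint : Interlaced c k q) :
    ¬ IsCutNode G.toSimpleGraphInclusive (c 0) := by
  obtain ⟨a, b, ha0, haq, hqb, hbk, hab⟩ := hint
  have hmem : ∀ i < k, i ≠ 0 → i ≠ q → c i ∈ ({c 0}ᶜ : Set V) := by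
    intro i hi h0 h1 h2
    rcases hocc i hi h2 with h3 | h3
    · exact h0 h3
    · exact h1 h3
  have hstep : ∀ i j, i ≤ j → (hj : j < k) → (hi : i < k) →
      (h0 : i ≠ 0) → (h1 : i ≠ q) → (h2 : j ≠ 0) → (h3 : j ≠ q) → (i < q ↔ j < q) →
      (G.toSimpleGraphInclusive.induce {c 0}ᶜ).Reachable ⟨c i, hmem i hi h0 h1⟩
        ⟨c j, hmem j hj h2 h3⟩ := by
    intro i j hij hj hi h0 h1 h2 h3 hiff
    obtain ⟨n, rfl⟩ := Nat.exists_eq_add_of_le hij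
    exact h.reachable_stretch hloop (a := i) (n := n)
      (fun m hm => hmem (i + m) (by omega) (by omega) (by omega))
  have hstep' : ∀ i j, (hj : j < k) → (hi : i < k) →
      (h0 : i ≠ 0) → (h1 : i ≠ q) → (h2 : j ≠ 0) → (h3 : j ≠ q) → (i < q ↔ j < q) →
      (G.toSimpleGraphInclusive.induce {c 0}ᶜ).Reachable ⟨c i, hmem i hi h0 h1⟩
        ⟨c j, hmem j hj h2 h3⟩ := by
    intro i j hj hi h0 h1 h2 h3 hiff
    rcases le_total i j with hij | hij
    · exact hstep i j hij hj hi h0 h1 h2 h3 hiff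
    · exact (hstep j i hij hi hj h2 h3 h0 h1 hiff.symm).symm
  have hall : ∀ x : ({c 0}ᶜ : Set V), (G.toSimpleGraphInclusive.induce {c 0}ᶜ).Reachable
      ⟨c a, hmem a (by omega) (by omega) (by omega)⟩ x := by
    rintro ⟨x, hx⟩
    obtain ⟨i, hi, rfl⟩ := h.exists_index hloop hconn x
    have h0 : i ≠ 0 := by rintro rfl; exact hx rfl
    have h1 : i ≠ q := by
      rintro rfl; exact hx hq
    by_cases hiq : i < q
    · exact hstep' a i hi (by omega) (by omega) (by omega) h0 h1 (by omega)
    · have := hstep' b i hi (by omega) (by omega) (by omega) h0 h1 (by omega)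
      simpa only [hab] using this
  rw [IsCutNode, not_not, SimpleGraph.connected_iff]
  exact ⟨fun x y => (hall x).symm.trans (hall y),
    ⟨⟨c a, hmem a (by omega) (by omega) (by omega)⟩⟩⟩

/-- The nodes of the stretch between the two occurrences. -/
def stretchNodes (c : ℕ → V) (a b : ℕ) : Set V :=
  {x | ∃ i, a < i ∧ i < b ∧ c i = x}

/-- Every edge that avoids `c 0` runs inside one stretch, and without interlacing the two stretches
share no node; so no edge joins them. -/
theorem IsEulerSeq.mem_stretch_of_adj (h : IsEulerSeq G k c) (hq : c q = c 0)
    (hint : ¬ Interlaced c k q) {u v : V} (huv : G.toSimpleGraphInclusive.Adj u v)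
    (hu0 : u ≠ c 0) (hv0 : v ≠ c 0) :
    (u ∈ stretchNodes c 0 q → v ∈ stretchNodes c 0 q) ∧
      (u ∈ stretchNodes c q k → v ∈ stretchNodes c q k) := by
  have hdis : ∀ x, x ∈ stretchNodes c 0 q → x ∈ stretchNodes c q k → False := by
    rintro x ⟨a, ha0, haq, rfl⟩ ⟨b, hb, hbk, hab⟩
    exact hint ⟨a, b, ha0, haq, hb, hbk, hab.symm⟩
  rcases (inclusive_adj.1 huv).2 with hadj | hadj
  · obtain ⟨i, rfl, rfl, hi | hi⟩ := h.index_of_adj_ne hq hadj hu0 hv0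
    · exact ⟨fun _ => ⟨i + 1, by omega, by omega, rfl⟩,
        fun h' => (hdis _ ⟨i, by omega, by omega, rfl⟩ h').elim⟩
    · exact ⟨fun h' => (hdis _ h' ⟨i, by omega, by omega, rfl⟩).elim,
        fun _ => ⟨i + 1, by omega, by omega, rfl⟩⟩
  · obtain ⟨i, rfl, rfl, hi | hi⟩ := h.index_of_adj_ne hq hadj hv0 hu0
    · exact ⟨fun _ => ⟨i, by omega, by omega, rfl⟩,
        fun h' => (hdis _ ⟨i + 1, by omega, by omega, rfl⟩ h').elim⟩
    · exact ⟨fun h' => (hdis _ h' ⟨i + 1, by omega, by omega, rfl⟩).elim,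
        fun _ => ⟨i, by omega, by omega, rfl⟩⟩

theorem IsEulerSeq.ne_succ (h : IsEulerSeq G k c) (hloop : ∀ v, ¬ G.Adj v v) (i : ℕ) :
    c i ≠ c (i + 1) := by
  intro heq
  have := h.adj i
  rw [← heq] at this
  exact hloop _ this

/-- The nodes `c 1` and `c (q + 1)` lie on different stretches, and a walk that avoids `c 0` cannot
leave its stretch. A connection between them would make `c (q + 1)` an interlacing node. -/
theorem IsEulerSeq.isCutNode_of_not_interlaced (h : IsEulerSeq G k c)
    (hloop : ∀ v, ¬ G.Adj v v) (hq0 : 0 < q) (hqk : q < k) (hq : c q = c 0)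
    (hocc : ∀ i < k, c i = c 0 → i = 0 ∨ i = q) (hint : ¬ Interlaced c k q) :
    IsCutNode G.toSimpleGraphInclusive (c 0) := by
  intro hconn
  -- Without loops neither stretch is empty.
  have h1 : 1 < q := by
    rcases Nat.lt_or_ge 1 q with h1 | h1
    · exact h1
    · have : q = 1 := by omega
      subst this
      exact (h.ne_succ hloop 0 hq.symm).elim
  have h2 : q + 1 < k := by
    rcases Nat.lt_or_ge (q + 1) k with h2 | h2
    · exact h2
    · have : q + 1 = 0 + k := by omega
      have h3 := h.ne_succ hloop q
      rw [this, h.periodic, hq] at h3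
      exact (h3 rfl).elim
  have m1 : c 1 ∈ ({c 0}ᶜ : Set V) := fun hh => by
    rcases hocc 1 (by omega) hh with h' | h' <;> omega
  have m2 : c (q + 1) ∈ ({c 0}ᶜ : Set V) := fun hh => by
    rcases hocc (q + 1) (by omega) hh with h' | h' <;> omega
  have hreach := hconn.preconnected ⟨c 1, m1⟩ ⟨c (q + 1), m2⟩
  have hclosed : ∀ x y : ({c 0}ᶜ : Set V), (G.toSimpleGraphInclusive.induce {c 0}ᶜ).Walk x y →
      x.1 ∈ stretchNodes c 0 q → y.1 ∈ stretchNodes c 0 q := by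
    intro x y w
    induction w with
    | nil => exact id
    | @cons x y z hadj _ ih =>
      intro hx
      exact ih ((h.mem_stretch_of_adj hq hint (SimpleGraph.comap_adj.1 hadj)
        x.2 y.2).1 hx)
  obtain ⟨w⟩ := hreach
  obtain ⟨a, ha0, haq, ha⟩ := hclosed _ _ w ⟨1, by omega, h1, rfl⟩
  exact hint ⟨a, q + 1, ha0, haq, by omega, h2, ha⟩

end TwoOccurrences

/-! ### Transitions at forced and at unforced nodes -/

/-- `c` passes a forced node `c 0` in the same way as every Eulerian circuit does. -/
theorem IsEulerSeq.forced_transition_zero (h : IsEulerSeq G k c) (h' : IsEulerSeq G k c')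
    (hloop : ∀ v, ¬ G.Adj v v) (hconn : G.toSimpleGraphInclusive.Connected)
    (hv : c 0 ∈ forcedNodes G) (h0 : c' 0 = c 0) (hpred : c' (k - 1) = c (k - 1)) :
    c' 1 = c 1 := by
  have hk := h.pos
  rcases hv with hd | ⟨hd, hcut⟩
  · obtain ⟨i, hi, h1, h2⟩ := h.surj _ _ (h'.adj 0)
    have h3 := h.eq_of_outDegree_eq_one hd (h1.trans h0) rfl
    rw [← h2]
    exact h.congr (h3.add_right 1)
  obtain ⟨q, hq0, hqk, hq, hocc⟩ := h.exists_of_outDegree_eq_two hd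
  obtain ⟨q', hq0', hqk', hq', hocc'⟩ := h'.exists_of_outDegree_eq_two (by rwa [h0])
  have hint : ¬ Interlaced c k q := fun hint =>
    h.not_isCutNode_of_interlaced hloop hconn hq hocc hint hcut
  obtain ⟨i, hi, h1, h2⟩ := h.surj _ _ (h'.adj 0)
  rcases hocc i hi (h1.trans h0) with rfl | rfl
  · exact h2.symm
  -- Now `c'` leaves `c 0` by the edge that `c` uses at its second visit. For lack of interlacing,
  -- `c'` then stays on the second stretch of `c` until it returns to `c 0`, and it can return only
  -- by the edge with which `c` closes. By `hpred` that edge is the last one of `c'`, but `c'`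
  -- already returns at the time `q' < k`.
  exfalso
  have hne : ∀ j, 0 < j → j < q' → c' j ≠ c 0 := fun j hj0 hj hj' => by
    rcases hocc' j (by omega) (hj'.trans h0.symm) with h3 | h3 <;> omega
  have h1q' : q' ≠ 1 := by
    rintro rfl
    exact h'.ne_succ hloop 0 hq'.symm
  have hin : ∀ j, j + 1 < q' → c' (j + 1) ∈ stretchNodes c i k := by
    intro j
    induction j with
    | zero =>
      intro hj
      refine ⟨i + 1, by omega, ?_, h2⟩
      rcases Nat.lt_or_ge (i + 1) k with h3 | h3
      · exact h3
      · have h4 : i + 1 = 0 + k := by omega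
        rw [h4, h.periodic] at h2
        exact (hne 1 (by omega) hj h2.symm).elim
    | succ j ih =>
      intro hj
      refine (h.mem_stretch_of_adj hq hint (inclusive_adj.2 ⟨h'.ne_succ hloop _,
        Or.inl (h'.adj _)⟩) (hne _ (by omega) (by omega)) (hne _ (by omega) hj)).2 (ih (by omega))
  obtain ⟨b, hb, hbk, hbe⟩ := hin (q' - 2) (by omega)
  have e1 : q' - 2 + 1 = q' - 1 := by omega
  rw [e1] at hbe
  have hadj := h'.adj (q' - 1)
  have e2 : q' - 1 + 1 = q' := by omega
  rw [e2] at hadj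
  obtain ⟨j, hj, hj1, hj2⟩ := h.surj _ _ hadj
  have hj3 : c (j + 1) = c 0 := by rw [hj2, hq', h0]
  rcases Nat.lt_or_ge (j + 1) k with hjk | hjk
  · rcases hocc (j + 1) hjk hj3 with h4 | h4
    · omega
    · have : j ≠ 0 := by
        rintro rfl
        rw [Nat.zero_add] at h4
        subst h4
        exact h.ne_succ hloop 0 hj3.symm
      exact hint ⟨j, b, by omega, by omega, hb, hbk, by rw [hj1, hbe]⟩
  · have h5 : j = k - 1 := by omega
    subst h5
    have h6 := h'.eq_of_lt (i := q' - 1) (j := k - 1) (by omega) (by omega) (by rw [hpred, hj1])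
      (by rw [e2, hq', Nat.sub_add_cancel hk]; simpa using (h'.periodic 0).symm)
    omega

/-- Both circuits are rotated so that the forced node sits at index `0`; its predecessor then has
index `k - 1`. -/
theorem IsEulerSeq.forced_transition (h : IsEulerSeq G k c) (h' : IsEulerSeq G k c')
    (hloop : ∀ v, ¬ G.Adj v v) (hconn : G.toSimpleGraphInclusive.Connected) {i j : ℕ}
    (hv : c (i + 1) ∈ forcedNodes G) (h0 : c' j = c i) (h1 : c' (j + 1) = c (i + 1)) :
    c' (j + 2) = c (i + 2) := by
  have hk := h.pos
  have e : ∀ m, m + 1 + (k - 1) = m + k := by omega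
  exact (h.shift (i + 1)).forced_transition_zero (h'.shift (j + 1)) hloop hconn hv h1
    (by simp only [e, h.periodic, h'.periodic, h0])

/-- A walk whose first edge occurs once in a circuit has a unique continuation there. -/
theorem IsEulerianCircuit.continuation_unique {C : List V} (hC : IsEulerianCircuit G C)
    (hk : 0 < walkLength C) {y v w w' : V} (h : AppearsInCircuit [y, v, w] C)
    (h' : AppearsInCircuit [y, v, w'] C) : w = w' := by
  obtain ⟨c, hc, hCc⟩ := hC.exists_seq hk
  rw [hCc, appearsInCircuit_window hc.pos hc.periodic] at h h'
  obtain ⟨-, i, hi⟩ := h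
  obtain ⟨-, j, hj⟩ := h'
  simp only [window, List.length_cons, List.length_nil, Nat.zero_add, Nat.reduceAdd, List.range_succ,
    List.range_zero, List.nil_append, List.map_cons, List.map_nil,
    Nat.add_zero, List.cons_append, List.cons.injEq, and_true] at hi hj
  have := hc.inj i j (hi.1.symm.trans hj.1) (hi.2.1.symm.trans hj.2.1)
  rw [hi.2.2, hj.2.2]
  exact hc.congr (this.add_right 2)

theorem IsEulerianCircuit.appears_of_subwalk {C Q : List V} (hC : IsEulerianCircuit G C)
    (hk : 0 < walkLength C) (hQ : Q <:+: C) (hlen : walkLength Q + 1 ≤ walkLength C) :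
    AppearsInCircuit Q C := by
  obtain ⟨c, hc, hCc⟩ := hC.exists_seq hk
  rw [hCc] at hQ
  obtain ⟨a, -, ha⟩ := subwalk_window hQ
  rw [hCc, appearsInCircuit_window hc.pos hc.periodic]
  exact ⟨hlen, _, ha⟩

/-- One different continuation after the edge `(y, v)` excludes the given one. Three edges are
needed for a walk of length two to count as appearing. -/
theorem IsEulerianCircuit.not_appears {C' : List V} (hC' : IsEulerianCircuit G C')
    (hlen : 3 ≤ walkLength C') {y v w w' : V} (hw' : [y, v, w'] <:+: C')
    (hne : w ≠ w') : ¬ AppearsInCircuit [y, v, w] C' := by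
  intro h
  exact hne (hC'.continuation_unique (by omega) h
    (hC'.appears_of_subwalk (by omega) hw' (by simpa [walkLength] using hlen)))

/-! ### Rerouting a circuit at an unforced node -/

theorem walkEdges_window_append (c : ℕ → V) (s n : ℕ) {l : List V}
    (hl : l.head? = some (c (s + n))) :
    walkEdges (window c s n ++ l) = window (fun i => (c i, c (i + 1))) s n ++ walkEdges l := by
  rcases l with _ | ⟨x, l⟩
  · simp at hl
  · obtain rfl : x = c (s + n) := by simpa using hl
    rw [walkEdges_append_cons, ← window_succ_last, walkEdges_window]

theorem window_append_eq_cons_cons (c : ℕ → V) {s n : ℕ} (hn : 0 < n) {l : List V}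
    (hl : l.head? = some (c (s + n))) :
    ∃ t, window c s n ++ l = c s :: c (s + 1) :: t := by
  rcases n with _ | _ | n
  · omega
  · rcases l with _ | ⟨x, l⟩
    · simp at hl
    · obtain rfl : x = c (s + 1) := by simpa using hl
      exact ⟨l, rfl⟩
  · exact ⟨_, by rw [window_succ, window_succ]; rfl⟩

theorem head?_window_append (c : ℕ → V) {s n : ℕ} (hn : 0 < n) (l : List V) :
    (window c s n ++ l).head? = some (c s) := by
  obtain ⟨n, rfl⟩ := Nat.exists_eq_succ_of_ne_zero hn.ne'
  rw [window_succ]; rfl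

theorem subwalk_window_append (c : ℕ → V) {s n : ℕ} (hn : 0 < n) {l t : List V} {v w : V}
    (hl : l = v :: w :: t) : [c (s + n - 1), v, w] <:+: window c s n ++ l := by
  obtain ⟨n, rfl⟩ := Nat.exists_eq_succ_of_ne_zero hn.ne'
  refine ⟨window c s n, t, ?_⟩
  rw [window_succ_last, hl]
  simp

theorem IsEulerSeq.ne_of_occurrence (h : IsEulerSeq G k c) {q : ℕ} (hq0 : 0 < q) (hqk : q < k)
    (hq : c q = c 0) : c 1 ≠ c (q + 1) := by
  intro h1
  have := h.eq_of_lt h.pos hqk hq.symm h1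
  omega

/-- The circuit is cut into pieces at the visits to `c 0` (and, in degree two, at two visits to an
interlacing node), and the pieces are traversed in reverse order, each in its own direction. The
edges stay the same, but after the last edge the new circuit continues with `c (q + 1)` instead of
`c 1`. -/
theorem IsEulerSeq.unforced_transition_zero (h : IsEulerSeq G k c)
    (hloop : ∀ v, ¬ G.Adj v v) (hconn : G.toSimpleGraphInclusive.Connected)
    (hv : c 0 ∉ forcedNodes G) :
    ∃ C', IsEulerianCircuit G C' ∧ ¬ AppearsInCircuit [c (k - 1), c 0, c 1] C' := by
  have hd0 := h.outDegree_pos hloop hconn (c 0)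
  have hd1 : outDegree G (c 0) ≠ 1 := fun h1 => hv (Or.inl h1)
  have hck : c k = c 0 := by simpa using h.periodic 0
  have hE := h.isEulerianCircuit 0
  have hEe : walkEdges (window c 0 (k + 1)) = window (fun i => (c i, c (i + 1))) 0 k :=
    walkEdges_window c 0 k
  rcases Nat.lt_or_ge (outDegree G (c 0)) 3 with hd | hd
  · have hd2 : outDegree G (c 0) = 2 := by omega
    obtain ⟨q, hq0, hqk, hq, hocc⟩ := h.exists_of_outDegree_eq_two hd2
    have hint : Interlaced c k q := by
      by_contra hint
      exact hv (Or.inr ⟨hd2, h.isCutNode_of_not_interlaced hloop hq0 hqk hq hocc hint⟩)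
    obtain ⟨a, b, ha0, haq, hqb, hbk, hab⟩ := hint
    have eb : b + (k - b) = k := by omega
    have eq : q + (b - q) = b := by omega
    have ea : a + (q - a) = q := by omega
    have hA := head?_window_append c (s := 0) ha0 [c a]
    have hB := head?_window_append c (s := a) (n := q - a) (by omega) (window c 0 a ++ [c a])
    have hC := head?_window_append c (s := q) (n := b - q) (by omega)
      (window c a (q - a) ++ (window c 0 a ++ [c a]))
    have hD := head?_window_append c (s := b) (n := k - b) (by omega)
      (window c q (b - q) ++ (window c a (q - a) ++ (window c 0 a ++ [c a])))
    obtain ⟨t, ht⟩ := window_append_eq_cons_cons c (s := q) (n := b - q) (by omega)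
      (l := window c a (q - a) ++ (window c 0 a ++ [c a])) (by rw [hB, eq, hab])
    -- The pieces from `b` to `k`, `q` to `b`, `a` to `q` and `0` to `a` fit together because `c q =
    -- c 0` and `c a = c b`.
    have hp : (walkEdges (window c b (k - b) ++ (window c q (b - q) ++
        (window c a (q - a) ++ (window c 0 a ++ [c a]))))).Perm
        (walkEdges (window c 0 (k + 1))) := by
      rw [walkEdges_window_append c b (k - b) (by rw [hC, eb, hq, hck]),
        walkEdges_window_append c q (b - q) (by rw [hB, eq, hab]),
        walkEdges_window_append c a (q - a) (by rw [hA, ea, hq]),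
        walkEdges_window_append c 0 a (by simp), walkEdges_singleton, hEe]
      have e1 : k = a + (q - a) + (b - q) + (k - b) := by omega
      have e2 : 0 + (a + (q - a)) = q := by omega
      have e3 : 0 + (a + (q - a) + (b - q)) = b := by omega
      conv_rhs => rw [e1, window_add, window_add, window_add, e2, e3, Nat.zero_add]
      rw [List.append_nil]
      refine List.perm_append_comm.trans (List.Perm.append_right _ ?_)
      refine List.perm_append_comm.trans (List.Perm.append_right _ ?_)
      exact List.perm_append_comm
    have hE' := hE.of_perm (by intro h0; rw [h0] at hD; simp at hD)
      (by rw [hD]; simp [hab]) hp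
    refine ⟨_, hE', hE'.not_appears (w' := c (q + 1)) ?_ ?_ (h.ne_of_occurrence hq0 hqk hq)⟩
    · rw [← length_walkEdges, hp.length_eq, hEe, length_window]; omega
    · have := subwalk_window_append c (s := b) (n := k - b) (by omega) ht
      rw [eb, hq] at this
      exact this
  · obtain ⟨q, r, hq0, hqr, hrk, hq, hr⟩ := h.exists_of_three_le_outDegree hd
    have er : r + (k - r) = k := by omega
    have eq : q + (r - q) = r := by omega
    have hA := head?_window_append c (s := 0) hq0 [c 0]
    have hB := head?_window_append c (s := q) (n := r - q) (by omega) (window c 0 q ++ [c 0])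
    have hD := head?_window_append c (s := r) (n := k - r) (by omega)
      (window c q (r - q) ++ (window c 0 q ++ [c 0]))
    obtain ⟨t, ht⟩ := window_append_eq_cons_cons c (s := q) (n := r - q) (by omega)
      (l := window c 0 q ++ [c 0]) (by rw [hA, eq, hr])
    -- Three visits to `c 0` give three closed pieces, and reversing their cyclic order is a real
    -- change; with two closed pieces it would only be a rotation.
    have hp : (walkEdges (window c r (k - r) ++ (window c q (r - q) ++
        (window c 0 q ++ [c 0])))).Perm (walkEdges (window c 0 (k + 1))) := by
      rw [walkEdges_window_append c r (k - r) (by rw [hB, er, hq, hck]),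
        walkEdges_window_append c q (r - q) (by rw [hA, eq, hr]),
        walkEdges_window_append c 0 q (by simp [hq]), walkEdges_singleton, hEe]
      have e1 : k = q + (r - q) + (k - r) := by omega
      have e2 : 0 + (q + (r - q)) = r := by omega
      conv_rhs => rw [e1, window_add, window_add, e2, Nat.zero_add]
      rw [List.append_nil]
      exact List.perm_append_comm.trans (List.Perm.append_right _ List.perm_append_comm)
    have hE' := hE.of_perm (by intro h0; rw [h0] at hD; simp at hD)
      (by rw [hD]; simp [hr]) hp
    refine ⟨_, hE', hE'.not_appears (w' := c (q + 1)) ?_ ?_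
      (h.ne_of_occurrence hq0 (by omega) hq)⟩
    · rw [← length_walkEdges, hp.length_eq, hEe, length_window]; omega
    · have := subwalk_window_append c (s := r) (n := k - r) (by omega) ht
      rw [er, hq] at this
      exact this

theorem IsEulerSeq.unforced_transition (h : IsEulerSeq G k c)
    (hloop : ∀ v, ¬ G.Adj v v) (hconn : G.toSimpleGraphInclusive.Connected) {i : ℕ}
    (hv : c (i + 1) ∉ forcedNodes G) :
    ∃ C', IsEulerianCircuit G C' ∧ ¬ AppearsInCircuit [c i, c (i + 1), c (i + 2)] C' := by
  have hk := h.pos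
  have := (h.shift (i + 1)).unforced_transition_zero hloop hconn hv
  have e : i + 1 + (k - 1) = i + k := by omega
  simpa only [e, h.periodic] using this

/-! ### Safe walks -/

/-- The first edge of the window occurs somewhere in `c'`. From there on, every internal node forces
the next edge. -/
theorem IsEulerSeq.exists_window_eq (h : IsEulerSeq G k c) (h' : IsEulerSeq G k c')
    (hloop : ∀ v, ¬ G.Adj v v) (hconn : G.toSimpleGraphInclusive.Connected) (i n : ℕ)
    (hf : ∀ j, 0 < j → j + 1 < n → c (i + j) ∈ forcedNodes G) :
    ∃ i', window c i n = window c' i' n := by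
  obtain ⟨i', -, h1, h2⟩ := h'.surj _ _ (h.adj i)
  refine ⟨i', window_congr ?_⟩
  have key : ∀ j, j + 1 < n → c (i + j) = c' (i' + j) ∧ c (i + j + 1) = c' (i' + j + 1) := by
    intro j
    induction j with
    | zero => exact fun _ => ⟨h1.symm, h2.symm⟩
    | succ j ih =>
      intro hj
      obtain ⟨h3, h4⟩ := ih (by omega)
      exact ⟨h4, (h.forced_transition h' hloop hconn (hf (j + 1) (by omega) hj) h3.symm
        h4.symm).symm⟩
  intro j hj
  rcases j with _ | j
  · exact h1.symm
  · exact (key j hj).2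

/-- A walk is safe iff it is a stretch of an Eulerian circuit with forced internal nodes. -/
theorem IsEulerSeq.isSafe_iff (h : IsEulerSeq G k c) (hloop : ∀ v, ¬ G.Adj v v)
    (hconn : G.toSimpleGraphInclusive.Connected) (Q : List V) :
    IsSafe G Q ↔ ∃ i n, Q = window c i n ∧ 0 < n ∧ n ≤ k ∧
      ∀ j, 0 < j → j + 1 < n → c (i + j) ∈ forcedNodes G := by
  have hcirc : ∀ C, IsEulerianCircuit G C →
      ∃ c', IsEulerSeq G k c' ∧ C = window c' 0 (k + 1) := by
    intro C hC
    have hlen : walkLength C = k := by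
      rw [← length_walkEdges, (hC.perm (h.isEulerianCircuit 0)).length_eq, walkEdges_window,
        length_window]
    obtain ⟨c', hc', hC'⟩ := hC.exists_seq (by rw [hlen]; exact h.pos)
    rw [hlen] at hc' hC'
    exact ⟨c', hc', hC'⟩
  constructor
  · rintro ⟨⟨hne, -⟩, hall⟩
    obtain ⟨hlen, i, hi⟩ :=
      (appearsInCircuit_window h.pos h.periodic 0 Q).1 (hall _ (h.isEulerianCircuit 0))
    have hpos := List.length_pos_of_ne_nil hne
    refine ⟨i, Q.length, hi, hpos, by unfold walkLength at hlen; omega, ?_⟩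
    intro j hj0 hj
    by_contra hv
    obtain ⟨j, rfl⟩ := Nat.exists_eq_succ_of_ne_zero hj0.ne'
    -- An unforced internal node, with its two neighbors in `Q`, is a subwalk of `Q` that some other
    -- circuit avoids.
    obtain ⟨C', hC', hnot⟩ := h.unforced_transition hloop hconn (i := i + j) hv
    obtain ⟨c', hc', rfl⟩ := hcirc C' hC'
    refine hnot (AppearsInCircuit.of_subwalk hc'.pos hc'.periodic (hall _ hC') ?_)
    have := window_subwalk c i Q.length j 3 (by omega)
    rw [← hi] at this
    exact this
  · rintro ⟨i, n, rfl, hn, hnk, hf⟩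
    refine ⟨⟨by rw [← List.length_pos_iff_ne_nil, length_window]; exact hn, ?_⟩, ?_⟩
    · rw [isChain_iff_walkEdges]
      obtain ⟨n, rfl⟩ := Nat.exists_eq_succ_of_ne_zero hn.ne'
      rw [Nat.succ_eq_add_one, walkEdges_window]
      intro e he
      obtain ⟨j, -, rfl⟩ := mem_window.1 he
      exact h.adj _
    · intro C hC
      obtain ⟨c', hc', rfl⟩ := hcirc C hC
      rw [appearsInCircuit_window hc'.pos hc'.periodic, length_window]
      refine ⟨by simp only [walkLength, length_window]; omega, ?_⟩
      exact h.exists_window_eq hc' hloop hconn i n hf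

/-! ### Maximal safe walks -/

theorem IsEulerSeq.isCutSegment_iff (h : IsEulerSeq G k c) (s : ℕ) (Q : List V) :
    IsCutSegment G (window c s (k + 1)) Q ↔ ∃ i n, Q = window c i (n + 1) ∧ 0 < n ∧ n + 1 ≤ k ∧
      c i ∉ forcedNodes G ∧ c (i + n) ∉ forcedNodes G ∧
      ∀ j, 0 < j → j < n → c (i + j) ∈ forcedNodes G := by
  unfold IsCutSegment
  rw [appearsInCircuit_window h.pos h.periodic]
  have hint : ∀ i n, (∀ v ∈ (window c i (n + 1)).tail.dropLast, v ∈ forcedNodes G) ↔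
      ∀ j, 0 < j → j < n → c (i + j) ∈ forcedNodes G := by
    intro i n
    rw [window_tail_dropLast]
    constructor
    · intro hh j hj0 hj
      exact hh _ (mem_window.2 ⟨j - 1, by omega, by congr 1; omega⟩)
    · intro hh v hv
      obtain ⟨j, hj, rfl⟩ := mem_window.1 hv
      rw [Nat.add_assoc]
      exact hh (1 + j) (by omega) (by omega)
  constructor
  · rintro ⟨⟨h1, i, hi⟩, h2, h3, h4, h5⟩
    obtain ⟨n, hn⟩ : ∃ n, Q.length = n + 1 := ⟨Q.length - 1, by unfold walkLength at h2; omega⟩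
    rw [hn] at hi
    subst hi
    simp only [walkLength, length_window, Nat.add_sub_cancel] at h1 h2
    refine ⟨i, n, rfl, by omega, h1, h3 _ (window_head? c i n), h4 _ (window_getLast? c i n), ?_⟩
    exact (hint i n).1 h5
  · rintro ⟨i, n, rfl, hn, hnk, h3, h4, h5⟩
    rw [length_window]
    refine ⟨⟨by simpa [walkLength] using hnk, i, rfl⟩, by simp [walkLength]; omega, ?_, ?_, ?_⟩
    · rw [window_head?]; rintro v ⟨⟩; exact h3
    · rw [window_getLast?]; rintro v ⟨⟩; exact h4
    · exact (hint i n).2 h5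

/-- An unforced node occurs at least twice in every period. -/
theorem IsEulerSeq.exists_two_of_unforced (h : IsEulerSeq G k c) (hloop : ∀ v, ¬ G.Adj v v)
    (hconn : G.toSimpleGraphInclusive.Connected) {v : V} (hv : v ∉ forcedNodes G) (s : ℕ) :
    ∃ i j, i < j ∧ j < k ∧ c (s + i) = v ∧ c (s + j) = v := by
  classical
  have hd : 1 < outDegree G v := by
    have := h.outDegree_pos hloop hconn v
    have h1 : outDegree G v ≠ 1 := fun h1 => hv (Or.inl h1)
    omega
  rw [(h.shift s).outDegree_eq] at hd
  obtain ⟨a, ha, b, hb, hab⟩ := Finset.one_lt_card.1 hd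
  simp only [Finset.mem_filter, Finset.mem_range] at ha hb
  rcases lt_or_gt_of_ne hab with hlt | hlt
  · exact ⟨a, b, hlt, hb.1, ha.2, hb.2⟩
  · exact ⟨b, a, hlt, ha.1, hb.2, ha.2⟩

theorem IsEulerSeq.two_le (h : IsEulerSeq G k c) (hloop : ∀ v, ¬ G.Adj v v) : 2 ≤ k := by
  have hk := h.pos
  by_contra hlt
  obtain rfl : k = 1 := by omega
  exact h.ne_succ hloop 0 (h.periodic 0).symm

/-- A safe walk with a forced end can be prolonged there, unless it already has `k` nodes. That
exception cannot occur: such a walk covers a full period, hence meets an unforced node twice, while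
only one of its positions is not known to be forced. -/
theorem IsEulerSeq.isMaximalSafe_iff_isCutSegment (h : IsEulerSeq G k c)
    (hloop : ∀ v, ¬ G.Adj v v) (hconn : G.toSimpleGraphInclusive.Connected)
    (hA : forcedNodes G ≠ Set.univ) (Q : List V) :
    IsMaximalSafe G Q ↔ IsCutSegment G (window c 0 (k + 1)) Q := by
  have h2k := h.two_le hloop
  obtain ⟨v, hv⟩ := (Set.ne_univ_iff_exists_notMem _).1 hA
  rw [h.isCutSegment_iff]
  constructor
  · rintro ⟨hs, hmax⟩
    obtain ⟨i, n, rfl, hn, hnk, hf⟩ := (h.isSafe_iff hloop hconn Q).1 hs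
    have hn2 : 2 ≤ n := by
      by_contra hlt
      obtain rfl : n = 1 := by omega
      have := hmax (window c i 2) ((h.isSafe_iff hloop hconn _).2
        ⟨i, 2, rfl, by omega, h2k, fun j h1 h3 => by omega⟩) ⟨[], [c (i + 1)], rfl⟩
      simpa using congrArg List.length this
    have hhead : c i ∉ forcedNodes G := by
      intro hi
      by_cases hnk' : n = k
      · subst hnk'
        obtain ⟨a, b, hab, hb, ha', hb'⟩ := h.exists_two_of_unforced hloop hconn hv i
        rcases Nat.eq_zero_or_pos a with rfl | ha0
        · exact hv (by rw [← ha']; exact hi)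
        · exact hv (by rw [← ha']; exact hf a ha0 (by omega))
      · have e : window c (i + k) n = window c i n :=
          window_congr fun j _ => by rw [Nat.add_right_comm]; exact h.periodic _
        have e1 : i + k - 1 + 1 = i + k := by omega
        have := hmax (window c (i + k - 1) (n + 1)) ((h.isSafe_iff hloop hconn _).2
          ⟨i + k - 1, n + 1, rfl, by omega, by omega, fun j hj0 hj => ?_⟩)
          ⟨[c (i + k - 1)], [], by rw [window_succ, e1, e]; simp⟩
        · simpa using congrArg List.length this
        · have e2 : i + k - 1 + j = i + (j - 1) + k := by omega
          rw [e2, h.periodic]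
          rcases Nat.eq_zero_or_pos (j - 1) with h0 | h0
          · rw [h0]; exact hi
          · exact hf _ h0 (by omega)
    have hlast : c (i + (n - 1)) ∉ forcedNodes G := by
      intro hi
      by_cases hnk' : n = k
      · subst hnk'
        obtain ⟨a, b, hab, hb, ha', hb'⟩ := h.exists_two_of_unforced hloop hconn hv i
        rcases Nat.lt_or_ge (b + 1) n with hlt | hge
        · exact hv (by rw [← hb']; exact hf b (by omega) hlt)
        · obtain rfl : b = n - 1 := by omega
          exact hv (by rw [← hb']; exact hi)
      · have := hmax (window c i (n + 1)) ((h.isSafe_iff hloop hconn _).2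
          ⟨i, n + 1, rfl, by omega, by omega, fun j hj0 hj => ?_⟩)
          ⟨[], [c (i + n)], by rw [window_succ_last]; simp⟩
        · simpa using congrArg List.length this
        · rcases Nat.lt_or_ge (j + 1) n with hlt | hge
          · exact hf j hj0 hlt
          · obtain rfl : j = n - 1 := by omega
            exact hi
    obtain ⟨n, rfl⟩ := Nat.exists_eq_succ_of_ne_zero hn.ne'
    exact ⟨i, n, rfl, by omega, hnk, hhead, hlast, fun j hj0 hj => hf j hj0 (by omega)⟩
  · rintro ⟨i, n, rfl, hn, hnk, h3, h4, h5⟩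
    refine ⟨(h.isSafe_iff hloop hconn _).2 ⟨i, n + 1, rfl, by omega, hnk,
      fun j hj0 hj => h5 j hj0 (by omega)⟩, ?_⟩
    intro Q' hQ' hinf
    obtain ⟨i', n', rfl, hn', hnk', hf'⟩ := (h.isSafe_iff hloop hconn _).1 hQ'
    obtain ⟨a, ha, he⟩ := subwalk_window hinf
    rw [length_window] at ha he
    -- An end of `Q` lying strictly inside a longer safe walk would be internal there, hence forced.
    have ha0 : a = 0 := by
      by_contra h0
      have e := eq_of_window_eq he 0 (by omega)
      simp only [Nat.add_zero] at e
      exact h3 (by rw [e]; exact hf' a (by omega) (by omega))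
    subst ha0
    have hn1 : n' = n + 1 := by
      by_contra h0
      have e := eq_of_window_eq he n (by omega)
      simp only [Nat.add_zero] at e
      exact h4 (by rw [e]; exact hf' n hn (by omega))
    rw [he, hn1]; rfl

theorem window_isRotated {c : ℕ → V} (hper : ∀ i, c (i + k) = c i) (s : ℕ) :
    window c 0 k ~r window c s k := by
  induction s with
  | zero => exact List.IsRotated.refl _
  | succ s ih =>
    refine ih.trans ?_
    rcases k with _ | k
    · exact List.IsRotated.refl _
    · refine ⟨1, ?_⟩
      rw [window_succ, window_succ_last c (s + 1), List.rotate_cons_succ, List.rotate_zero]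
      have e : s + 1 + k = s + (k + 1) := by omega
      rw [e, hper]

/-- With all nodes forced, a window over a full period recurs in every circuit. `dropLast` removes
the repeated end node, so that rotating the list means rotating the circuit. -/
theorem IsEulerSeq.isRotated_of_all_forced (h : IsEulerSeq G k c)
    (hloop : ∀ v, ¬ G.Adj v v) (hconn : G.toSimpleGraphInclusive.Connected)
    (hA : forcedNodes G = Set.univ) {C' : List V} (hC' : IsEulerianCircuit G C') (s : ℕ) :
    C'.dropLast ~r (window c s (k + 1)).dropLast := by
  have hlen : walkLength C' = k := by
    rw [← length_walkEdges, (hC'.perm (h.isEulerianCircuit 0)).length_eq, walkEdges_window,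
      length_window]
  obtain ⟨c', hc', hCe⟩ := hC'.exists_seq (by rw [hlen]; exact h.pos)
  rw [hlen] at hc' hCe
  rw [hCe, window_succ_last, window_succ_last, List.dropLast_concat, List.dropLast_concat]
  obtain ⟨i, hi⟩ := h.exists_window_eq hc' hloop hconn s k (fun j _ _ => by rw [hA]; trivial)
  rw [hi]
  exact window_isRotated hc'.periodic i

/-- Every nonempty window of at most `k` nodes is safe here, so maximality just means having `k`
nodes. -/
theorem IsEulerSeq.isMaximalSafe_iff_of_all_forced (h : IsEulerSeq G k c)
    (hloop : ∀ v, ¬ G.Adj v v) (hconn : G.toSimpleGraphInclusive.Connected)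
    (hA : forcedNodes G = Set.univ) (s : ℕ) (Q : List V) :
    IsMaximalSafe G Q ↔ AppearsInCircuit Q (window c s (k + 1)) ∧
      walkLength Q + 1 = walkLength (window c s (k + 1)) := by
  have h2k := h.two_le hloop
  have hsafe : ∀ Q, IsSafe G Q ↔ ∃ i n, Q = window c i n ∧ 0 < n ∧ n ≤ k := by
    intro Q
    rw [h.isSafe_iff hloop hconn, hA]
    simp
  have hwl : walkLength (window c s (k + 1)) = k := by simp [walkLength]
  rw [appearsInCircuit_window h.pos h.periodic, hwl]
  constructor
  · rintro ⟨hs, hmax⟩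
    obtain ⟨i, n, rfl, hn, hnk⟩ := (hsafe Q).1 hs
    have : n = k := by
      by_contra hne
      have := hmax (window c i (n + 1)) ((hsafe _).2 ⟨i, n + 1, rfl, by omega, by omega⟩)
        ⟨[], [c (i + n)], by rw [window_succ_last]; simp⟩
      simpa using congrArg List.length this
    subst this
    simp only [walkLength, length_window]
    exact ⟨⟨by omega, i, rfl⟩, by omega⟩
  · rintro ⟨⟨-, i, hi⟩, hlen⟩
    have hQ : Q.length = k := by unfold walkLength at hlen; omega
    rw [hQ] at hi
    refine ⟨(hsafe Q).2 ⟨i, k, hi, by omega, le_rfl⟩, ?_⟩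
    intro Q' hQ' hinf
    obtain ⟨i', n', rfl, -, hn'⟩ := (hsafe Q').1 hQ'
    refine (hinf.eq_of_length_le ?_).symm
    rw [length_window]; omega

/-! ### Recognizing cut nodes on an Eulerian circuit -/

/-- A node of degree two, met at the times `p < q`, is a cut node iff every node met between
these times is met only between them. -/
theorem IsEulerSeq.isCutNode_iff (h : IsEulerSeq G k c) (hloop : ∀ v, ¬ G.Adj v v)
    (hconn : G.toSimpleGraphInclusive.Connected) {p q : ℕ} (hpq : p < q) (hqk : q < k)
    (hc : c q = c p) (hd : outDegree G (c p) = 2) :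
    IsCutNode G.toSimpleGraphInclusive (c p) ↔
      ∀ j, p < j → j < q → ∀ i < k, c i = c j → p ≤ i ∧ i ≤ q := by
  have h' := h.shift p
  obtain ⟨q₀, hq0, hqk0, hq, hocc⟩ := h'.exists_of_outDegree_eq_two hd
  have e : ∀ i, p ≤ i → p + (i - p) = i := by omega
  obtain rfl : q - p = q₀ := by
    rcases hocc (q - p) (by omega) (by simp only [e q hpq.le, Nat.add_zero, hc]) with h1 | h1
    · omega
    · exact h1
  have hiff : IsCutNode G.toSimpleGraphInclusive (c p) ↔
      ¬ Interlaced (fun i => c (p + i)) k (q - p) :=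
    ⟨fun hcut hint => h'.not_isCutNode_of_interlaced hloop hconn hq hocc hint hcut,
      fun hint => h'.isCutNode_of_not_interlaced hloop hq0 hqk0 hq hocc hint⟩
  rw [hiff]
  constructor
  · intro hint j hpj hjq i hik hij
    have hjv : c j ≠ c p := by
      intro hj
      rcases hocc (j - p) (by omega) (by simp only [e j hpj.le, Nat.add_zero, hj]) with h1 | h1 <;>
        omega
    have hip : i ≠ p := by rintro rfl; exact hjv hij.symm
    have hiq : i ≠ q := by rintro rfl; exact hjv (hij.symm.trans hc)
    by_contra hcon
    rcases Nat.lt_or_ge i p with hlt | hge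
    -- A visit before `p` is taken one period later, which puts it behind `q` in the sequence
    -- shifted by `p`.
    · refine hint ⟨j - p, i + k - p, by omega, by omega, by omega, by omega, ?_⟩
      simp only [e j hpj.le, e (i + k) (by omega), h.periodic, hij]
    · refine hint ⟨j - p, i - p, by omega, by omega, by omega, by omega, ?_⟩
      simp only [e j hpj.le, e i hge, hij]
  · rintro hall ⟨a, b, ha0, haq, hqb, hbk, hab⟩
    rcases Nat.lt_or_ge (p + b) k with hlt | hge
    · have := hall (p + a) (by omega) (by omega) (p + b) hlt hab.symm
      omega
    · have e1 : p + b - k + k = p + b := by omega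
      have := hall (p + a) (by omega) (by omega) (p + b - k) (by omega)
        (by rw [← h.periodic, e1]; exact hab.symm)
      omega

/-! ### Cutting a circuit -/

/-- Cut the walk `cur ++ rest` behind every node of `rest` at which `F` fails and at its end. -/
def cutAt (F : V → Prop) [DecidablePred F] : List V → List V → List (List V)
  | _, [] => []
  | cur, x :: rest =>
    if F x ∧ rest ≠ [] then cutAt F (cur ++ [x]) rest else (cur ++ [x]) :: cutAt F [x] rest

variable {F : V → Prop} [DecidablePred F]

/-- Consecutive pieces share only their cut node, so no edge is lost or repeated. Coverage,
disjointness and total length of the pieces all come from this identity. -/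
theorem flatMap_walkEdges_cutAt (cur rest : List V) (hc : cur ≠ []) (hr : rest ≠ []) :
    (cutAt F cur rest).flatMap walkEdges = walkEdges (cur ++ rest) := by
  induction rest generalizing cur with
  | nil => exact (hr rfl).elim
  | cons x rest ih =>
    rw [cutAt]
    split_ifs with hx
    · rw [ih _ (by simp) hx.2]; simp
    · rw [walkEdges_append_cons, List.flatMap_cons]
      congr 1
      rcases rest with _ | ⟨y, rest⟩
      · rfl
      · rw [ih [x] (by simp) (by simp)]; rfl

theorem cutAt_of_forall (cur rest : List V) (hr : rest ≠ []) (hF : ∀ x ∈ rest, F x) :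
    cutAt F cur rest = [cur ++ rest] := by
  induction rest generalizing cur with
  | nil => exact (hr rfl).elim
  | cons x rest ih =>
    rw [cutAt]
    split_ifs with hx
    · rw [ih _ hx.2 fun y hy => hF y (List.mem_cons_of_mem _ hy)]; simp
    · have : rest = [] := by
        by_contra h0
        exact hx ⟨hF x List.mem_cons_self, h0⟩
      subst this
      rfl

/-- The induction carries the invariant that the current piece is a window that starts at a node
failing `F` and satisfies `F` at its later nodes. `hlast` takes care of the cut that happens only
because the list ends. -/
theorem mem_cutAt_window {c : ℕ → V} {m i n : ℕ} {Q : List V}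
    (hQ : Q ∈ cutAt F (window c i n) (window c (i + n) m)) (hn : 0 < n)
    (hi : ¬ F (c i)) (hlast : ¬ F (c (i + n + m - 1)))
    (hF : ∀ j, 0 < j → j < n → F (c (i + j))) :
    ∃ i' n', Q = window c i' (n' + 1) ∧ 0 < n' ∧ i ≤ i' ∧ i' + n' < i + n + m ∧
      ¬ F (c i') ∧ ¬ F (c (i' + n')) ∧ ∀ j, 0 < j → j < n' → F (c (i' + j)) := by
  induction m generalizing i n with
  | zero => simp [cutAt] at hQ
  | succ m ih =>
    rw [window_succ, cutAt, ← window_succ_last] at hQ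
    have e : i + (n + 1) + m - 1 = i + n + (m + 1) - 1 := by omega
    have hwne : window c (i + n + 1) m ≠ [] ↔ m ≠ 0 := by
      rw [← List.length_pos_iff_ne_nil, length_window]; omega
    split_ifs at hQ with hx
    · obtain ⟨i', n', h1, h2, h3, h4, h5⟩ := ih (i := i) (n := n + 1) hQ (by omega) hi
        (by rwa [e]) (fun j hj0 hj => by
          rcases Nat.lt_or_ge j n with h | h
          · exact hF j hj0 h
          · obtain rfl : j = n := by omega
            exact hx.1)
      exact ⟨i', n', h1, h2, h3, by omega, h5⟩
    · have hx' : ¬ F (c (i + n)) := by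
        intro hFx
        have hm : m = 0 := by
          by_contra hm
          exact hx ⟨hFx, hwne.2 hm⟩
        subst hm
        exact hlast hFx
      rcases List.mem_cons.1 hQ with rfl | hQ
      · exact ⟨i, n, rfl, hn, le_rfl, by omega, hi, hx', hF⟩
      · obtain ⟨i', n', h1, h2, h3, h4, h5⟩ := ih (i := i + n) (n := 1) hQ (by omega) hx'
          (by
            have e : i + n + 1 + m - 1 = i + n + (m + 1) - 1 := by omega
            rwa [e]) (fun j hj0 hj => by omega)
        exact ⟨i', n', h1, h2, by omega, by omega, h5⟩

/-- Cutting an Eulerian circuit that starts at an unforced node yields its cut segments. -/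
theorem IsEulerSeq.mem_cutAt_iff [DecidablePred (· ∈ forcedNodes G)] (h : IsEulerSeq G k c)
    (hloop : ∀ v, ¬ G.Adj v v)
    (hconn : G.toSimpleGraphInclusive.Connected) {r : ℕ} (hr : c r ∉ forcedNodes G)
    (Q : List V) :
    Q ∈ cutAt (· ∈ forcedNodes G) [c r] (window c (r + 1) k) ↔
      IsCutSegment G (window c 0 (k + 1)) Q := by
  have hk := h.pos
  have hmem : ∀ Q ∈ cutAt (· ∈ forcedNodes G) [c r] (window c (r + 1) k),
      ∃ i' n', Q = window c i' (n' + 1) ∧ 0 < n' ∧ n' + 1 ≤ k ∧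
      c i' ∉ forcedNodes G ∧ c (i' + n') ∉ forcedNodes G ∧
        ∀ j, 0 < j → j < n' → c (i' + j) ∈ forcedNodes G := by
    intro Q hQ
    have e : r + 1 + k - 1 = r + k := by omega
    obtain ⟨i, n, h1, h2, h3, h4, h5, h6, h7⟩ := mem_cutAt_window (n := 1) hQ (by omega) hr
      (by rw [e, h.periodic]; exact hr) (fun j _ _ => by omega)
    refine ⟨i, n, h1, h2, ?_, h5, h6, h7⟩
    -- A piece with `k` edges would be the whole circuit from `r` on, with only forced nodes inside;
    -- but the unforced node `c r` occurs a second time within the period.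
    by_contra hnk
    obtain rfl : i = r := by omega
    obtain ⟨a, b, hab, hb, -, hb'⟩ := h.exists_two_of_unforced hloop hconn hr i
    exact hr (by rw [← hb']; exact h7 b (by omega) (by omega))
  rw [h.isCutSegment_iff]
  constructor
  · exact hmem Q
  · rintro ⟨i, n, rfl, hn, hnk, h3, h4, h5⟩
    -- The first edge of the segment lies in some piece. As the segment starts unforced, this edge
    -- is also the first one of the piece, and both then run to the next unforced node.
    have hedge : (c i, c (i + 1)) ∈ walkEdges (window c r (k + 1)) :=
      ((isEulerianCircuit_iff _ _).1 (h.isEulerianCircuit r)).2.2.2 _ _ |>.1 (h.adj i)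
    have hfm := flatMap_walkEdges_cutAt (F := (· ∈ forcedNodes G)) [c r] (window c (r + 1) k)
      (by simp) (by rw [← List.length_pos_iff_ne_nil, length_window]; exact hk)
    rw [List.singleton_append, ← window_succ] at hfm
    rw [← hfm, List.mem_flatMap] at hedge
    obtain ⟨Q', hQ', he⟩ := hedge
    obtain ⟨i', n', rfl, hn', hnk', h3', h4', h5'⟩ := hmem Q' hQ'
    rw [walkEdges_window] at he
    obtain ⟨j, hj, he⟩ := mem_window.1 he
    rw [Prod.mk.injEq] at he
    have hj0 : j = 0 := by
      by_contra h0
      exact h3 (by rw [← he.1]; exact h5' j (by omega) hj)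
    subst hj0
    have hmod := h.inj _ _ he.1 he.2
    have hc : ∀ t, c (i + t) = c (i' + t) := fun t => h.congr (hmod.symm.add_right t)
    have hnn : n = n' := by
      rcases lt_trichotomy n n' with hlt | heq | hlt
      · exact (h4 (by rw [hc]; exact h5' n hn hlt)).elim
      · exact heq
      · exact (h4' (by rw [← hc]; exact h5 n' hn' hlt)).elim
    subst hnn
    rw [window_congr fun t _ => hc t]
    exact hQ'

open Classical in
/-- The list obtained by cutting an Eulerian circuit, started at an unforced node if there is
one, has the properties required of the output. -/
theorem IsEulerSeq.cutAt_spec (h : IsEulerSeq G k c) (hloop : ∀ v, ¬ G.Adj v v)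
    (hconn : G.toSimpleGraphInclusive.Connected) {r : ℕ}
    (hr : c r ∉ forcedNodes G ∨ forcedNodes G = Set.univ) {L : List (List V)}
    (hL : L = cutAt (· ∈ forcedNodes G) [c r] (window c (r + 1) k)) :
    (forcedNodes G ≠ Set.univ →
      L.Nodup ∧ (∀ Q, Q ∈ L ↔ IsMaximalSafe G Q) ∧
      ∀ C, IsEulerianCircuit G C → ∀ Q, IsMaximalSafe G Q ↔ IsCutSegment G C Q) ∧
    (forcedNodes G = Set.univ →
      ∃ C, L = [C] ∧ IsEulerianCircuit G C ∧
        (∀ C', IsEulerianCircuit G C' → C'.dropLast ~r C.dropLast) ∧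
        ∀ Q, IsMaximalSafe G Q ↔ AppearsInCircuit Q C ∧ walkLength Q + 1 = walkLength C) ∧
    L.Pairwise (fun Q Q' => (walkEdges Q).Disjoint (walkEdges Q')) ∧
    (L.map walkLength).sum = k := by
  have hk := h.pos
  have hwne : window c (r + 1) k ≠ [] := by
    rw [← List.length_pos_iff_ne_nil, length_window]; exact hk
  have hfm := flatMap_walkEdges_cutAt (F := (· ∈ forcedNodes G)) [c r] (window c (r + 1) k)
    (by simp) hwne
  rw [List.singleton_append, ← window_succ, ← hL] at hfm
  have hE := h.isEulerianCircuit r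
  have hnd := ((isEulerianCircuit_iff _ _).1 hE).2.2.1
  rw [← hfm, List.nodup_flatMap] at hnd
  refine ⟨?_, ?_, hnd.2, ?_⟩
  · intro hA
    have hr' := hr.resolve_right hA
    have hmem := h.mem_cutAt_iff hloop hconn hr'
    rw [← hL] at hmem
    refine ⟨?_, ?_, ?_⟩
    -- Edge-disjoint walks with at least one edge cannot be equal.
    · refine hnd.2.imp_of_mem ?_
      rintro Q Q' hQ - hdis rfl
      obtain ⟨i, n, rfl, hn, -⟩ := (h.isCutSegment_iff 0 Q).1 ((hmem Q).1 hQ)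
      rw [Function.onFun, walkEdges_window] at hdis
      have hin : (c i, c (i + 1)) ∈ window (fun i => (c i, c (i + 1))) i n :=
        mem_window.2 ⟨0, hn, rfl⟩
      exact hdis hin hin
    · intro Q
      rw [hmem, h.isMaximalSafe_iff_isCutSegment hloop hconn hA]
    · intro C hC Q
      have hlen : walkLength C = k := by
        rw [← length_walkEdges, (hC.perm hE).length_eq, walkEdges_window, length_window]
      obtain ⟨c', hc', hCe⟩ := hC.exists_seq (by rw [hlen]; exact hk)
      rw [hlen] at hc' hCe
      rw [hCe]
      exact hc'.isMaximalSafe_iff_isCutSegment hloop hconn hA Q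
  · intro hA
    refine ⟨window c r (k + 1), ?_, hE, ?_, ?_⟩
    · rw [hL, cutAt_of_forall _ _ hwne (fun x _ => by rw [hA]; trivial), window_succ]; rfl
    · intro C' hC'
      exact h.isRotated_of_all_forced hloop hconn hA hC' r
    · exact h.isMaximalSafe_iff_of_all_forced hloop hconn hA r
  · have := congrArg List.length hfm
    rw [List.length_flatMap, walkEdges_window, length_window] at this
    rw [← this]
    congr 1
    exact List.map_congr_left fun Q _ => (length_walkEdges Q).symm

/-! ### Graphs without edges -/

/-- The circuit `[x]` has length `0`, so no walk appears in it and none is safe. All degrees are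
`0`, so `A(G)` is empty and differs from `V`. -/
theorem edgeless_spec {V : Type*} {G : Digraph V} (hG : ∀ u v, ¬ G.Adj u v)
    (hne : Nonempty V) {L : List (List V)} (hL : L = []) :
    (forcedNodes G ≠ Set.univ →
      L.Nodup ∧ (∀ Q, Q ∈ L ↔ IsMaximalSafe G Q) ∧
      ∀ C, IsEulerianCircuit G C → ∀ Q, IsMaximalSafe G Q ↔ IsCutSegment G C Q) ∧
    (forcedNodes G = Set.univ →
      ∃ C, L = [C] ∧ IsEulerianCircuit G C ∧
        (∀ C', IsEulerianCircuit G C' → C'.dropLast ~r C.dropLast) ∧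
        ∀ Q, IsMaximalSafe G Q ↔ AppearsInCircuit Q C ∧ walkLength Q + 1 = walkLength C) ∧
    L.Pairwise (fun Q Q' => (walkEdges Q).Disjoint (walkEdges Q')) ∧
    (L.map walkLength).sum = 0 := by
  subst hL
  obtain ⟨x⟩ := hne
  have hlen : ∀ C, IsEulerianCircuit G C → walkLength C = 0 := by
    intro C hC
    rw [← length_walkEdges, List.length_eq_zero_iff, List.eq_nil_iff_forall_not_mem]
    rintro ⟨u, v⟩ huv
    exact hG u v ((((isEulerianCircuit_iff _ _).1 hC).2.2.2 u v).2 huv)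
  have happ : ∀ Q C, IsEulerianCircuit G C → ¬ AppearsInCircuit Q C := by
    intro Q C hC hQ
    have := hQ.1
    rw [hlen C hC] at this
    omega
  have hx : IsEulerianCircuit G [x] :=
    (isEulerianCircuit_iff _ _).2 ⟨by simp, by simp, by simp [walkEdges_singleton],
      fun u v => by simp [walkEdges_singleton, hG]⟩
  have hmax : ∀ Q, ¬ IsMaximalSafe G Q := fun Q hQ => happ Q _ hx (hQ.1.2 _ hx)
  refine ⟨fun _ => ⟨List.nodup_nil, fun Q => by simp [hmax], fun C hC Q => ?_⟩, fun hA => ?_,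
    List.Pairwise.nil, rfl⟩
  · exact ⟨fun h => (hmax Q h).elim, fun h => (happ Q C hC h.1).elim⟩
  · have h1 : x ∈ forcedNodes G := by rw [hA]; trivial
    have h0 : outDegree G x = 0 := by
      have : {w | G.Adj x w} = ∅ := by ext w; simp [hG]
      rw [outDegree, this, Set.ncard_empty]
    rcases h1 with h1 | h1
    · omega
    · have := h1.1
      omega

end EulerSafe

namespace RAM

/-! ### Reasoning about programs -/

/-- The program has no loops. -/
def Prog.LoopFree : Prog → Prop
  | .skip => True
  | .assign _ _ => True
  | .store _ _ _ => True
  | .write _ => True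
  | .seq p q => p.LoopFree ∧ q.LoopFree
  | .ite _ p q => p.LoopFree ∧ q.LoopFree
  | .while _ _ => False

open Classical in
/-- The final state of a loop-free program. -/
noncomputable def Prog.run : Prog → State → State
  | .skip, s => s
  | .assign r e, s => { s with reg := Function.update s.reg r (e.eval s) }
  | .store a i e, s =>
    { s with arr := Function.update s.arr a (Function.update (s.arr a) (i.eval s) (e.eval s)) }
  | .write e, s => { s with out := s.out ++ [e.eval s] }
  | .seq p q, s => q.run (p.run s)
  | .ite b p q, s => if b.holds s then p.run s else q.run s
  | .while _ _, s => s

/-- A bound for the number of steps of a loop-free program. -/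
def Prog.bound : Prog → ℕ
  | .skip => 1
  | .assign _ e => e.cost + 1
  | .store _ i e => i.cost + e.cost + 1
  | .write e => e.cost + 1
  | .seq p q => p.bound + q.bound
  | .ite b p q => b.cost + (p.bound + q.bound)
  | .while _ _ => 0

/-- Started in `s`, the program halts within `B` steps in a state that satisfies `Q`. -/
def Runs (p : Prog) (s : State) (B : ℕ) (Q : State → Prop) : Prop :=
  ∃ s' t, Exec p s s' t ∧ t ≤ B ∧ Q s'

/-- This allows loop bodies to be evaluated as functions. Charging both branches of an `ite` makes
`bound` independent of the state, so for a concrete program it is a numeral that `decide` can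
compare. -/
theorem Prog.LoopFree.exec {p : Prog} (hp : p.LoopFree) (s : State) :
    ∃ t ≤ p.bound, Exec p s (p.run s) t := by
  induction p generalizing s with
  | skip => exact ⟨_, le_rfl, .skip s⟩
  | assign r e => exact ⟨_, le_rfl, .assign r e s⟩
  | store a i e => exact ⟨_, le_rfl, .store a i e s⟩
  | write e => exact ⟨_, le_rfl, .write e s⟩
  | seq p q ihp ihq =>
    obtain ⟨t, ht, h1⟩ := ihp hp.1 s
    obtain ⟨u, hu, h2⟩ := ihq hp.2 (p.run s)
    exact ⟨t + u, Nat.add_le_add ht hu, .seq _ _ _ _ _ _ _ h1 h2⟩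
  | ite b p q ihp ihq =>
    by_cases hb : b.holds s
    · obtain ⟨t, ht, h1⟩ := ihp hp.1 s
      refine ⟨b.cost + t, by simp only [Prog.bound]; omega, ?_⟩
      rw [Prog.run, if_pos hb]
      exact .ite_true _ _ _ _ _ _ hb h1
    · obtain ⟨t, ht, h1⟩ := ihq hp.2 s
      refine ⟨b.cost + t, by simp only [Prog.bound]; omega, ?_⟩
      rw [Prog.run, if_neg hb]
      exact .ite_false _ _ _ _ _ _ hb h1
  | _ => exact hp.elim

theorem Runs.of_loopFree {p : Prog} (hp : p.LoopFree) {s : State} {Q : State → Prop}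
    (hQ : Q (p.run s)) : Runs p s p.bound Q := by
  obtain ⟨t, ht, h⟩ := hp.exec s
  exact ⟨_, t, h, ht, hQ⟩

theorem Runs.seq {p q : Prog} {s : State} {A B : ℕ} {P Q : State → Prop} (hp : Runs p s A P)
    (hq : ∀ s', P s' → Runs q s' B Q) : Runs (.seq p q) s (A + B) Q := by
  obtain ⟨s', t, h1, ht, hP⟩ := hp
  obtain ⟨s'', u, h2, hu, hQ⟩ := hq s' hP
  exact ⟨s'', t + u, .seq _ _ _ _ _ _ _ h1 h2, Nat.add_le_add ht hu, hQ⟩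

theorem Runs.mono {p : Prog} {s : State} {A B : ℕ} {P Q : State → Prop} (hp : Runs p s A P)
    (hAB : A ≤ B) (hPQ : ∀ s', P s' → Q s') : Runs p s B Q := by
  obtain ⟨s', t, h1, ht, hP⟩ := hp
  exact ⟨s', t, h1, ht.trans hAB, hPQ s' hP⟩

/-- A loop with a loop-free body, an invariant `I` and a bound `n` on the remaining rounds. -/
theorem Runs.loop {b : Test} {p : Prog} (hp : p.LoopFree) {I : State → ℕ → Prop}
    (step : ∀ s n, I s n → b.holds s → ∃ n' < n, I (p.run s) n') {s : State} {n : ℕ}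
    (h : I s n) :
    Runs (.while b p) s ((n + 1) * (b.cost + p.bound)) fun s' => (∃ n', I s' n') ∧ ¬ b.holds s' := by
  induction n using Nat.strong_induction_on generalizing s with
  | _ n ih =>
    by_cases hb : b.holds s
    · obtain ⟨n', hn', h'⟩ := step s n h hb
      obtain ⟨t, ht, h1⟩ := hp.exec s
      obtain ⟨s', u, h2, hu, hQ⟩ := ih n' hn' h'
      refine ⟨s', _, .while_true _ _ _ _ _ _ _ hb h1 h2, ?_, hQ⟩
      have : (n' + 1 + 1) * (b.cost + p.bound) ≤ (n + 1) * (b.cost + p.bound) :=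
        Nat.mul_le_mul_right _ (by omega)
      rw [Nat.succ_mul] at this
      omega
    · refine ⟨s, _, .while_false _ _ _ hb, ?_, ⟨n, h⟩, hb⟩
      calc b.cost ≤ 1 * (b.cost + p.bound) := by omega
        _ ≤ _ := Nat.mul_le_mul_right _ (by omega)

/-! ### Linked lists and stacks in arrays -/

/-- The pointer `p` heads the linked list `l`; the pointer to the cell `e` is `e + 1`, and the
null pointer is `0`. -/
def IsLinked (nx : ℕ → ℕ) : ℕ → List ℕ → Prop
  | p, [] => p = 0
  | p, e :: l => p = e + 1 ∧ IsLinked nx (nx e) l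

theorem IsLinked.update {nx : ℕ → ℕ} {p : ℕ} {l : List ℕ} (h : IsLinked nx p l) {i x : ℕ}
    (hi : i ∉ l) : IsLinked (Function.update nx i x) p l := by
  induction l generalizing p with
  | nil => exact h
  | cons e l ih =>
    rw [List.mem_cons, not_or] at hi
    exact ⟨h.1, by rw [Function.update_of_ne (Ne.symm hi.1)]; exact ih h.2 hi.2⟩

/-- The array `f` holds the stack `l`, whose top is the first element. -/
def IsStack (f : ℕ → ℕ) : List ℕ → Prop
  | [] => True
  | x :: l => f l.length = x ∧ IsStack f l

theorem IsStack.update {f : ℕ → ℕ} {l : List ℕ} (h : IsStack f l) {i x : ℕ}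
    (hi : l.length ≤ i) : IsStack (Function.update f i x) l := by
  induction l with
  | nil => trivial
  | cons y l ih =>
    rw [List.length_cons] at hi
    exact ⟨by rw [Function.update_of_ne (by omega)]; exact h.1, ih h.2 (by omega)⟩

theorem IsStack.push {f : ℕ → ℕ} {l : List ℕ} (h : IsStack f l) (x : ℕ) :
    IsStack (Function.update f l.length x) (x :: l) :=
  ⟨by simp, h.update le_rfl⟩

/-! ### Lists of the incoming edges -/

/-- The body of `buildLists`. -/
def buildStep : Prog :=
  .seq (.store 3 (.reg 2) (.get 2 (.get 1 (.reg 2))))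
    (.seq (.store 2 (.get 1 (.reg 2)) (.succ (.reg 2)))
      (.assign 2 (.succ (.reg 2))))

/-- Build, in the arrays `2` (heads) and `3` (links), the linked lists of the edges that enter
each node. -/
def buildLists : Prog :=
  .while (.lt (.reg 2) (.reg 1)) buildStep

/-- The numbers below `m` of the edges with head `v`, in decreasing order. -/
def inEdges (H : ℕ → ℕ) (m v : ℕ) : List ℕ :=
  ((List.range m).filter fun e => H e = v).reverse

theorem mem_inEdges {H : ℕ → ℕ} {m v e : ℕ} : e ∈ inEdges H m v ↔ e < m ∧ H e = v := by
  simp [inEdges]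

theorem nodup_inEdges (H : ℕ → ℕ) (m v : ℕ) : (inEdges H m v).Nodup := by
  rw [inEdges, List.nodup_reverse]
  exact List.nodup_range.filter _

theorem inEdges_succ (H : ℕ → ℕ) (m v : ℕ) :
    inEdges H (m + 1) v = if H m = v then m :: inEdges H m v else inEdges H m v := by
  unfold inEdges
  rw [List.range_succ, List.filter_append]
  split_ifs with h <;> simp [h]

/-- Each round prepends one edge to the list of its head. The link cell that is written belongs to
an edge on no list yet, so the existing lists survive. -/
theorem buildLists_runs (s₀ : State) (h2 : s₀.reg 2 = 0) (ha : s₀.arr 2 = 0) :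
    Runs buildLists s₀ ((s₀.reg 1 + 1) * 20) fun s =>
      (∀ r, r ≠ 2 → s.reg r = s₀.reg r) ∧ (∀ a, a ≠ 2 → a ≠ 3 → s.arr a = s₀.arr a) ∧
      s.out = s₀.out ∧
      ∀ v, IsLinked (s.arr 3) (s.arr 2 v) (inEdges (s₀.arr 1) (s₀.reg 1) v) := by
  refine (Runs.loop (p := buildStep) (by simp [buildStep, Prog.LoopFree])
    (I := fun s n => s.reg 2 + n = s₀.reg 1 ∧
      (∀ r, r ≠ 2 → s.reg r = s₀.reg r) ∧ (∀ a, a ≠ 2 → a ≠ 3 → s.arr a = s₀.arr a) ∧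
      s.out = s₀.out ∧ ∀ v, IsLinked (s.arr 3) (s.arr 2 v) (inEdges (s₀.arr 1) (s.reg 2) v))
    ?_ (n := s₀.reg 1) ?_).mono ?_ ?_
  · rintro s n ⟨hi, hreg, harr, hout, hl⟩ hb
    simp only [Test.holds, Expr.eval, hreg 1 (by decide)] at hb
    refine ⟨n - 1, by omega, ?_, ?_, ?_, ?_, ?_⟩
    · simp [buildStep, Prog.run, Expr.eval]; omega
    · intro r hr
      simp [buildStep, Prog.run, hr, hreg]
    · intro a h2 h3
      simp [buildStep, Prog.run, h2, h3, harr]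
    · simp [buildStep, Prog.run, hout]
    · intro v
      have e1 := harr 1 (by decide) (by decide)
      simp only [buildStep, Prog.run, Expr.eval, Function.update_self, ne_eq,
        Nat.reduceEqDiff, not_false_eq_true, Function.update_of_ne,
        OfNat.one_ne_ofNat, e1, inEdges_succ]
      have hnot : ∀ v, s.reg 2 ∉ inEdges (s₀.arr 1) (s.reg 2) v := fun v hv =>
        lt_irrefl _ (mem_inEdges.1 hv).1
      by_cases hv : s₀.arr 1 (s.reg 2) = v
      · subst hv
        rw [if_pos rfl, Function.update_self]
        exact ⟨rfl, by rw [Function.update_self]; exact (hl _).update (hnot _)⟩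
      · rw [if_neg hv, Function.update_of_ne (Ne.symm hv)]
        exact (hl _).update (hnot _)
  · refine ⟨by omega, fun _ _ => rfl, fun _ _ _ => rfl, rfl, fun v => ?_⟩
    rw [h2, ha]; rfl
  · exact Nat.mul_le_mul_left _ (by decide)
  · rintro s ⟨⟨n, hi, hreg, harr, hout, hl⟩, hb⟩
    refine ⟨hreg, harr, hout, ?_⟩
    simp only [Test.holds, Expr.eval, hreg 1 (by decide)] at hb
    have : s.reg 2 = s₀.reg 1 := by omega
    rwa [this] at hl

/-! ### Hierholzer's algorithm -/

open EulerSafe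

/-- Every entry of a walk except the last is the tail of one edge. Together with `walkEdges_snd`
this turns degree balance into cancellation of multisets. -/
theorem walkEdges_fst {α : Type*} (W : List α) {z : α} (hz : W.getLast? = some z) :
    ((walkEdges W).map Prod.fst : Multiset α) + {z} = W := by
  obtain ⟨W, rfl⟩ : ∃ l, W = l ++ [z] := List.getLast?_eq_some_iff.1 hz
  have : (walkEdges (W ++ [z])).map Prod.fst = W := by
    clear hz
    induction W with
    | nil => rfl
    | cons a W ih =>
      rcases W with _ | ⟨b, W⟩
      · rfl
      · simpa [walkEdges_cons_cons] using ih
  rw [this, Multiset.add_comm, Multiset.singleton_add, Multiset.cons_coe]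
  exact Multiset.coe_eq_coe.2 (List.perm_append_singleton z W).symm

theorem walkEdges_snd {α : Type*} (W : List α) {a : α} (ha : W.head? = some a) :
    ((walkEdges W).map Prod.snd : Multiset α) + {a} = W := by
  rcases W with _ | ⟨b, W⟩
  · simp at ha
  obtain rfl : b = a := by simpa using ha
  have : (walkEdges (b :: W)).map Prod.snd = W := by
    rw [walkEdges, List.map_snd_zip (by simp)]
    rfl
  rw [this, Multiset.add_comm, Multiset.singleton_add, Multiset.cons_coe]

/-- The edges with numbers in `R`. -/
def edgesOf (T H : ℕ → ℕ) (R : Finset ℕ) : Multiset (ℕ × ℕ) :=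
  R.val.map fun e => (T e, H e)

/-- The state of the search: `W` is a closed trail through the node `0` that consists of the
completed part `K` and the part of the stack `S` below its last node on `W`; the rest of the stack
is a trail that leads to `W`; and `R` is the set of the unused edges. -/
def IsTour (T H : ℕ → ℕ) (m : ℕ) (R : Finset ℕ) (S K : List ℕ) : Prop :=
  ∃ W : List ℕ, W.head? = some 0 ∧ W.getLast? = some 0 ∧
    ((S = [] ∧ W = K ∧ edgesOf T H (Finset.range m) =
        (walkEdges W : Multiset (ℕ × ℕ)) + edgesOf T H R) ∨
      ∃ D j S₁, S = D ++ j :: S₁ ∧ W = K ++ j :: S₁ ∧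
        edgesOf T H (Finset.range m) =
          (walkEdges W : Multiset (ℕ × ℕ)) + (walkEdges (D ++ [j]) : Multiset (ℕ × ℕ)) +
          edgesOf T H R)

variable {T H : ℕ → ℕ} {m : ℕ} {R : Finset ℕ} {S K : List ℕ}

/-- The open trail `D` grows at its front, backwards along `e`; the closed trail `W` is untouched.
-/
theorem IsTour.push {u e : ℕ} (h : IsTour T H m R (u :: S) K) (he : e ∈ R) (hu : H e = u) :
    IsTour T H m (R.erase e) (T e :: u :: S) K := by
  obtain ⟨W, h1, h2, ⟨h3, -⟩ | ⟨D, j, S₁, h3, h4, h5⟩⟩ := h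
  · simp at h3
  refine ⟨W, h1, h2, Or.inr ⟨T e :: D, j, S₁, by rw [h3]; rfl, h4, ?_⟩⟩
  have hD : ∃ t, D ++ [j] = u :: t := by
    rcases D with _ | ⟨d, D⟩
    · simp only [List.nil_append, List.cons.injEq] at h3
      exact ⟨[], by simp [h3.1]⟩
    · simp only [List.cons_append, List.cons.injEq] at h3
      exact ⟨D ++ [j], by simp [h3.1]⟩
  obtain ⟨t, ht⟩ := hD
  have hR : edgesOf T H R = (T e, H e) ::ₘ edgesOf T H (R.erase e) := by
    unfold edgesOf
    rw [Finset.erase_val, ← Multiset.map_cons (fun e => (T e, H e)), Multiset.cons_erase he]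
  rw [h5, hR, List.cons_append, ht, walkEdges_cons_cons, hu, ← Multiset.cons_coe,
    Multiset.add_cons, Multiset.add_cons, Multiset.cons_add]

/-- The open trail leads from `u` to a node `j` of `W`. All edges together are balanced and so is
`W`; if no unused edge enters `u`, balance at `u` forces `j = u`. The open trail is then closed and
can be spliced into `W`. -/
theorem IsTour.pop {u : ℕ} (h : IsTour T H m R (u :: S) K)
    (hbal : (Multiset.range m).map T = (Multiset.range m).map H)
    (hu : ∀ e ∈ R, H e ≠ u) : IsTour T H m R S (K ++ [u]) := by
  obtain ⟨W, h1, h2, ⟨h3, -⟩ | ⟨D, j, S₁, h3, h4, h5⟩⟩ := h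
  · simp at h3
  have hhead : (D ++ [j]).head? = some u := by
    rcases D with _ | ⟨d, D⟩
    · simp only [List.nil_append, List.cons.injEq] at h3
      simp [h3.1]
    · simp only [List.cons_append, List.cons.injEq] at h3
      simp [h3.1]
  have huj : u = j := by
    have f1 := congrArg (Multiset.map Prod.fst) h5
    have f2 := congrArg (Multiset.map Prod.snd) h5
    simp only [edgesOf, Multiset.map_add, Multiset.map_map, Function.comp_def,
      Finset.range_val, Multiset.map_coe] at f1 f2
    rw [hbal, f2] at f1
    have w1 := walkEdges_fst W h2
    have w2 := walkEdges_snd W h1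
    rw [← w2] at w1
    have w3 := add_right_cancel w1
    have d1 := walkEdges_fst (D ++ [j]) (z := j) (by simp)
    have d2 := walkEdges_snd (D ++ [j]) hhead
    rw [← d2] at d1
    rw [w3, add_assoc, add_assoc] at f1
    have f3 := add_left_cancel f1
    -- After the edges of `W` cancel, the open trail contributes its heads and `u` on one side
    -- against its tails and `j` on the other.
    have f4 : ((walkEdges (D ++ [j])).map Prod.snd : Multiset ℕ) + (Multiset.map H R.val + {j}) =
        ((walkEdges (D ++ [j])).map Prod.snd : Multiset ℕ) + (Multiset.map T R.val + {u}) := by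
      rw [← add_assoc, f3, add_right_comm, d1]
      rw [add_right_comm, add_assoc]
    have f5 := add_left_cancel f4
    have f6 : u ∈ Multiset.map H R.val + {j} := by rw [f5]; simp
    rcases Multiset.mem_add.1 f6 with f6 | f6
    · obtain ⟨e, he, heu⟩ := Multiset.mem_map.1 f6
      exact (hu e he heu).elim
    · simpa using f6
  subst huj
  have e1 : walkEdges (K ++ u :: S) = walkEdges (K ++ [u]) ++
      (walkEdges (D ++ [u]) ++ walkEdges (u :: S₁)) := by
    rw [walkEdges_append_cons, h3, walkEdges_append_cons D]
  have e2 : walkEdges W = walkEdges (K ++ [u]) ++ walkEdges (u :: S₁) := by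
    rw [h4, walkEdges_append_cons]
  have h6 : edgesOf T H (Finset.range m) =
      (walkEdges (K ++ u :: S) : Multiset (ℕ × ℕ)) + edgesOf T H R := by
    rw [h5, e1, e2, ← Multiset.coe_add, ← Multiset.coe_add, ← Multiset.coe_add]
    rw [add_assoc (walkEdges (K ++ [u]) : Multiset (ℕ × ℕ)),
      add_comm (walkEdges (D ++ [u]) : Multiset (ℕ × ℕ))]
  refine ⟨K ++ u :: S, ?_, ?_, ?_⟩
  · rw [h4] at h1
    rcases K with _ | ⟨a, K⟩ <;> simpa using h1
  · rw [h4] at h2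
    rw [h3]
    simpa using h2
  · rcases S with _ | ⟨j, S⟩
    · exact Or.inl ⟨rfl, rfl, h6⟩
    -- The whole remaining stack now lies on the closed trail, so the open trail restarts empty at
    -- its top.
    · refine Or.inr ⟨[], j, S, rfl, by simp, ?_⟩
      rw [h6, List.nil_append, walkEdges_singleton]
      simp

theorem isTour_start (T H : ℕ → ℕ) (m : ℕ) : IsTour T H m (Finset.range m) [0] [] :=
  ⟨[0], rfl, rfl, Or.inr ⟨[], 0, [], rfl, rfl, by simp [walkEdges_singleton]⟩⟩

/-- The body of `hierholzer`. -/
def hierholzerStep : Prog :=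
  .ite (.eq (.get 2 (.get 4 (.pred (.reg 3)))) (.lit 0))
    (.seq (.store 5 (.reg 4) (.get 4 (.pred (.reg 3))))
      (.seq (.assign 4 (.succ (.reg 4))) (.assign 3 (.pred (.reg 3)))))
    (.seq (.store 4 (.reg 3) (.get 0 (.pred (.get 2 (.get 4 (.pred (.reg 3)))))))
      (.seq (.store 2 (.get 4 (.pred (.reg 3)))
          (.get 3 (.pred (.get 2 (.get 4 (.pred (.reg 3)))))))
        (.assign 3 (.succ (.reg 3)))))

/-- Starting with the node `0` on the stack in array `4`, whose size is in register `3`, go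
backwards along unused edges; where there is none, move the top of the stack to the end of the
array `5`, whose size is in register `4`. -/
def hierholzer : Prog :=
  .seq (.assign 3 (.lit 1)) (.while (.lt (.lit 0) (.reg 3)) hierholzerStep)

/-- The potential `2 * R.card + S.length` falls by one in each round: a push uses up an edge, a pop
shortens the stack. It starts at `2 * m + 1`. The lists `adj` hold exactly the unused edges, and a
node enters the completed part only when no unused edge enters it, which stays true as `R` shrinks.
-/
theorem hierholzer_runs (s₀ : State) (h4 : s₀.reg 4 = 0) (ha : s₀.arr 4 = 0) (m : ℕ)
    (hbal : (Multiset.range m).map (s₀.arr 0) = (Multiset.range m).map (s₀.arr 1))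
    (hl : ∀ v, IsLinked (s₀.arr 3) (s₀.arr 2 v) (inEdges (s₀.arr 1) m v)) :
    Runs hierholzer s₀ ((m + 1) * 200) fun s =>
      (∀ r, r ≠ 3 → r ≠ 4 → s.reg r = s₀.reg r) ∧ s.reg 3 = 0 ∧
      (∀ a, a ≠ 2 → a ≠ 4 → a ≠ 5 → s.arr a = s₀.arr a) ∧
      s.out = s₀.out ∧
      ∃ R, IsTour (s₀.arr 0) (s₀.arr 1) m R [] (window (s.arr 5) 0 (s.reg 4)) ∧
        R ⊆ Finset.range m ∧
        ∀ e ∈ R, s₀.arr 1 e ∉ window (s.arr 5) 0 (s.reg 4) := by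
  set T := s₀.arr 0 with hT
  set H := s₀.arr 1 with hH
  refine (Runs.seq (Runs.of_loopFree (p := .assign 3 (.lit 1)) trivial
    (Q := fun s => s = (Prog.assign 3 (.lit 1)).run s₀) rfl) (fun s₁ hs₁ =>
    Runs.loop (p := hierholzerStep) (by simp [hierholzerStep, Prog.LoopFree])
    (I := fun s n => (∀ r, r ≠ 3 → r ≠ 4 → s.reg r = s₀.reg r) ∧
      (∀ a, a ≠ 2 → a ≠ 4 → a ≠ 5 → s.arr a = s₀.arr a) ∧ s.out = s₀.out ∧
      ∃ (R : Finset ℕ) (S : List ℕ) (adj : ℕ → List ℕ),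
        IsTour T H m R S (window (s.arr 5) 0 (s.reg 4)) ∧
        R ⊆ Finset.range m ∧ S.length = s.reg 3 ∧ IsStack (s.arr 4) S ∧
        (∀ v, IsLinked (s.arr 3) (s.arr 2 v) (adj v)) ∧ (∀ v, (adj v).Nodup) ∧
        (∀ v e, e ∈ adj v ↔ e ∈ R ∧ H e = v) ∧
        (∀ e ∈ R, H e ∉ window (s.arr 5) 0 (s.reg 4)) ∧ n = 2 * R.card + S.length)
    ?_ (n := 2 * m + 1) ?_)).mono ?_ ?_
  · rintro s n ⟨hreg, harr, hout, R, S, adj, htour, hRm, hlen, hstk, hlink, hnd, hadj, hK, hn⟩ hb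
    simp only [Test.holds, Expr.eval] at hb
    rcases S with _ | ⟨u, S⟩
    · simp at hlen; omega
    have hlen' : s.reg 3 = S.length + 1 := hlen.symm
    have hu : s.arr 4 S.length = u := hstk.1
    rcases hau : adj u with _ | ⟨e, l⟩
    · have hhd : s.arr 2 u = 0 := by have := hlink u; rwa [hau] at this
      have hrun : hierholzerStep.run s =
          { s with
            reg := Function.update (Function.update s.reg 4 (s.reg 4 + 1)) 3 S.length
            arr := Function.update s.arr 5 (Function.update (s.arr 5) (s.reg 4) u) } := by
        simp [hierholzerStep, Prog.run, Test.holds, Expr.eval, hlen', hu, hhd]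
      have hRu : ∀ e ∈ R, H e ≠ u := fun e he heu => by
        have := (hadj u e).2 ⟨he, heu⟩
        rw [hau] at this
        simp at this
      have hwin : window (Function.update (s.arr 5) (s.reg 4) u) 0 (s.reg 4 + 1) =
          window (s.arr 5) 0 (s.reg 4) ++ [u] := by
        rw [window_succ_last, Nat.zero_add, Function.update_self]
        congr 1
        refine window_congr fun j hj => ?_
        rw [Function.update_of_ne (by omega)]
      rw [hrun]
      refine ⟨n - 1, by simp only [List.length_cons] at hn; omega, ?_, ?_, hout, R, S, adj, ?_⟩
      · intro r h3 h4
        simp [h3, h4, hreg]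
      · intro a h2 h4 h5
        simp [h5, harr a h2 h4 h5]
      · simp only [Function.update_self, ne_eq, Nat.reduceEqDiff, not_false_eq_true,
          Function.update_of_ne, hwin]
        refine ⟨htour.pop hbal hRu, hRm, trivial, hstk.2, hlink, hnd, hadj, ?_, ?_⟩
        · intro e he hmem
          rcases List.mem_append.1 hmem with h | h
          · exact hK e he h
          · exact hRu e he (by simpa using h)
        · simp only [List.length_cons] at hn; omega
    · have hlu := hlink u
      rw [hau] at hlu
      have hhd : s.arr 2 u = e + 1 := hlu.1
      obtain ⟨heR, heu⟩ := (hadj u e).1 (by rw [hau]; simp)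
      have hTe : s.arr 0 e = T e := by rw [harr 0 (by decide) (by decide) (by decide)]
      have hrun : hierholzerStep.run s =
          { s with
            reg := Function.update s.reg 3 (S.length + 2)
            arr := Function.update (Function.update s.arr 4
              (Function.update (s.arr 4) (S.length + 1) (T e))) 2
              (Function.update (s.arr 2) u (s.arr 3 e)) } := by
        simp [hierholzerStep, Prog.run, Test.holds, Expr.eval, hlen', hu, hhd, hTe]
      rw [hrun]
      have hcard := Finset.card_erase_add_one heR
      refine ⟨n - 1, by simp only [List.length_cons] at hn; omega, ?_, ?_, hout, R.erase e,
        T e :: u :: S, Function.update adj u l, ?_⟩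
      · intro r h3 h4
        simp [h3, hreg r h3 h4]
      · intro a h2 h4 h5
        simp [h2, h4, harr a h2 h4 h5]
      · simp only [Function.update_self, ne_eq, Nat.reduceEqDiff, not_false_eq_true,
          Function.update_of_ne]
        refine ⟨htour.push heR heu, (Finset.erase_subset _ _).trans hRm, rfl, hstk.push (T e), ?_,
          ?_, ?_, ?_, ?_⟩
        · intro v
          by_cases hv : v = u
          · subst hv
            rw [Function.update_self, Function.update_self]
            exact hlu.2
          · rw [Function.update_of_ne hv, Function.update_of_ne hv]
            exact hlink v
        · intro v
          by_cases hv : v = u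
          · subst hv
            rw [Function.update_self]
            have := hnd v
            rw [hau] at this
            exact this.of_cons
          · rw [Function.update_of_ne hv]
            exact hnd v
        · intro v e'
          by_cases hv : v = u
          · subst hv
            rw [Function.update_self, Finset.mem_erase]
            have h1 := hnd v
            have h2 := hadj v e'
            rw [hau, List.mem_cons] at h2
            rw [hau, List.nodup_cons] at h1
            constructor
            · intro hmem
              refine ⟨⟨?_, (h2.1 (Or.inr hmem)).1⟩, (h2.1 (Or.inr hmem)).2⟩
              rintro rfl
              exact h1.1 hmem
            · rintro ⟨⟨h3, h4⟩, h5⟩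
              exact (h2.2 ⟨h4, h5⟩).resolve_left h3
          · rw [Function.update_of_ne hv, Finset.mem_erase, hadj]
            constructor
            · rintro ⟨h3, h4⟩
              refine ⟨⟨?_, h3⟩, h4⟩
              rintro rfl
              exact hv (h4.symm.trans heu)
            · rintro ⟨⟨-, h3⟩, h4⟩
              exact ⟨h3, h4⟩
        · intro e' he'
          exact hK e' (Finset.mem_of_mem_erase he')
        · simp only [List.length_cons] at hn ⊢; omega
  · subst hs₁
    refine ⟨?_, fun _ _ _ _ => rfl, rfl, Finset.range m, [0], inEdges H m, ?_, subset_rfl, ?_, ?_,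
      hl, nodup_inEdges H m, ?_, ?_, ?_⟩
    · intro r h3 _
      simp [Prog.run, h3]
    · simp [Prog.run, h4, isTour_start]
    · simp [Prog.run, Expr.eval]
    · simp [Prog.run, IsStack, ha]
    · intro v e
      rw [mem_inEdges, Finset.mem_range]
    · simp [Prog.run, h4]
    · simp
  · have : (Prog.assign 3 (.lit 1)).bound + (2 * m + 1 + 1) *
        ((Test.lt (.lit 0) (.reg 3)).cost + hierholzerStep.bound) ≤ 2 + (2 * m + 2) * 60 :=
      Nat.add_le_add (by decide) (Nat.mul_le_mul_left _ (by decide))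
    omega
  · rintro s ⟨⟨n, hreg, harr, hout, R, S, adj, htour, hRm, hlen, hstk, hlink, hnd, hadj, hK, hn⟩,
      hb⟩
    simp only [Test.holds, Expr.eval] at hb
    have h3 : s.reg 3 = 0 := by omega
    rw [h3, List.length_eq_zero_iff] at hlen
    subst hlen
    exact ⟨hreg, h3, harr, hout, R, htour, hRm, hK⟩

/-! ### From the arrays back to Eulerian circuits of the digraph -/

variable {n : ℕ} {G : Digraph (Fin n)} {E : List (Fin n × Fin n)}

/-- The tails, or the heads, of the edges as they are stored in an array. -/
def column (E : List (Fin n × Fin n)) (f : Fin n × Fin n → Fin n) (i : ℕ) : ℕ :=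
  (E.map fun e => (f e : ℕ)).getD i 0

theorem column_eq (f : Fin n × Fin n → Fin n) {i : ℕ} (hi : i < E.length) :
    column E f i = f E[i] := by
  simp [column, hi]

theorem map_column (E : List (Fin n × Fin n)) (f : Fin n × Fin n → Fin n) :
    (Multiset.range E.length).map (column E f) = (E.map fun e => (f e : ℕ) : List ℕ) := by
  rw [← Multiset.coe_range, Multiset.map_coe]
  congr 1
  refine List.ext_getElem (by simp) fun i h1 h2 => ?_
  simp only [List.length_map, List.length_range] at h1
  simp [column_eq, h1]

theorem edgesOf_column (E : List (Fin n × Fin n)) :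
    edgesOf (column E Prod.fst) (column E Prod.snd) (Finset.range E.length) =
      (E.map (Prod.map Fin.val Fin.val) : List (ℕ × ℕ)) := by
  rw [edgesOf, Finset.range_val, ← Multiset.coe_range, Multiset.map_coe]
  congr 1
  refine List.ext_getElem (by simp) fun i h1 h2 => ?_
  simp only [List.length_map, List.length_range] at h1
  simp [column_eq, h1, Prod.map]

theorem walkEdges_perm_edgeList {C : List (Fin n)} (hC : IsEulerianCircuit G C)
    (hnd : E.Nodup) (hE : ∀ u v, (u, v) ∈ E ↔ G.Adj u v) : (walkEdges C).Perm E := by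
  have h := (isEulerianCircuit_iff _ _).1 hC
  rw [List.perm_ext_iff_of_nodup h.2.2.1 hnd]
  rintro ⟨u, v⟩
  rw [hE, h.2.2.2]

/-- As many edges leave a node as enter it. -/
theorem column_balanced {C : List (Fin n)} (hC : IsEulerianCircuit G C)
    (hnd : E.Nodup) (hE : ∀ u v, (u, v) ∈ E ↔ G.Adj u v) :
    (Multiset.range E.length).map (column E Prod.fst) =
      (Multiset.range E.length).map (column E Prod.snd) := by
  have hp := walkEdges_perm_edgeList hC hnd hE
  obtain ⟨hne, hcl, -⟩ := (isEulerianCircuit_iff _ _).1 hC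
  obtain ⟨a, ha⟩ : ∃ a, C.head? = some a := by
    rcases C with _ | ⟨a, C⟩
    · exact (hne rfl).elim
    · exact ⟨a, rfl⟩
  have h1 := walkEdges_fst C (hcl ▸ ha)
  rw [← walkEdges_snd C ha] at h1
  have h2 : (walkEdges C).map Prod.fst |>.Perm ((walkEdges C).map Prod.snd) :=
    Multiset.coe_eq_coe.1 (add_right_cancel h1)
  have h3 : (E.map Prod.fst).Perm (E.map Prod.snd) :=
    ((hp.map Prod.fst).symm.trans h2).trans (hp.map Prod.snd)
  rw [map_column, map_column, Multiset.coe_eq_coe]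
  simpa [Function.comp_def] using h3.map Fin.val

/-- A completed tour is an Eulerian circuit. -/
theorem IsTour.exists_seq (hloop : ∀ v, ¬ G.Adj v v)
    (hconn : G.toSimpleGraphInclusive.Connected) {C₀ : List (Fin n)}
    (hC₀ : IsEulerianCircuit G C₀) (hnd : E.Nodup) (hE : ∀ u v, (u, v) ∈ E ↔ G.Adj u v)
    (hpos : 0 < E.length) {R : Finset ℕ} {circ : ℕ → ℕ} {l : ℕ}
    (ht : IsTour (column E Prod.fst) (column E Prod.snd) E.length R [] (window circ 0 l))
    (hRm : R ⊆ Finset.range E.length)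
    (hR : ∀ e ∈ R, column E Prod.snd e ∉ window circ 0 l) :
    ∃ c, IsEulerSeq G E.length c ∧ ∀ i ≤ E.length, circ i = c i := by
  set K := window circ 0 l with hK
  obtain ⟨W, h1, h2, ⟨-, rfl, h3⟩ | ⟨D, j, S₁, h3, -⟩⟩ := ht
  swap
  · simp at h3
  have hlen₀ : walkLength C₀ = E.length := by
    rw [← length_walkEdges, (walkEdges_perm_edgeList hC₀ hnd hE).length_eq]
  obtain ⟨c₀, hc₀, -⟩ := hC₀.exists_seq (by omega)
  rw [hlen₀] at hc₀
  have h0K : 0 ∈ K := List.mem_of_mem_head? h1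
  have hn : 0 < n := Fin.pos (c₀ 0)
  rw [edgesOf_column] at h3
  -- An edge into a visited node is not in `R`, so it lies on the tour and its tail is visited too.
  -- Going backwards along the known circuit `c₀` from the node `0`, this reaches all nodes and
  -- leaves `R` empty.
  have hback : ∀ i, (c₀ (i + 1) : ℕ) ∈ K → (c₀ i : ℕ) ∈ K := by
    intro i hi
    have hmem : ((c₀ i : ℕ), (c₀ (i + 1) : ℕ)) ∈
        ((E.map (Prod.map Fin.val Fin.val) : List (ℕ × ℕ)) : Multiset (ℕ × ℕ)) := by
      rw [Multiset.mem_coe, List.mem_map]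
      exact ⟨(c₀ i, c₀ (i + 1)), (hE _ _).2 (hc₀.adj i), rfl⟩
    rw [h3, Multiset.mem_add] at hmem
    rcases hmem with hmem | hmem
    · exact (List.of_mem_zip (Multiset.mem_coe.1 hmem)).1
    · obtain ⟨e, he, heq⟩ := Multiset.mem_map.1 hmem
      rw [Prod.mk.injEq] at heq
      exact (hR e he (by rw [heq.2]; exact hi)).elim
  have hback' : ∀ d i, (c₀ (i + d) : ℕ) ∈ K → (c₀ i : ℕ) ∈ K := by
    intro d
    induction d with
    | zero => exact fun i hi => hi
    | succ d ih => exact fun i hi => ih i (hback (i + d) hi)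
  have hall : ∀ i, (c₀ i : ℕ) ∈ K := by
    intro i
    obtain ⟨t, -, ht⟩ := hc₀.exists_index hloop hconn ⟨0, hn⟩
    -- `t + E.length * i` is a visit of `c₀` to the node `0` at time `i` or later, as a start for
    -- walking back to `i`.
    have hle : i ≤ t + E.length * i := le_add_left (Nat.le_mul_of_pos_left i hpos)
    obtain ⟨d, hd⟩ := Nat.exists_eq_add_of_le hle
    refine hback' d i ?_
    rw [← hd, hc₀.congr (j := t) (by simp [Nat.ModEq]), ht]
    exact h0K
  have hR0 : R = ∅ := by
    rw [Finset.eq_empty_iff_forall_notMem]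
    intro e he
    have hlt := Finset.mem_range.1 (hRm he)
    refine hR e he ?_
    rw [column_eq _ hlt]
    obtain ⟨i, -, -, hi⟩ := hc₀.surj E[e].1 E[e].2 ((hE _ _).1 (List.getElem_mem hlt))
    rw [← hi]
    exact hall _
  have hperm : (E.map (Prod.map Fin.val Fin.val)).Perm (walkEdges K) := by
    rw [hR0] at h3
    simpa [edgesOf] using h3
  have hlt : ∀ x ∈ K, x < n := by
    intro x hx
    have h4 := walkEdges_fst K h2
    rw [← Multiset.mem_coe, ← h4, Multiset.mem_add] at hx
    rcases hx with hx | hx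
    · obtain ⟨e, he, rfl⟩ := List.mem_map.1 (Multiset.mem_coe.1 hx)
      obtain ⟨e', -, rfl⟩ := List.mem_map.1 (hperm.mem_iff.2 he)
      exact e'.1.2
    · rw [Multiset.mem_singleton.1 hx]; exact hn
  obtain ⟨C, hC⟩ : ∃ C : List (Fin n), C.map Fin.val = K :=
    ⟨K.pmap (fun x hx => ⟨x, hx⟩) hlt, by simp [List.map_pmap]⟩
  rw [← hC, walkEdges_map] at hperm
  have hinj : Function.Injective (Prod.map Fin.val Fin.val : Fin n × Fin n → ℕ × ℕ) :=
    Fin.val_injective.prodMap Fin.val_injective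
  have hperm' : E.Perm (walkEdges C) := (List.map_perm_map_iff hinj).1 hperm
  have hCne : C ≠ [] := by
    rintro rfl
    rw [← hC] at h1
    simp at h1
  have hCcirc : IsEulerianCircuit G C := by
    refine (isEulerianCircuit_iff _ _).2 ⟨hCne, ?_, hperm'.nodup_iff.1 hnd, fun u v => ?_⟩
    · have h5 : (C.map Fin.val).head? = (C.map Fin.val).getLast? := by rw [hC, h1, h2]
      rw [List.head?_map, List.getLast?_map] at h5
      exact Option.map_injective Fin.val_injective h5
    · rw [← hE, hperm'.mem_iff]
  have hlenC : walkLength C = E.length := by rw [← length_walkEdges, hperm'.length_eq]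
  obtain ⟨c, hc, hCc⟩ := hCcirc.exists_seq (by omega)
  rw [hlenC] at hc hCc
  refine ⟨c, hc, fun i hi => ?_⟩
  have hl : l = E.length + 1 := by
    have := congrArg List.length hC
    rw [List.length_map, hCc, hK, length_window, length_window] at this
    exact this.symm
  have h6 : window circ 0 (E.length + 1) = window (fun i => (c i : ℕ)) 0 (E.length + 1) := by
    rw [← hl, ← hK, ← hC, hCc, hl]
    simp [window]
  simpa using eq_of_window_eq h6 i (by omega)

/-! ### First and last occurrences -/

/-- The arrays `deg`, `fst` and `lst` hold the number of occurrences and the first and the last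
occurrence of the numbers among `w 0, …, w (i - 1)`. -/
structure IsTally (w deg fst lst : ℕ → ℕ) (i : ℕ) : Prop where
  deg_eq : ∀ v, deg v = ((Finset.range i).filter fun j => w j = v).card
  w_fst : ∀ j < i, w (fst (w j)) = w j
  fst_le : ∀ j < i, fst (w j) ≤ j
  w_lst : ∀ j < i, w (lst (w j)) = w j
  le_lst : ∀ j < i, j ≤ lst (w j)
  lst_lt : ∀ j < i, lst (w j) < i

/-- Whether a node is new is read off from `deg`: entries of `fst` for unseen nodes are
unconstrained, and a default `0` would look like a visit at time `0`. -/
theorem IsTally.succ {w deg fst lst fst' : ℕ → ℕ} {i : ℕ} (h : IsTally w deg fst lst i)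
    (hf : fst' = if deg (w i) = 0 then Function.update fst (w i) i else fst) :
    IsTally w (Function.update deg (w i) (deg (w i) + 1)) fst'
      (Function.update lst (w i) i) (i + 1) := by
  have hdeg0 : deg (w i) = 0 ↔ ∀ j < i, w j ≠ w i := by
    rw [h.deg_eq, Finset.card_eq_zero, Finset.filter_eq_empty_iff]
    simp
  have key : ∀ j < i + 1, w (fst' (w j)) = w j ∧ fst' (w j) ≤ j := by
    intro j hj
    by_cases hd : deg (w i) = 0
    · rw [if_pos hd] at hf
      subst hf
      rcases Nat.lt_succ_iff_lt_or_eq.1 hj with hj | rfl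
      · rw [Function.update_of_ne (hdeg0.1 hd j hj)]
        exact ⟨h.w_fst j hj, h.fst_le j hj⟩
      · simp
    · rw [if_neg hd] at hf
      subst hf
      rcases Nat.lt_succ_iff_lt_or_eq.1 hj with hj | rfl
      · exact ⟨h.w_fst j hj, h.fst_le j hj⟩
      · rw [hdeg0] at hd
        push Not at hd
        obtain ⟨j', hj', he⟩ := hd
        rw [← he]
        exact ⟨h.w_fst j' hj', (h.fst_le j' hj').trans hj'.le⟩
  have key2 : ∀ j < i + 1, w (Function.update lst (w i) i (w j)) = w j ∧
      j ≤ Function.update lst (w i) i (w j) ∧ Function.update lst (w i) i (w j) < i + 1 := by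
    intro j hj
    by_cases he : w j = w i
    · rw [he, Function.update_self]
      exact ⟨rfl, by omega, by omega⟩
    · rw [Function.update_of_ne he]
      have hj' : j < i := by
        rcases Nat.lt_succ_iff_lt_or_eq.1 hj with hj | rfl
        · exact hj
        · exact (he rfl).elim
      exact ⟨h.w_lst j hj', h.le_lst j hj', (h.lst_lt j hj').trans (by omega)⟩
  refine ⟨fun v => ?_, fun j hj => (key j hj).1, fun j hj => (key j hj).2,
    fun j hj => (key2 j hj).1, fun j hj => (key2 j hj).2.1, fun j hj => (key2 j hj).2.2⟩
  rw [Finset.range_add_one, Finset.filter_insert]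
  by_cases hv : v = w i
  · subst hv
    rw [Function.update_self, if_pos rfl, Finset.card_insert_of_notMem (by simp), h.deg_eq]
  · rw [Function.update_of_ne hv, if_neg (Ne.symm hv), h.deg_eq]

/-- The body of `tally`. -/
def tallyStep : Prog :=
  .seq (.ite (.eq (.get 6 (.get 5 (.reg 2))) (.lit 0)) (.store 7 (.get 5 (.reg 2)) (.reg 2)) .skip)
    (.seq (.store 8 (.get 5 (.reg 2)) (.reg 2))
      (.seq (.store 6 (.get 5 (.reg 2)) (.succ (.get 6 (.get 5 (.reg 2)))))
        (.assign 2 (.succ (.reg 2)))))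

/-- Compute the number of occurrences and the first and the last occurrence of every node in the
array `5`. -/
def tally : Prog :=
  .seq (.assign 2 (.lit 0)) (.while (.lt (.reg 2) (.reg 1)) tallyStep)

theorem tally_runs (s₀ : State) (h6 : s₀.arr 6 = 0) :
    Runs tally s₀ ((s₀.reg 1 + 1) * 50) fun s =>
      (∀ r, r ≠ 2 → s.reg r = s₀.reg r) ∧
      (∀ a, a ≠ 6 → a ≠ 7 → a ≠ 8 → s.arr a = s₀.arr a) ∧ s.out = s₀.out ∧
      IsTally (s₀.arr 5) (s.arr 6) (s.arr 7) (s.arr 8) (s₀.reg 1) := by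
  refine (Runs.seq (Runs.of_loopFree (p := .assign 2 (.lit 0)) trivial
    (Q := fun s => s = (Prog.assign 2 (.lit 0)).run s₀) rfl) (fun s₁ hs₁ =>
    Runs.loop (p := tallyStep) (by simp [tallyStep, Prog.LoopFree])
    (I := fun s n => s.reg 2 + n = s₀.reg 1 ∧ (∀ r, r ≠ 2 → s.reg r = s₀.reg r) ∧
      (∀ a, a ≠ 6 → a ≠ 7 → a ≠ 8 → s.arr a = s₀.arr a) ∧ s.out = s₀.out ∧
      IsTally (s₀.arr 5) (s.arr 6) (s.arr 7) (s.arr 8) (s.reg 2))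
    ?_ (n := s₀.reg 1) ?_)).mono ?_ ?_
  · rintro s n ⟨hi, hreg, harr, hout, ht⟩ hb
    simp only [Test.holds, Expr.eval, hreg 1 (by decide)] at hb
    have e5 := harr 5 (by decide) (by decide) (by decide)
    have hrun : tallyStep.run s =
        { s with
          reg := Function.update s.reg 2 (s.reg 2 + 1)
          arr := Function.update (Function.update (Function.update s.arr 7
            (if s.arr 6 (s₀.arr 5 (s.reg 2)) = 0 then
              Function.update (s.arr 7) (s₀.arr 5 (s.reg 2)) (s.reg 2) else s.arr 7)) 8
            (Function.update (s.arr 8) (s₀.arr 5 (s.reg 2)) (s.reg 2))) 6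
            (Function.update (s.arr 6) (s₀.arr 5 (s.reg 2))
              (s.arr 6 (s₀.arr 5 (s.reg 2)) + 1)) } := by
      by_cases hd : s.arr 6 (s₀.arr 5 (s.reg 2)) = 0
      · simp [tallyStep, Prog.run, Test.holds, Expr.eval, hd, e5]
      · simp [tallyStep, Prog.run, Test.holds, Expr.eval, hd, e5]
    rw [hrun]
    refine ⟨n - 1, by omega, ?_, ?_, ?_, hout, ?_⟩
    · simp only [Function.update_self]; omega
    · intro r hr
      simp [hr, hreg]
    · intro a h6 h7 h8
      simp [h6, h7, h8, harr]
    · simp only [Function.update_self, ne_eq, Nat.reduceEqDiff, not_false_eq_true,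
        Function.update_of_ne]
      exact ht.succ rfl
  · subst hs₁
    refine ⟨by simp [Prog.run, Expr.eval], fun r hr => by simp [Prog.run, hr], fun _ _ _ _ => rfl,
      rfl, ?_⟩
    have e : ((Prog.assign 2 (.lit 0)).run s₀).reg 2 = 0 := by simp [Prog.run, Expr.eval]
    rw [e]
    refine ⟨fun v => ?_, ?_, ?_, ?_, ?_, ?_⟩
    · simp [Prog.run, h6]
    all_goals intro j hj; omega
  · have : (Prog.assign 2 (.lit 0)).bound + (s₀.reg 1 + 1) *
        ((Test.lt (.reg 2) (.reg 1)).cost + tallyStep.bound) ≤ 2 + (s₀.reg 1 + 1) * 45 :=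
      Nat.add_le_add (by decide) (Nat.mul_le_mul_left _ (by decide))
    omega
  · rintro s ⟨⟨n, hi, hreg, harr, hout, ht⟩, hb⟩
    simp only [Test.holds, Expr.eval, hreg 1 (by decide)] at hb
    have : s.reg 2 = s₀.reg 1 := by omega
    rw [this] at ht
    exact ⟨hreg, harr, hout, ht⟩

/-! ### Scanning for forced nodes -/

section Scan

variable {w deg fst lst : ℕ → ℕ} {m : ℕ}

theorem IsTally.deg_pos (h : IsTally w deg fst lst m) {i : ℕ} (hi : i < m) : 0 < deg (w i) := by
  rw [h.deg_eq]
  exact Finset.card_pos.2 ⟨i, by simp [hi]⟩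

theorem IsTally.eq_of_deg_one (h : IsTally w deg fst lst m) {i j : ℕ} (hi : i < m) (hj : j < m)
    (hd : deg (w i) = 1) (he : w j = w i) : j = i := by
  rw [h.deg_eq, Finset.card_eq_one] at hd
  obtain ⟨a, ha⟩ := hd
  have key : ∀ j, j < m ∧ w j = w i ↔ j = a := by
    intro j
    have := congrArg (j ∈ ·) ha
    simpa using this
  rw [(key j).1 ⟨hj, he⟩, (key i).1 ⟨hi, rfl⟩]

theorem IsTally.of_deg_two (h : IsTally w deg fst lst m) {i : ℕ} (hi : i < m)
    (hd : deg (w i) = 2) :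
    fst (w i) < lst (w i) ∧ ∀ j < m, w j = w i → j = fst (w i) ∨ j = lst (w i) := by
  rw [h.deg_eq, Finset.card_eq_two] at hd
  obtain ⟨a, b, hab, hs⟩ := hd
  have key : ∀ j, j < m ∧ w j = w i ↔ j = a ∨ j = b := by
    intro j
    have := congrArg (j ∈ ·) hs
    simpa using this
  have hle := (h.fst_le i hi).trans (h.le_lst i hi)
  have hl := h.lst_lt i hi
  have k1 := (key _).1 ⟨by omega, h.w_fst i hi⟩
  have k2 := (key _).1 ⟨hl, h.w_lst i hi⟩
  obtain ⟨ha, hwa⟩ := (key a).2 (Or.inl rfl)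
  obtain ⟨hb, hwb⟩ := (key b).2 (Or.inr rfl)
  have f1 := h.fst_le a ha
  have f2 := h.le_lst a ha
  have f3 := h.fst_le b hb
  have f4 := h.le_lst b hb
  rw [hwa] at f1 f2
  rw [hwb] at f3 f4
  refine ⟨by omega, fun j hj he => ?_⟩
  have := (key j).1 ⟨hj, he⟩
  omega

/-- Some node is met both between the first and the last occurrence of `v` and outside. -/
def Crossed (w fst lst : ℕ → ℕ) (v : ℕ) : Prop :=
  ∃ j, fst v < j ∧ j < lst v ∧ (fst (w j) < fst v ∨ lst v < lst (w j))

/-- The invariant of the scan before position `i`: the stack holds, innermost first, the open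
nodes of degree two that are not known to be crossed. -/
structure IsScan (w deg fst lst : ℕ → ℕ) (m i : ℕ) (S : List ℕ) (flag : ℕ → ℕ) : Prop where
  mem : ∀ v ∈ S, deg v = 2 ∧ (∃ j < m, w j = v) ∧ fst v < i ∧ i ≤ lst v ∧
    ∀ j, fst v < j → j < i → fst v ≤ fst (w j) ∧ lst (w j) ≤ lst v
  nested : S.Pairwise fun a b => fst b < fst a ∧ lst a < lst b
  crossed : ∀ j < m, deg (w j) = 2 → fst (w j) < i → i ≤ lst (w j) → w j ∉ S →
    Crossed w fst lst (w j)
  flag_iff : ∀ j < m, flag (w j) = 1 ↔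
    lst (w j) < i ∧ (deg (w j) = 1 ∨ deg (w j) = 2 ∧ ¬ Crossed w fst lst (w j))

/-- The position `i` itself witnesses that `t` is crossed. It lies strictly before `lst t`, because
at `lst t` the node met is `t`, which does not reach beyond its own interval. -/
theorem IsScan.pop {i t : ℕ} {S : List ℕ} {flag : ℕ → ℕ}
    (h : IsScan w deg fst lst m i (t :: S) flag) (ht : IsTally w deg fst lst m)
    (hx : fst (w i) < fst t ∨ lst t < lst (w i)) : IsScan w deg fst lst m i S flag := by
  refine ⟨fun v hv => h.mem v (List.mem_cons_of_mem _ hv), h.nested.of_cons, ?_, h.flag_iff⟩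
  intro j hj hd h1 h2 hS
  by_cases hjt : w j = t
  · subst hjt
    have hne : i ≠ lst (w j) := by
      intro he
      have := ht.w_lst j hj
      rw [← he] at this
      rw [this] at hx
      omega
    exact ⟨i, h1, by omega, hx⟩
  · exact h.crossed j hj hd h1 h2 (by simp [hjt, hS])

/-- The intervals on the stack are nested, so comparing with the top alone settles all of them. This
is what keeps a round of the scan at constant cost. -/
theorem IsScan.bounds {i : ℕ} {S : List ℕ} {flag : ℕ → ℕ}
    (h : IsScan w deg fst lst m i S flag)
    (htop : ∀ t ∈ S.head?, fst t ≤ fst (w i) ∧ lst (w i) ≤ lst t) :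
    ∀ v ∈ S, fst v ≤ fst (w i) ∧ lst (w i) ≤ lst v := by
  rcases S with _ | ⟨t, S⟩
  · simp
  · have ht := htop t rfl
    intro v hv
    rcases List.mem_cons.1 hv with rfl | hv
    · exact ht
    · have := (List.pairwise_cons.1 h.nested).1 v hv
      omega

theorem IsTally.eq_of_lst_eq (ht : IsTally w deg fst lst m) {i j : ℕ} (hj : j < m)
    (h : lst (w j) = i) : w j = w i := by
  rw [← h, ht.w_lst j hj]

theorem IsTally.eq_of_fst_eq (ht : IsTally w deg fst lst m) {i j : ℕ} (hj : j < m)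
    (h : fst (w j) = i) : w j = w i := by
  rw [← h, ht.w_fst j hj]

/-- Passing a position whose node is not on the stack. -/
theorem IsScan.advance {i : ℕ} {S : List ℕ} {flag flag' : ℕ → ℕ}
    (h : IsScan w deg fst lst m i S flag) (ht : IsTally w deg fst lst m) (hi : i < m)
    (htop : ∀ t ∈ S.head?, fst t ≤ fst (w i) ∧ lst (w i) ≤ lst t)
    (hx : w i ∉ S) (hd : deg (w i) = 2 → fst (w i) < i)
    (hflag : ∀ v, v ≠ w i → flag' v = flag v)
    (hflagx : lst (w i) = i →
      (flag' (w i) = 1 ↔ deg (w i) = 1 ∨ deg (w i) = 2 ∧ ¬ Crossed w fst lst (w i)))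
    (hflagx' : lst (w i) ≠ i → flag' (w i) = flag (w i)) :
    IsScan w deg fst lst m (i + 1) S flag' := by
  have hb := h.bounds htop
  have hli := ht.le_lst i hi
  refine ⟨?_, h.nested, ?_, ?_⟩
  · intro v hv
    obtain ⟨h1, ⟨a, ha, rfl⟩, h3, h4, h5⟩ := h.mem v hv
    have hbv := hb _ hv
    have hne : lst (w a) ≠ i := fun he => hx (by rw [← ht.eq_of_lst_eq ha he]; exact hv)
    refine ⟨h1, ⟨a, ha, rfl⟩, by omega, by omega, fun j hj1 hj2 => ?_⟩
    rcases Nat.lt_succ_iff_lt_or_eq.1 hj2 with hj2 | rfl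
    · exact h5 j hj1 hj2
    · exact hbv
  · intro j hj hdj h1 h2 hS
    have : fst (w j) ≠ i := by
      intro he
      have h3 := ht.eq_of_fst_eq hj he
      rw [h3] at hdj he
      have := hd hdj
      omega
    exact h.crossed j hj hdj (by omega) (by omega) hS
  · intro j hj
    by_cases hji : w j = w i
    · rw [hji]
      by_cases hl : lst (w i) = i
      · rw [hflagx hl]
        exact ⟨fun h' => ⟨by omega, h'⟩, fun h' => h'.2⟩
      · rw [hflagx' hl, h.flag_iff i hi]
        have : lst (w i) < i ↔ lst (w i) < i + 1 := by omega
        rw [this]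
    · have hl : lst (w j) ≠ i := fun he => hji (ht.eq_of_lst_eq hj he)
      rw [hflag _ hji, h.flag_iff j hj]
      have : lst (w j) < i ↔ lst (w j) < i + 1 := by omega
      rw [this]

/-- The new interval lies strictly inside all those on the stack, since different nodes have
different last occurrences. -/
theorem IsScan.advance_push {i : ℕ} {S : List ℕ} {flag : ℕ → ℕ}
    (h : IsScan w deg fst lst m i S flag) (ht : IsTally w deg fst lst m) (hi : i < m)
    (htop : ∀ t ∈ S.head?, fst t ≤ fst (w i) ∧ lst (w i) ≤ lst t)
    (hd : deg (w i) = 2) (hf : fst (w i) = i) :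
    IsScan w deg fst lst m (i + 1) (w i :: S) flag := by
  have hb := h.bounds htop
  obtain ⟨hlt, -⟩ := ht.of_deg_two hi hd
  have hx : w i ∉ S := fun hx => by
    have := (h.mem _ hx).2.2.1
    omega
  have hstrict : ∀ v ∈ S, fst v < fst (w i) ∧ lst (w i) < lst v := by
    intro v hv
    obtain ⟨h1, ⟨a, ha, rfl⟩, h3, h4, h5⟩ := h.mem v hv
    have hbv := hb _ hv
    refine ⟨by omega, lt_of_le_of_ne hbv.2 fun he => hx ?_⟩
    rw [← ht.w_lst i hi, he, ht.w_lst a ha]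
    exact hv
  refine ⟨?_, List.pairwise_cons.2 ⟨hstrict, h.nested⟩, ?_, ?_⟩
  · intro v hv
    rcases List.mem_cons.1 hv with rfl | hv
    · exact ⟨hd, ⟨i, hi, rfl⟩, by omega, by omega, fun j _ _ => by omega⟩
    obtain ⟨h1, h2, h3, h4, h5⟩ := h.mem v hv
    have hbv := hstrict _ hv
    refine ⟨h1, h2, by omega, by omega, fun j hj1 hj2 => ?_⟩
    rcases Nat.lt_succ_iff_lt_or_eq.1 hj2 with hj2 | rfl
    · exact h5 j hj1 hj2
    · omega
  · intro j hj hdj h1 h2 hS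
    have hne : w j ≠ w i := fun he => hS (by simp [he])
    have : fst (w j) ≠ i := fun he => hne (ht.eq_of_fst_eq hj he)
    exact h.crossed j hj hdj (by omega) (by omega) fun hm => hS (List.mem_cons_of_mem _ hm)
  · intro j hj
    have hl : lst (w j) ≠ i := fun he => by
      rw [ht.eq_of_lst_eq hj he] at he
      omega
    rw [h.flag_iff j hj]
    have : lst (w j) < i ↔ lst (w j) < i + 1 := by omega
    rw [this]

/-- A node still on the stack at its last occurrence has been compared with every node met since its
first one, so it is not crossed. -/
theorem IsScan.advance_close {i : ℕ} {S : List ℕ} {flag flag' : ℕ → ℕ}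
    (h : IsScan w deg fst lst m i (w i :: S) flag) (ht : IsTally w deg fst lst m) (hi : i < m)
    (hd : deg (w i) = 2) (hf : fst (w i) ≠ i)
    (hflag : ∀ v, v ≠ w i → flag' v = flag v) (hflagx : flag' (w i) = 1) :
    IsScan w deg fst lst m (i + 1) S flag' := by
  obtain ⟨hlt, hocc⟩ := ht.of_deg_two hi hd
  have hl : lst (w i) = i := by
    rcases hocc i hi rfl with h1 | h1
    · exact (hf h1.symm).elim
    · exact h1.symm
  obtain ⟨hn1, hn2⟩ := List.pairwise_cons.1 h.nested
  have hxm := h.mem (w i) List.mem_cons_self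
  have hnc : ¬ Crossed w fst lst (w i) := by
    rintro ⟨j, h1, h2, h3⟩
    have := hxm.2.2.2.2 j h1 (by omega)
    omega
  refine ⟨?_, hn2, ?_, ?_⟩
  · intro v hv
    obtain ⟨h1, h2, h3, h4, h5⟩ := h.mem v (List.mem_cons_of_mem _ hv)
    have hbv := hn1 v hv
    refine ⟨h1, h2, by omega, by omega, fun j hj1 hj2 => ?_⟩
    rcases Nat.lt_succ_iff_lt_or_eq.1 hj2 with hj2 | rfl
    · exact h5 j hj1 hj2
    · omega
  · intro j hj hdj h1 h2 hS
    have hne : w j ≠ w i := fun he => by rw [he] at h2; omega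
    have : fst (w j) ≠ i := fun he => hne (ht.eq_of_fst_eq hj he)
    exact h.crossed j hj hdj (by omega) (by omega) (by simp [hne, hS])
  · intro j hj
    by_cases hji : w j = w i
    · rw [hji, hflagx]
      exact ⟨fun _ => ⟨by omega, Or.inr ⟨hd, hnc⟩⟩, fun _ => rfl⟩
    · have hl : lst (w j) ≠ i := fun he => hji (ht.eq_of_lst_eq hj he)
      rw [hflag _ hji, h.flag_iff j hj]
      have : lst (w j) < i ↔ lst (w j) < i + 1 := by omega
      rw [this]

end Scan

/-- The body of `scan`. -/
def scanStep : Prog :=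
  .ite (.and (.lt (.lit 0) (.reg 3))
      (.not (.and
        (.not (.lt (.get 7 (.get 5 (.reg 2))) (.get 7 (.get 4 (.pred (.reg 3))))))
        (.not (.lt (.get 8 (.get 4 (.pred (.reg 3)))) (.get 8 (.get 5 (.reg 2))))))))
    (.assign 3 (.pred (.reg 3)))
    (.seq
      (.ite (.eq (.get 6 (.get 5 (.reg 2))) (.lit 1))
        (.store 9 (.get 5 (.reg 2)) (.lit 1))
        (.ite (.eq (.get 6 (.get 5 (.reg 2))) (.lit 2))
          (.ite (.eq (.get 7 (.get 5 (.reg 2))) (.reg 2))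
            (.seq (.store 4 (.reg 3) (.get 5 (.reg 2))) (.assign 3 (.succ (.reg 3))))
            (.ite (.and (.lt (.lit 0) (.reg 3))
                (.eq (.get 4 (.pred (.reg 3))) (.get 5 (.reg 2))))
              (.seq (.store 9 (.get 5 (.reg 2)) (.lit 1)) (.assign 3 (.pred (.reg 3))))
              .skip))
          .skip))
      (.assign 2 (.succ (.reg 2))))

/-- Set, in the array `9`, the flags of the forced nodes of the circuit in the array `5`, with a
stack in the array `4`, whose size is in register `3`. -/
def scan : Prog :=
  .seq (.assign 2 (.lit 0)) (.while (.lt (.reg 2) (.reg 1)) scanStep)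

/-- A round either drops a crossed top and stays at its position, or advances and adds at most one
stack entry. The final alternative is what the time bound of the scan rests on. -/
theorem scanStep_spec {s : State} {w deg fst lst : ℕ → ℕ} {m : ℕ} {S : List ℕ}
    (h5 : s.arr 5 = w) (h6 : s.arr 6 = deg) (h7 : s.arr 7 = fst) (h8 : s.arr 8 = lst)
    (h3 : S.length = s.reg 3) (hstk : IsStack (s.arr 4) S) (ht : IsTally w deg fst lst m)
    (hi : s.reg 2 < m) (h : IsScan w deg fst lst m (s.reg 2) S (s.arr 9)) :
    (∀ r, r ≠ 2 → r ≠ 3 → (scanStep.run s).reg r = s.reg r) ∧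
    (∀ a, a ≠ 4 → a ≠ 9 → (scanStep.run s).arr a = s.arr a) ∧
    (scanStep.run s).out = s.out ∧
    ∃ S' : List ℕ, S'.length = (scanStep.run s).reg 3 ∧ IsStack ((scanStep.run s).arr 4) S' ∧
      IsScan w deg fst lst m ((scanStep.run s).reg 2) S' ((scanStep.run s).arr 9) ∧
      ((scanStep.run s).reg 2 = s.reg 2 ∧ S'.length < S.length ∨
        (scanStep.run s).reg 2 = s.reg 2 + 1 ∧ S'.length ≤ S.length + 1) := by
  have hdp := ht.deg_pos hi
  by_cases hpop : ∃ t S', S = t :: S' ∧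
      (fst (w (s.reg 2)) < fst t ∨ lst t < lst (w (s.reg 2)))
  · obtain ⟨t, S', rfl, hx⟩ := hpop
    have h3' : s.reg 3 = S'.length + 1 := h3.symm
    have hr : scanStep.run s = { s with reg := Function.update s.reg 3 S'.length } := by
      have htest : (Test.and (.lt (.lit 0) (.reg 3)) (.not (.and
          (.not (.lt (.get 7 (.get 5 (.reg 2))) (.get 7 (.get 4 (.pred (.reg 3))))))
          (.not (.lt (.get 8 (.get 4 (.pred (.reg 3)))) (.get 8 (.get 5 (.reg 2)))))))).holds s := by
        simp only [Test.holds, Expr.eval, h3', Nat.add_sub_cancel, hstk.1, h5, h7, h8]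
        omega
      rw [scanStep, Prog.run, if_pos htest]
      simp [Prog.run, Expr.eval, h3']
    rw [hr]
    refine ⟨fun r _ h => by simp [h], fun _ _ _ => rfl, rfl, S', by simp, hstk.2, ?_, ?_⟩
    · simpa using h.pop ht hx
    · left; simp
  have htop : ∀ t ∈ S.head?, fst t ≤ fst (w (s.reg 2)) ∧ lst (w (s.reg 2)) ≤ lst t := by
    intro t hS
    rcases S with _ | ⟨t', S'⟩
    · simp at hS
    obtain rfl : t' = t := by simpa using hS
    by_contra hcon
    exact hpop ⟨t', S', rfl, by omega⟩
  have htest : ¬ (0 < s.reg 3 ∧ ¬ (¬ fst (w (s.reg 2)) < fst (s.arr 4 (s.reg 3 - 1)) ∧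
      ¬ lst (s.arr 4 (s.reg 3 - 1)) < lst (w (s.reg 2)))) := by
    rintro ⟨h0, hcon⟩
    rcases S with _ | ⟨t, S'⟩
    · simp at h3; omega
    have h3' : s.reg 3 = S'.length + 1 := h3.symm
    rw [h3', Nat.add_sub_cancel, hstk.1] at hcon
    exact hpop ⟨t, S', rfl, by omega⟩
  have hnotmem : deg (w (s.reg 2)) ≠ 2 → w (s.reg 2) ∉ S := fun hd hm => hd (h.mem _ hm).1
  by_cases hd1 : deg (w (s.reg 2)) = 1
  · have hr : scanStep.run s =
        { s with
          reg := Function.update s.reg 2 (s.reg 2 + 1)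
          arr := Function.update s.arr 9 (Function.update (s.arr 9) (w (s.reg 2)) 1) } := by
      rw [scanStep, Prog.run, if_neg (by simpa only [Test.holds, Expr.eval, h5, h7, h8] using htest)]
      simp [Prog.run, Test.holds, Expr.eval, h5, h6, hd1]
    rw [hr]
    refine ⟨fun r h _ => by simp [h], fun a _ h => by simp [h], rfl, S, ?_⟩
    simp only [Function.update_self, ne_eq, Nat.reduceEqDiff, not_false_eq_true,
      Function.update_of_ne]
    refine ⟨h3, hstk, h.advance ht hi htop (hnotmem (by omega)) (by omega)
      (fun v hv => by simp [hv]) (fun _ => by simp [hd1]) (fun hne => (hne ?_).elim),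
      by right; exact ⟨trivial, by omega⟩⟩
    exact ht.eq_of_deg_one hi (ht.lst_lt _ hi) hd1 (ht.w_lst _ hi)
  by_cases hd2 : deg (w (s.reg 2)) = 2
  swap
  · have hr : scanStep.run s = { s with reg := Function.update s.reg 2 (s.reg 2 + 1) } := by
      rw [scanStep, Prog.run, if_neg (by simpa only [Test.holds, Expr.eval, h5, h7, h8] using htest)]
      simp [Prog.run, Test.holds, Expr.eval, h5, h6, hd1, hd2]
    rw [hr]
    refine ⟨fun r h _ => by simp [h], fun a _ _ => rfl, rfl, S, ?_⟩
    simp only [Function.update_self, ne_eq, Nat.reduceEqDiff, not_false_eq_true,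
      Function.update_of_ne]
    refine ⟨h3, hstk, h.advance ht hi htop (hnotmem hd2) (by omega)
      (fun v _ => rfl) (fun _ => ?_) (fun _ => rfl), by right; exact ⟨trivial, by omega⟩⟩
    rw [h.flag_iff _ hi]
    simp [hd1, hd2]
  by_cases hf : fst (w (s.reg 2)) = s.reg 2
  · have hr : scanStep.run s =
        { s with
          reg := Function.update (Function.update s.reg 3 (s.reg 3 + 1)) 2 (s.reg 2 + 1)
          arr := Function.update s.arr 4 (Function.update (s.arr 4) (s.reg 3) (w (s.reg 2))) } := by
      rw [scanStep, Prog.run, if_neg (by simpa only [Test.holds, Expr.eval, h5, h7, h8] using htest)]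
      simp [Prog.run, Test.holds, Expr.eval, h5, h6, h7, hd2, hf]
    rw [hr]
    refine ⟨fun r h h' => by simp [h, h'], fun a h _ => by simp [h], rfl, w (s.reg 2) :: S, ?_⟩
    simp only [Function.update_self, ne_eq, Nat.reduceEqDiff, not_false_eq_true,
      Function.update_of_ne]
    refine ⟨by simp [h3], ?_, h.advance_push ht hi htop hd2 hf,
      by right; exact ⟨trivial, by simp⟩⟩
    rw [← h3]
    exact hstk.push _
  obtain ⟨hlt, hocc⟩ := ht.of_deg_two hi hd2
  have hfi := ht.fst_le _ hi
  have hl : lst (w (s.reg 2)) = s.reg 2 := by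
    rcases hocc _ hi rfl with h1 | h1
    · exact (hf h1.symm).elim
    · exact h1.symm
  by_cases hclose : ∃ S', S = w (s.reg 2) :: S'
  · obtain ⟨S', rfl⟩ := hclose
    have h3' : s.reg 3 = S'.length + 1 := h3.symm
    have hr : scanStep.run s =
        { s with
          reg := Function.update (Function.update s.reg 3 S'.length) 2 (s.reg 2 + 1)
          arr := Function.update s.arr 9 (Function.update (s.arr 9) (w (s.reg 2)) 1) } := by
      rw [scanStep, Prog.run, if_neg (by simpa only [Test.holds, Expr.eval, h5, h7, h8] using htest)]
      simp [Prog.run, Test.holds, Expr.eval, h5, h6, h7, hd2, hf, h3', hstk.1]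
    rw [hr]
    refine ⟨fun r h h' => by simp [h, h'], fun a _ h => by simp [h], rfl, S', ?_⟩
    simp only [Function.update_self, ne_eq, Nat.reduceEqDiff, not_false_eq_true,
      Function.update_of_ne]
    exact ⟨trivial, hstk.2, h.advance_close ht hi hd2 hf (fun v hv => by simp [hv]) (by simp),
      by right; exact ⟨trivial, by simp; omega⟩⟩
  -- Deeper in the stack it would strictly enclose the top, against `htop`; so looking at the top
  -- decides membership.
  · have hxS : w (s.reg 2) ∉ S := by
      intro hm
      rcases S with _ | ⟨t, S'⟩
      · simp at hm
      rcases List.mem_cons.1 hm with rfl | hm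
      · exact hclose ⟨S', rfl⟩
      · have h1 := (List.pairwise_cons.1 h.nested).1 _ hm
        have h2 := htop t rfl
        omega
    have hr : scanStep.run s = { s with reg := Function.update s.reg 2 (s.reg 2 + 1) } := by
      rw [scanStep, Prog.run, if_neg (by simpa only [Test.holds, Expr.eval, h5, h7, h8] using htest)]
      have hnc : ¬ (0 < s.reg 3 ∧ s.arr 4 (s.reg 3 - 1) = w (s.reg 2)) := by
        rintro ⟨h0, he⟩
        rcases S with _ | ⟨t, S'⟩
        · simp at h3; omega
        have h3' : s.reg 3 = S'.length + 1 := h3.symm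
        rw [h3', Nat.add_sub_cancel, hstk.1] at he
        exact hclose ⟨S', by rw [he]⟩
      simp only [Prog.run, Test.holds, Expr.eval, h5, h6, h7, hd2, hf, if_neg hnc]
      simp
    rw [hr]
    refine ⟨fun r h _ => by simp [h], fun a _ _ => rfl, rfl, S, ?_⟩
    simp only [Function.update_self, ne_eq, Nat.reduceEqDiff, not_false_eq_true,
      Function.update_of_ne]
    refine ⟨h3, hstk, h.advance ht hi htop hxS (by omega)
      (fun v _ => rfl) (fun _ => ?_) (fun _ => rfl), by right; exact ⟨trivial, by omega⟩⟩
    -- An open node missing from the stack was dropped as crossed, so leaving its flag unset is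
    -- right.
    have hcr := h.crossed _ hi hd2 (by omega) (by omega) hxS
    rw [h.flag_iff _ hi]
    simp [hcr, hd1, hl]

/-- Twice the number of remaining positions plus the stack height decreases in every round, although
a single position may cause many pops. -/
theorem scan_runs (s₀ : State) (h3 : s₀.reg 3 = 0) (h9 : s₀.arr 9 = 0)
    (ht : IsTally (s₀.arr 5) (s₀.arr 6) (s₀.arr 7) (s₀.arr 8) (s₀.reg 1)) :
    Runs scan s₀ ((s₀.reg 1 + 1) * 300) fun s =>
      (∀ r, r ≠ 2 → r ≠ 3 → s.reg r = s₀.reg r) ∧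
      (∀ a, a ≠ 4 → a ≠ 9 → s.arr a = s₀.arr a) ∧ s.out = s₀.out ∧
      ∀ j < s₀.reg 1, s.arr 9 (s₀.arr 5 j) = 1 ↔
        (s₀.arr 6 (s₀.arr 5 j) = 1 ∨ s₀.arr 6 (s₀.arr 5 j) = 2 ∧
          ¬ Crossed (s₀.arr 5) (s₀.arr 7) (s₀.arr 8) (s₀.arr 5 j)) := by
  refine (Runs.seq (Runs.of_loopFree (p := .assign 2 (.lit 0)) trivial
    (Q := fun s => s = (Prog.assign 2 (.lit 0)).run s₀) rfl) (fun s₁ hs₁ =>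
    Runs.loop (p := scanStep) (by simp [scanStep, Prog.LoopFree])
    (I := fun s n => (∀ r, r ≠ 2 → r ≠ 3 → s.reg r = s₀.reg r) ∧
      (∀ a, a ≠ 4 → a ≠ 9 → s.arr a = s₀.arr a) ∧ s.out = s₀.out ∧
      ∃ S : List ℕ, S.length = s.reg 3 ∧ IsStack (s.arr 4) S ∧ s.reg 2 ≤ s₀.reg 1 ∧
        IsScan (s₀.arr 5) (s₀.arr 6) (s₀.arr 7) (s₀.arr 8) (s₀.reg 1) (s.reg 2) S (s.arr 9) ∧
        n = 2 * (s₀.reg 1 - s.reg 2) + S.length)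
    ?_ (n := 2 * s₀.reg 1) ?_)).mono ?_ ?_
  · rintro s n ⟨hreg, harr, hout, S, hlen, hstk, hle, hscan, hn⟩ hb
    simp only [Test.holds, Expr.eval, hreg 1 (by decide) (by decide)] at hb
    obtain ⟨g1, g2, g3, S', g4, g5, g6, g7⟩ := scanStep_spec (harr 5 (by decide) (by decide))
      (harr 6 (by decide) (by decide)) (harr 7 (by decide) (by decide))
      (harr 8 (by decide) (by decide)) hlen hstk ht hb hscan
    refine ⟨_, ?_, fun r hr hr' => (g1 r hr hr').trans (hreg r hr hr'),
      fun a ha ha' => (g2 a ha ha').trans (harr a ha ha'), g3.trans hout, S', g4, g5, ?_, g6, rfl⟩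
    all_goals omega
  · subst hs₁
    refine ⟨fun r hr _ => by simp [Prog.run, hr], fun _ _ _ => rfl, rfl, [], ?_, trivial, ?_, ?_, ?_⟩
    · simp [Prog.run, h3]
    · simp [Prog.run, Expr.eval]
    · have e : ((Prog.assign 2 (.lit 0)).run s₀).reg 2 = 0 := by simp [Prog.run, Expr.eval]
      rw [e]
      refine ⟨by simp, List.Pairwise.nil, fun j _ _ h => by omega, fun j _ => ?_⟩
      simp [Prog.run, h9]
    · simp [Prog.run, Expr.eval]
  · have : (Prog.assign 2 (.lit 0)).bound + (2 * s₀.reg 1 + 1) *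
        ((Test.lt (.reg 2) (.reg 1)).cost + scanStep.bound) ≤ 2 + (2 * s₀.reg 1 + 1) * 140 :=
      Nat.add_le_add (by decide) (Nat.mul_le_mul_left _ (by decide))
    omega
  · rintro s ⟨⟨n, hreg, harr, hout, S, hlen, hstk, hle, hscan, hn⟩, hb⟩
    simp only [Test.holds, Expr.eval, hreg 1 (by decide) (by decide)] at hb
    have : s.reg 2 = s₀.reg 1 := by omega
    refine ⟨hreg, harr, hout, fun j hj => ?_⟩
    rw [hscan.flag_iff j hj, this]
    exact ⟨fun h => h.2, fun h => ⟨ht.lst_lt j hj, h⟩⟩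

/-! ### Writing the output -/

/-- Find, in register `5`, the first position of the circuit whose node is not flagged; if there
is none, take the position `0`. -/
def findStart : Prog :=
  .seq (.assign 5 (.lit 0))
    (.seq (.while (.and (.lt (.reg 5) (.reg 1)) (.eq (.get 9 (.get 5 (.reg 5))) (.lit 1)))
        (.assign 5 (.succ (.reg 5))))
      (.ite (.eq (.reg 5) (.reg 1)) (.assign 5 (.lit 0)) .skip))

theorem findStart_runs (s₀ : State) :
    Runs findStart s₀ ((s₀.reg 1 + 1) * 30) fun s =>
      (∀ r, r ≠ 5 → s.reg r = s₀.reg r) ∧ s.arr = s₀.arr ∧ s.out = s₀.out ∧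
      (0 < s₀.reg 1 → s.reg 5 < s₀.reg 1 ∧
        (s₀.arr 9 (s₀.arr 5 (s.reg 5)) ≠ 1 ∨ ∀ j < s₀.reg 1, s₀.arr 9 (s₀.arr 5 j) = 1)) := by
  refine (Runs.seq (Runs.of_loopFree (p := .assign 5 (.lit 0)) trivial
    (Q := fun s => s = (Prog.assign 5 (.lit 0)).run s₀) rfl) (fun s₁ hs₁ =>
    Runs.seq (B := 9) (Runs.loop (p := .assign 5 (.succ (.reg 5))) trivial
    (I := fun s n => s.reg 5 + n = s₀.reg 1 ∧ (∀ r, r ≠ 5 → s.reg r = s₀.reg r) ∧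
      s.arr = s₀.arr ∧ s.out = s₀.out ∧ ∀ j < s.reg 5, s₀.arr 9 (s₀.arr 5 j) = 1)
    ?_ (n := s₀.reg 1) ?_) (fun s hs => ?_))).mono (B := (s₀.reg 1 + 1) * 30) ?_ (fun s hs => hs)
  · rintro s n ⟨hi, hreg, harr, hout, hall⟩ hb
    have h1 : s.reg 1 = s₀.reg 1 := hreg 1 (by norm_num)
    simp only [Test.holds, Expr.eval, h1, harr] at hb
    refine ⟨n - 1, by omega, ?_, ?_, harr, hout, ?_⟩
    · simp only [Prog.run, Expr.eval, Function.update_self]; omega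
    · intro r hr
      simp [Prog.run, hr, hreg]
    · simp only [Prog.run, Expr.eval, Function.update_self]
      intro j hj
      rcases Nat.lt_succ_iff_lt_or_eq.1 hj with hj | rfl
      · exact hall j hj
      · exact hb.2
  · subst hs₁
    exact ⟨by simp [Prog.run, Expr.eval], fun r hr => by simp [Prog.run, hr], rfl, rfl,
      by simp [Prog.run, Expr.eval]⟩
  · obtain ⟨⟨n, hi, hreg, harr, hout, hall⟩, hb⟩ := hs
    simp only [Test.holds, Expr.eval, hreg 1 (by decide), harr] at hb
    refine (Runs.of_loopFree (by simp [Prog.LoopFree]) ?_).mono (by decide) (fun s h => h)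
    by_cases hm : s.reg 5 = s₀.reg 1
    · have hr : (Prog.ite (.eq (.reg 5) (.reg 1)) (.assign 5 (.lit 0)) .skip).run s =
          { s with reg := Function.update s.reg 5 0 } := by
        simp [Prog.run, Test.holds, Expr.eval, hm, hreg]
      rw [hr]
      refine ⟨fun r hr => by simp [hr, hreg], harr, hout, fun h0 => ⟨by simpa using h0, Or.inr ?_⟩⟩
      rw [← hm]; exact hall
    · have hr : (Prog.ite (.eq (.reg 5) (.reg 1)) (.assign 5 (.lit 0)) .skip).run s = s := by
        simp [Prog.run, Test.holds, Expr.eval, hm, hreg]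
      rw [hr]
      refine ⟨hreg, harr, hout, fun h0 => ⟨by omega, Or.inl fun h1 => hb ⟨by omega, h1⟩⟩⟩
  · have : (Prog.assign 5 (.lit 0)).bound + ((s₀.reg 1 + 1) *
        ((Test.and (.lt (.reg 5) (.reg 1)) (.eq (.get 9 (.get 5 (.reg 5))) (.lit 1))).cost +
          (Prog.assign 5 (.succ (.reg 5))).bound) + 9) ≤ 2 + ((s₀.reg 1 + 1) * 15 + 9) :=
      Nat.add_le_add (by decide) (Nat.add_le_add (Nat.mul_le_mul_left _ (by decide)) le_rfl)
    omega

/-- The body of `emit`. -/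
def emitStep : Prog :=
  .seq (.assign 5 (.succ (.reg 5)))
    (.seq (.ite (.eq (.reg 5) (.reg 1)) (.assign 5 (.lit 0)) .skip)
      (.seq (.assign 6 (.pred (.reg 6)))
        (.seq (.write (.succ (.get 5 (.reg 5))))
          (.ite (.and (.eq (.get 9 (.get 5 (.reg 5))) (.lit 1)) (.lt (.lit 0) (.reg 6))) .skip
            (.seq (.write (.lit 0))
              (.ite (.lt (.lit 0) (.reg 6)) (.write (.succ (.get 5 (.reg 5)))) .skip))))))

/-- Write the circuit, starting at the position in register `5`, cut at the nodes that are not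
flagged; register `6` counts the edges that are left. -/
def emit : Prog :=
  .seq (.assign 6 (.reg 1))
    (.seq (.ite (.lt (.lit 0) (.reg 1)) (.write (.succ (.get 5 (.reg 5)))) .skip)
      (.while (.lt (.lit 0) (.reg 6)) emitStep))

/-- A walk as it is written on the output tape, without the final `0`. -/
def encodeNodes {n : ℕ} (W : List (Fin n)) : List ℕ :=
  W.map fun v => (v : ℕ) + 1

theorem encodeWalks_cons {n : ℕ} (W : List (Fin n)) (L : List (List (Fin n))) :
    encodeWalks (W :: L) = encodeNodes W ++ [0] ++ encodeWalks L := rfl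

theorem emit_runs_zero (s₀ : State) (h1 : s₀.reg 1 = 0) :
    Runs emit s₀ 200 fun s => s.out = s₀.out := by
  refine (Runs.seq (Runs.of_loopFree (p := .assign 6 (.reg 1)) trivial
    (Q := fun s => s.reg 6 = 0 ∧ s.reg 1 = 0 ∧ s.out = s₀.out) ?_) (fun s₁ hs₁ =>
    Runs.seq (Runs.of_loopFree (by simp [Prog.LoopFree])
      (Q := fun s => s.reg 6 = 0 ∧ s.out = s₀.out) ?_) (fun s₂ hs₂ =>
    Runs.loop (p := emitStep) (by simp [emitStep, Prog.LoopFree])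
      (I := fun s n => s.reg 6 = 0 ∧ s.out = s₀.out ∧ n = 0) ?_ (n := 0) ?_))).mono ?_ ?_
  · simp [Prog.run, Expr.eval, h1]
  · simp [Prog.run, Test.holds, Expr.eval, hs₁]
  · rintro s n ⟨h6, -, -⟩ hb
    simp [Test.holds, Expr.eval, h6] at hb
  · exact ⟨hs₂.1, hs₂.2, rfl⟩
  · decide
  · rintro s ⟨⟨n, -, h, -⟩, -⟩
    exact h

theorem succ_mod_eq (j m : ℕ) (hm : 0 < m) :
    (j + 1) % m = if j % m + 1 = m then 0 else j % m + 1 := by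
  have hlt := Nat.mod_lt j hm
  rw [← Nat.mod_add_mod]
  split_ifs with h
  · rw [h, Nat.mod_self]
  · exact Nat.mod_eq_of_lt (by omega)

/-- The loop follows the recursion of `cutAt`: the tape holds the finished walks `pre` and the open
one `cur`, and the rest of the output is `cutAt` applied to `cur` and the `q` nodes to come. A cut
node is written twice, as the end of one walk and the start of the next, except at the very end,
where `cur` becomes empty. -/
theorem emit_runs {n : ℕ} (s₀ : State) (c : ℕ → Fin n) (F : Fin n → Prop) [DecidablePred F]
    (hm : 0 < s₀.reg 1) (hper : ∀ i, c (i + s₀.reg 1) = c i)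
    (hw : ∀ i < s₀.reg 1, s₀.arr 5 i = c i)
    (hF : ∀ i < s₀.reg 1, s₀.arr 9 (s₀.arr 5 i) = 1 ↔ F (c i))
    (hr : s₀.reg 5 < s₀.reg 1) (hout : s₀.out = []) :
    Runs emit s₀ ((s₀.reg 1 + 1) * 80) fun s =>
      s.out = encodeWalks (cutAt F [c (s₀.reg 5)] (window c (s₀.reg 5 + 1) (s₀.reg 1))) := by
  set m := s₀.reg 1 with hmdef
  set r := s₀.reg 5 with hrdef
  have hwj : ∀ j, s₀.arr 5 (j % m) = c j := by
    intro j
    rw [hw _ (Nat.mod_lt _ hm), periodic_mod hper]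
  have hFj : ∀ j, s₀.arr 9 (c j) = 1 ↔ F (c j) := by
    intro j
    rw [← hwj, hF _ (Nat.mod_lt _ hm), periodic_mod hper]
  refine (Runs.seq (Runs.of_loopFree (p := .assign 6 (.reg 1)) trivial
    (Q := fun s => s.reg 6 = m ∧ s.reg 1 = m ∧ s.reg 5 = r ∧ s.arr = s₀.arr ∧ s.out = []) ?_)
    (fun s₁ hs₁ => Runs.seq (Runs.of_loopFree (by simp [Prog.LoopFree])
      (Q := fun s => s.reg 6 = m ∧ s.reg 1 = m ∧ s.reg 5 = r ∧ s.arr = s₀.arr ∧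
        s.out = encodeNodes [c r]) ?_) (fun s₂ hs₂ =>
    Runs.loop (p := emitStep) (by simp [emitStep, Prog.LoopFree])
      (I := fun s q => s.reg 6 = q ∧ s.reg 1 = m ∧ s.arr = s₀.arr ∧
        ∃ j pre cur, j + q = r + m ∧ s.reg 5 = j % m ∧ s.out = pre ++ encodeNodes cur ∧
          encodeWalks (cutAt F [c r] (window c (r + 1) m)) =
            pre ++ encodeWalks (cutAt F cur (window c (j + 1) q)) ∧
          (q = 0 → cur = [])) ?_ (n := m) ?_))).mono ?_ ?_
  · simp [Prog.run, Expr.eval, ← hmdef, ← hrdef, hout]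
  · obtain ⟨g1, g2, g3, g4, g5⟩ := hs₁
    have := hwj r
    rw [Nat.mod_eq_of_lt hr] at this
    simp [Prog.run, Test.holds, Expr.eval, g1, g2, g3, g4, g5, hm, this, encodeNodes]
  · rintro s q ⟨h6, h1, harr, j, pre, cur, hj, h5, ho, htot, -⟩ hb
    simp only [Test.holds, Expr.eval, h6] at hb
    obtain ⟨q, rfl⟩ := Nat.exists_eq_succ_of_ne_zero hb.ne'
    rw [Nat.succ_eq_add_one, window_succ, cutAt] at htot
    have hwne : window c (j + 1 + 1) q ≠ [] ↔ 0 < q := by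
      rw [← List.length_pos_iff_ne_nil, length_window]
    have hrun : emitStep.run s =
        { reg := Function.update (Function.update s.reg 5 ((j + 1) % m)) 6 q
          arr := s₀.arr
          out := if F (c (j + 1)) ∧ 0 < q then s.out ++ [(c (j + 1) : ℕ) + 1]
            else if 0 < q then s.out ++ [(c (j + 1) : ℕ) + 1] ++ [0] ++ [(c (j + 1) : ℕ) + 1]
            else s.out ++ [(c (j + 1) : ℕ) + 1] ++ [0] } := by
      have hmod := succ_mod_eq j m hm
      have hwj' := hwj (j + 1)
      have hFj' := hFj (j + 1)
      by_cases hj1 : j % m + 1 = m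
      · rw [if_pos hj1] at hmod
        rw [hmod] at hwj' ⊢
        by_cases hf : F (c (j + 1)) <;> by_cases hq : 0 < q <;>
          simp [emitStep, Prog.run, Test.holds, Expr.eval, h6, h1, h5, hj1, harr, hwj', hFj', hf,
            hq]
      · rw [if_neg hj1] at hmod
        rw [hmod] at hwj' ⊢
        by_cases hf : F (c (j + 1)) <;> by_cases hq : 0 < q <;>
          simp [emitStep, Prog.run, Test.holds, Expr.eval, h6, h1, h5, hj1, harr, hwj', hFj', hf,
            hq]
    rw [hrun]
    refine ⟨q, by omega, by simp, by simp [h1], rfl, j + 1, ?_⟩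
    simp only [Function.update_self, ne_eq, Nat.reduceEqDiff, not_false_eq_true,
      Function.update_of_ne]
    split_ifs with hc hq
    · rw [if_pos ⟨hc.1, hwne.2 hc.2⟩] at htot
      refine ⟨pre, cur ++ [c (j + 1)], by omega, trivial, ?_, htot, by omega⟩
      simp [ho, encodeNodes]
    · rw [if_neg fun h => hc ⟨h.1, hwne.1 h.2⟩, encodeWalks_cons] at htot
      refine ⟨pre ++ (encodeNodes (cur ++ [c (j + 1)]) ++ [0]), [c (j + 1)], by omega, trivial, ?_,
        ?_, by omega⟩
      · simp [ho, encodeNodes]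
      · rw [htot, List.append_assoc pre]
    · rw [if_neg fun h => hc ⟨h.1, hwne.1 h.2⟩, encodeWalks_cons] at htot
      obtain rfl : q = 0 := by omega
      refine ⟨pre ++ (encodeNodes (cur ++ [c (j + 1)]) ++ [0]), [], by omega, trivial, ?_,
        ?_, fun _ => rfl⟩
      · simp [ho, encodeNodes]
      · rw [htot, List.append_assoc pre]; rfl
  · obtain ⟨g1, g2, g3, g4, g5⟩ := hs₂
    exact ⟨g1, g2, g4, r, [], [c r], rfl, by rw [g3, Nat.mod_eq_of_lt hr], g5, rfl, by omega⟩
  · have : (Prog.assign 6 (.reg 1)).bound + ((Prog.ite (.lt (.lit 0) (.reg 1))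
        (.write (.succ (.get 5 (.reg 5)))) .skip).bound + (m + 1) *
        ((Test.lt (.lit 0) (.reg 6)).cost + emitStep.bound)) ≤ 2 + (9 + (m + 1) * 60) :=
      Nat.add_le_add (by decide) (Nat.add_le_add (by decide) (Nat.mul_le_mul_left _ (by decide)))
    omega
  · rintro s ⟨⟨q, h6, h1, harr, j, pre, cur, hj, h5, ho, htot, hcur⟩, hb⟩
    simp only [Test.holds, Expr.eval, h6] at hb
    obtain rfl : q = 0 := by omega
    rw [hcur rfl] at ho
    rw [htot, ho]
    rfl

/-! ### The algorithm -/

/-- The complete program. -/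
def safeWalks : Prog :=
  .seq buildLists (.seq hierholzer (.seq tally (.seq scan (.seq findStart emit))))

/-- The numbers of occurrences and the first and last occurrences determine the forced nodes. -/
theorem mem_forcedNodes_iff {n : ℕ} {G : Digraph (Fin n)} {m : ℕ} {c : ℕ → Fin n}
    (hc : IsEulerSeq G m c) (hloop : ∀ v, ¬ G.Adj v v)
    (hconn : G.toSimpleGraphInclusive.Connected) {w deg fst lst : ℕ → ℕ}
    (hw : ∀ i < m, w i = c i) (ht : IsTally w deg fst lst m) {j : ℕ} (hj : j < m) :
    (deg (w j) = 1 ∨ deg (w j) = 2 ∧ ¬ Crossed w fst lst (w j)) ↔ c j ∈ forcedNodes G := by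
  classical
  have hdeg : deg (w j) = outDegree G (c j) := by
    rw [ht.deg_eq, hc.outDegree_eq]
    congr 1
    ext i
    simp only [Finset.mem_filter, Finset.mem_range]
    exact and_congr_right fun hi => by rw [hw i hi, hw j hj, Fin.val_inj]
  have hcw : ∀ a < m, ∀ b < m, w a = w b ↔ c a = c b := by
    intro a ha b hb
    rw [hw a ha, hw b hb, Fin.val_inj]
  rw [hdeg]
  refine or_congr Iff.rfl (and_congr_right fun hd => ?_)
  obtain ⟨hlt, -⟩ := ht.of_deg_two hj (hdeg.trans hd)
  have hl := ht.lst_lt j hj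
  have hp : c (fst (w j)) = c j := (hcw _ (by omega) _ hj).1 (ht.w_fst j hj)
  have hq : c (lst (w j)) = c j := (hcw _ hl _ hj).1 (ht.w_lst j hj)
  have hiff := hc.isCutNode_iff hloop hconn hlt hl (hq.trans hp.symm) (by rw [hp]; exact hd)
  rw [hp] at hiff
  rw [hiff]
  constructor
  -- If any visit to a node is outside the interval, then so is its first or its last one; comparing
  -- these two is enough.
  · intro hcr a ha1 ha2 i hi he
    rw [← hcw i hi a (by omega)] at he
    have h1 := ht.fst_le i hi
    have h2 := ht.le_lst i hi
    rw [he] at h1 h2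
    by_contra hcon
    exact hcr ⟨a, ha1, ha2, by omega⟩
  · rintro hall ⟨a, ha1, ha2, hor⟩
    have ha : a < m := by omega
    have h3 := ht.lst_lt a ha
    have h4 := ht.fst_le a ha
    have h1 := hall a ha1 ha2 _ (by omega) ((hcw _ (by omega) a ha).1 (ht.w_fst a ha))
    have h2 := hall a ha1 ha2 _ h3 ((hcw _ h3 a ha).1 (ht.w_lst a ha))
    omega

-- The circuit `C₀` serves the analysis only; the output is cut from the circuit `c` that the search
-- finds. The phases cost at most `20`, `200`, `50`, `300`, `30` and `200` times `E.length + 1`,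
-- which stays below the factor `900`.
open Classical in
theorem safeWalks_runs {n : ℕ} {G : Digraph (Fin n)} {E : List (Fin n × Fin n)}
    (hloop : ∀ v, ¬ G.Adj v v) (hconn : G.toSimpleGraphInclusive.Connected)
    {C₀ : List (Fin n)} (hC₀ : IsEulerianCircuit G C₀) (hnd : E.Nodup)
    (hE : ∀ u v, (u, v) ∈ E ↔ G.Adj u v) :
    Runs safeWalks (edgeListInput E) (900 * (E.length + 1)) fun s =>
      (E = [] ∧ s.out = encodeWalks (n := n) []) ∨
      ∃ c r, IsEulerSeq G E.length c ∧ (c r ∉ forcedNodes G ∨ forcedNodes G = Set.univ) ∧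
        s.out = encodeWalks (cutAt (· ∈ forcedNodes G) [c r] (window c (r + 1) E.length)) := by
  have i1 : (edgeListInput E).reg 1 = E.length := rfl
  have ia0 : (edgeListInput E).arr 0 = column E Prod.fst := rfl
  have ia1 : (edgeListInput E).arr 1 = column E Prod.snd := rfl
  have ia : ∀ a, 2 ≤ a → (edgeListInput E).arr a = 0 := by
    intro a ha
    funext i
    simp only [edgeListInput]
    rw [if_neg (by omega), if_neg (by omega)]
    rfl
  obtain ⟨s₁, t₁, x₁, b₁, p1, p2, p3, p4⟩ :=
    buildLists_runs (edgeListInput E) rfl (ia 2 le_rfl)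
  rw [i1] at b₁ p4
  have a0 : s₁.arr 0 = column E Prod.fst := by rw [p2 0 (by decide) (by decide), ia0]
  have a1 : s₁.arr 1 = column E Prod.snd := by rw [p2 1 (by decide) (by decide), ia1]
  obtain ⟨s₂, t₂, x₂, b₂, q1, q2, q3, q4, R, q5, q6, q7⟩ :=
    hierholzer_runs s₁ (by rw [p1 4 (by decide)]; rfl)
      (by rw [p2 4 (by decide) (by decide), ia 4 (by decide)]) E.length
      (by rw [a0, a1]; exact column_balanced hC₀ hnd hE)
      (by rw [a1, ← ia1]; exact p4)
  rw [a0, a1] at q5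
  rw [a1] at q7
  have r21 : s₂.reg 1 = E.length := by
    rw [q1 1 (by decide) (by decide), p1 1 (by decide), i1]
  have ar2 : ∀ a, 6 ≤ a → s₂.arr a = 0 := by
    intro a ha
    rw [q3 a (by omega) (by omega) (by omega), p2 a (by omega) (by omega), ia a (by omega)]
  obtain ⟨s₃, t₃, x₃, b₃, u1, u2, u3, u4⟩ := tally_runs s₂ (ar2 6 le_rfl)
  have e5 : s₃.arr 5 = s₂.arr 5 := u2 5 (by decide) (by decide) (by decide)
  have r31 : s₃.reg 1 = E.length := by rw [u1 1 (by decide), r21]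
  rw [r21, ← e5] at u4
  rw [r21] at b₃
  obtain ⟨s₄, t₄, x₄, b₄, v1, v2, v3, v4⟩ := scan_runs s₃ (by rw [u1 3 (by decide), q2])
    (by rw [u2 9 (by decide) (by decide) (by decide), ar2 9 (by decide)]) (by rw [r31]; exact u4)
  rw [r31] at b₄ v4
  have r41 : s₄.reg 1 = E.length := by rw [v1 1 (by decide) (by decide), r31]
  have e45 : s₄.arr 5 = s₃.arr 5 := v2 5 (by decide) (by decide)
  obtain ⟨s₅, t₅, x₅, b₅, w1, w2, w3, w4⟩ := findStart_runs s₄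
  have r51 : s₅.reg 1 = E.length := by rw [w1 1 (by decide), r41]
  rw [r41] at b₅ w4
  have o5 : s₅.out = [] := by rw [w3, v3, u3, q4, p3]; rfl
  have fin : ∀ s₆ t₆, Exec emit s₅ s₆ t₆ → t₆ ≤ 200 * (E.length + 1) →
      ∃ t, Exec safeWalks (edgeListInput E) s₆ t ∧ t ≤ 900 * (E.length + 1) := by
    intro s₆ t₆ x₆ b₆
    refine ⟨_, .seq _ _ _ _ _ _ _ x₁ (.seq _ _ _ _ _ _ _ x₂ (.seq _ _ _ _ _ _ _ x₃
      (.seq _ _ _ _ _ _ _ x₄ (.seq _ _ _ _ _ _ _ x₅ x₆)))), ?_⟩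
    omega
  rcases Nat.eq_zero_or_pos E.length with h0 | hpos
  · obtain ⟨s₆, t₆, x₆, b₆, y⟩ := emit_runs_zero s₅ (r51.trans h0)
    obtain ⟨t, hx, hb⟩ := fin s₆ t₆ x₆ (by omega)
    exact ⟨s₆, t, hx, hb, Or.inl ⟨List.length_eq_zero_iff.1 h0, by rw [y, o5]; rfl⟩⟩
  · obtain ⟨c, hc, hcirc⟩ := q5.exists_seq hloop hconn hC₀ hnd hE hpos q6 q7
    rw [← e5] at hcirc
    obtain ⟨w5, w6⟩ := w4 hpos
    have hflag : ∀ j < E.length, s₄.arr 9 (s₃.arr 5 j) = 1 ↔ c j ∈ forcedNodes G := by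
      intro j hj
      rw [v4 j hj, mem_forcedNodes_iff hc hloop hconn (fun i hi => hcirc i hi.le) u4 hj]
    rw [e45] at w6
    obtain ⟨s₆, t₆, x₆, b₆, y⟩ := emit_runs s₅ c (· ∈ forcedNodes G) (by rw [r51]; exact hpos)
      (by rw [r51]; exact hc.periodic)
      (by rw [r51, w2, e45]; exact fun i hi => hcirc i hi.le)
      (by rw [r51, w2, e45]; exact hflag) (by rw [r51]; exact w5) o5
    rw [r51] at y b₆
    obtain ⟨t, hx, hb⟩ := fin s₆ t₆ x₆ (by omega)
    refine ⟨s₆, t, hx, hb, Or.inr ⟨c, _, hc, ?_, y⟩⟩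
    rcases w6 with w6 | w6
    · left
      rwa [Ne, hflag _ w5] at w6
    · right
      rw [Set.eq_univ_iff_forall]
      intro v
      obtain ⟨j, hj, rfl⟩ := hc.exists_index hloop hconn v
      exact (hflag j hj).1 (w6 j hj)

end RAM

/-! ### The main theorem -/

theorem corollary2 :
    ∃ (P : RAM.Prog) (c : ℕ), ∀ (n : ℕ) (G : Digraph (Fin n)) (E : List (Fin n × Fin n)),
      (∀ v, ¬ G.Adj v v) →
      G.toSimpleGraphInclusive.Connected →
      (∃ C, EulerSafe.IsEulerianCircuit G C) →
      E.Nodup → (∀ u v, (u, v) ∈ E ↔ G.Adj u v) →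
      ∃ (s : RAM.State) (t : ℕ) (L : List (List (Fin n))),
        -- on every list of the edges of `G`, the program halts after `O(|E|)` steps with output `L`
        RAM.Exec P (RAM.edgeListInput E) s t ∧ t ≤ c * (E.length + 1) ∧
        s.out = RAM.encodeWalks L ∧
        -- if `A(G) ≠ V`, then `L` lists the maximal safe walks, each once, and these are the
        -- segments of any Eulerian circuit cut at the nodes outside `A(G)`
        (EulerSafe.forcedNodes G ≠ Set.univ →
          L.Nodup ∧ (∀ Q, Q ∈ L ↔ EulerSafe.IsMaximalSafe G Q) ∧
          ∀ C, EulerSafe.IsEulerianCircuit G C →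
            ∀ Q, EulerSafe.IsMaximalSafe G Q ↔ EulerSafe.IsCutSegment G C Q) ∧
        -- if `A(G) = V`, then there is nothing to cut: `L` consists of an Eulerian circuit `C`,
        -- unique up to rotation, and the maximal safe walks are `C` with one edge left out
        (EulerSafe.forcedNodes G = Set.univ →
          ∃ C, L = [C] ∧ EulerSafe.IsEulerianCircuit G C ∧
            (∀ C', EulerSafe.IsEulerianCircuit G C' → C'.dropLast ~r C.dropLast) ∧
            ∀ Q, EulerSafe.IsMaximalSafe G Q ↔
              EulerSafe.AppearsInCircuit Q C ∧
                EulerSafe.walkLength Q + 1 = EulerSafe.walkLength C) ∧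
        -- the walks in `L` are edge-disjoint and have total length `|E|`
        L.Pairwise (fun Q Q' => (EulerSafe.walkEdges Q).Disjoint (EulerSafe.walkEdges Q')) ∧
        (L.map EulerSafe.walkLength).sum = E.length := by

  refine ⟨RAM.safeWalks, 900, fun n G E hloop hconn hC hnd hE => ?_⟩
  obtain ⟨C₀, hC₀⟩ := hC
  obtain ⟨s, t, hx, hb, ⟨hnil, hout⟩ | ⟨c, r, hc, hr, hout⟩⟩ :=
    RAM.safeWalks_runs hloop hconn hC₀ hnd hE
  · refine ⟨s, t, _, hx, hb, hout, ?_⟩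
    subst hnil
    exact EulerSafe.edgeless_spec (fun u v h => by simpa using (hE u v).2 h) hconn.nonempty rfl
  · exact ⟨s, t, _, hx, hb, hout, hc.cutAt_spec hloop hconn hr rfl⟩
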